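/- Let $k\ge 1$ be a fixed integer. For each $n$ let $K_n\le P_n$ be non-negative integers and $p_n\in[0,1]$. Let $\mathbb{G}(n,K_n,P_n,p_n)$ be the random graph on $n$ nodes obtained as follows: each node independently receives a key ring, a uniformly random $K_n$-element subset of a common pool of $P_n$ keys; independently of the key rings, each pair of distinct nodes has a channel that is on with probability $p_n$, independently for different pairs; two distinct nodes are joined by an edge if and only if their key rings have at least one key in common and the channel between them is on. (Thus $\mathbb{G}(n,K_n,P_n,p_n)$ is the intersection of the random key graph $G(n,K_n,P_n)$ and an independent Erdős–Rényi graph $G(n,p_n)$.) Let $q_n$ be the probability that two given distinct nodes are joined by an edge in $\mathbb{G}(n,K_n,P_n,p_n)$, and, for all sufficiently large $n$, define $\alpha_n$ through $$q_n=\frac{\ln n+(k-1)\ln\ln n+\alpha_n}{n}.$$ Assume that $P_n=\Omega(n)$ and $K_n/P_n=o(1)$ as $n\to\infty$, and that $\lim_{n\to\infty}\alpha_n=\alpha^*\in(-\infty,\infty)$. Then $$\lim_{n\to\infty}\mathbb{P}\big[\mathbb{G}(n,K_n,P_n,p_n)\text{ is }k\text{-connected}\big]=\exp\!\left(-\frac{e^{-\alpha^*}}{(k-1)!}\right),$$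 where a graph is called $k$-connected if it has more than $k$ vertices and remains connected whenever fewer than $k$ of its vertices are deleted. -/

import Mathlib

open Filter Topology MeasureTheory ProbabilityTheory

/-- A simple graph is `k`-connected if it has more than `k` vertices and stays connected
whenever fewer than `k` of its vertices are deleted. -/
def SimpleGraph.IsKConnected {V : Type*} [Fintype V] (k : ℕ) (G : SimpleGraph V) : Prop :=
  k < Fintype.card V ∧
    ∀ S : Finset V, S.card < k → (G.induce {v : V | v ∉ S}).Connected

/-- The graph determined by an assignment of key rings to the vertices: two distinct vertices
are adjacent iff their key rings share at least one key. -/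
def keyGraph {V κ : Type*} (S : V → Finset κ) : SimpleGraph V where
  Adj u v := u ≠ v ∧ ∃ x, x ∈ S u ∧ x ∈ S v
  symm := ⟨fun _ _ h => ⟨h.1.symm, h.2.imp fun _ hx => hx.symm⟩⟩
  loopless := ⟨fun _ h => h.1 rfl⟩

/-- The law of one key ring: the uniform distribution on the `K`-element subsets of a pool of
`P` keys (a probability measure when `K ≤ P`). -/
noncomputable def keyRingLaw (K P : ℕ) : Measure (Finset (Fin P)) :=
  uniformOn {S : Finset (Fin P) | S.card = K}

/-- The law of the random key graph `G(n, K, P)`: the key rings of the `n` vertices are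
independent and uniform. -/
noncomputable def randomKeyGraph (n K P : ℕ) : Measure (SimpleGraph (Fin n)) :=
  (Measure.pi fun _ : Fin n => keyRingLaw K P).map keyGraph

/-- The law of `𝔾(n, K, P, p)`, the intersection of independent copies of the random key graph
`G(n, K, P)` and the Erdős–Rényi graph `G(n, p)`. -/
noncomputable def secureGraph (n K P : ℕ) (p : unitInterval) : Measure (SimpleGraph (Fin n)) :=
  ((randomKeyGraph n K P).prod (SimpleGraph.binomialRandom (Fin n) p)).map
    fun G => G.1 ⊓ G.2

/-!
The number of edges at a vertex is approximately Poisson, and `n * q = log n + (k - 1) log log n + α`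
is the scale at which the expected number of vertices of degree less than `k` tends to the constant
`c = exp (-α*) / (k - 1)!`. The proof shows that the number of such vertices is asymptotically
Poisson with mean `c`, so that minimum degree at least `k` has limit probability `exp (-c)`, and that
minimum degree at least `k` implies `k`-connectivity with high probability.

The dependence between edges is handled by resampling. All key rings and channel states are
independent, so given the rings and channels of a set `T` of vertices, the neighbourhoods in `T` of
the vertices outside `T` are independent (`integral_mul_prod_nbrsIn`), each with a law `typeProb`
that depends on the rings of `T` only through the probability that a random ring meets several of
them. Each vertex of `T` is adjacent to an outside vertex with conditional probability exactly the
edge probability `q`, and what has to be controlled is the conditional probability that an outside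
vertex is adjacent to two vertices of `T`. It is at most `p * q` always
(`typeProb_mem_both_le`), and of order `q / K + q ^ 2` when the two rings share few keys
(`typeProb_mem_both_le_of_overlapLE`). The indices `n` are therefore split into those with
`p ≤ (log n) ^ (-2)`, where the first bound suffices, and the others, where two rings meet with
probability `s = O((log n) ^ 3 / n)` only and the second bound applies to all but a negligible
proportion of the sets `T`.

*Minimum degree.* By the Bonferroni inequalities (`tendsto_exp_neg_of_bonferroni`) it suffices to
find the limit of the `m`-th binomial moment, the sum over the `m`-sets `A` of the probability that
all vertices of `A` have degree less than `k` (`tendsto_sum_lowDegree`). Up to negligible terms the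
outer neighbourhoods of the vertices of `A` are disjoint and the probability is the `m`-th power of
that of a single vertex. When two rings of `A` overlap, an event of probability `O(s)`, the set `A`
is still unlikely to have at most `m (k - 1)` outer neighbours, by almost the factor `n ^ (-m)` that
independence would give.

*Connectivity.* A graph of minimum degree at least `k` which is not `k`-connected has a connected
set `T` with `2 ≤ |T| ≤ n / 2` and fewer than `k` outer neighbours
(`exists_connected_of_not_isKConnected`). The probability that `T` is connected is bounded by
counting spanning trees (`sampleLaw_real_connected_le`). If `|T|` is bounded, two of its vertices
have almost disjoint neighbourhoods, so that a given outside vertex is joined to `T` with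
probability at least `3 q / 2`, and this beats the number `n ^ |T|` of choices of `T` together with
the factor `q ^ (|T| - 1)` for a spanning tree. If `|T|` is large, the key rings are expanding: with
high probability the rings of any set of vertices cover a positive fraction of the keys that
disjoint rings would cover, or of the whole pool (`sampleLaw_real_not_expanding_le`, which needs
`P = Ω(n)`), and then an outside vertex is joined to `T` with probability at least a constant times
`min 1 (|T| q)`.
-/

set_option linter.unusedSectionVars false

/-! ### A product model for the random graph -/

/-- The key rings: the `K`-element subsets of a pool of `P` keys. -/
abbrev KeyRing (K P : ℕ) : Type := {S : Finset (Fin P) // S.card = K}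

/-- The uniform law on key rings. -/
noncomputable def ringLaw (K P : ℕ) : Measure (KeyRing K P) := uniformOn Set.univ

/-- The law of the state of one channel: on with probability `p`. -/
noncomputable def channelLaw (p : unitInterval) : Measure Prop :=
  unitInterval.toNNReal p • Measure.dirac True +
    unitInterval.toNNReal (unitInterval.symm p) • Measure.dirac False

/-- A sample point: a key ring for each vertex, and a state for each unordered pair. The states of
the diagonal pairs are never used; they are kept so that the channels are indexed by a plain
type. -/
abbrev Sample (V : Type*) (K P : ℕ) : Type _ := (V → KeyRing K P) × (Sym2 V → Prop)

instance {K P : ℕ} [Nonempty (KeyRing K P)] : IsProbabilityMeasure (ringLaw K P) := by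
  unfold ringLaw
  exact isProbabilityMeasure_uniformOn Set.finite_univ Set.univ_nonempty

instance (p : unitInterval) : IsProbabilityMeasure (channelLaw p) := by
  unfold channelLaw
  infer_instance

lemma channelLaw_real_on (p : unitInterval) : (channelLaw p).real {b | b} = p := by
  simp [channelLaw, measureReal_def]

lemma nonempty_keyRing {K P : ℕ} (h : K ≤ P) : Nonempty (KeyRing K P) := by
  obtain ⟨s, -, hs⟩ := Finset.exists_subset_card_eq (s := (Finset.univ : Finset (Fin P))) (n := K)
    (by simpa using h)
  exact ⟨⟨s, hs⟩⟩

lemma measurableSet_simpleGraph {V : Type*} [Fintype V] (S : Set (SimpleGraph V)) :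
    MeasurableSet S := by
  have := SimpleGraph.measurable_edgeSet (V := V)
    (MeasurableSet.of_discrete (s := SimpleGraph.edgeSet '' S))
  rwa [Set.preimage_image_eq _ SimpleGraph.edgeSet_injective] at this

section Model

variable {V : Type*} [Fintype V] [DecidableEq V] {K P : ℕ} {p : unitInterval}

variable (V K P p) in
/-- The law of a sample point: all rings and channels are independent. -/
noncomputable def sampleLaw : Measure (Sample V K P) :=
  (Measure.pi fun _ : V => ringLaw K P).prod (Measure.pi fun _ : Sym2 V => channelLaw p)

instance [Nonempty (KeyRing K P)] : IsProbabilityMeasure (sampleLaw V K P p) := by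
  unfold sampleLaw; infer_instance

/-- The graph of a sample point: two distinct vertices are adjacent iff their rings meet and the
channel between them is on. -/
def sampleGraph (ω : Sample V K P) : SimpleGraph V where
  Adj u v := u ≠ v ∧ ¬ Disjoint (ω.1 u).1 (ω.1 v).1 ∧ ω.2 s(u, v)
  symm := ⟨fun _ _ h => ⟨h.1.symm, fun h' => h.2.1 h'.symm, Sym2.eq_swap ▸ h.2.2⟩⟩
  loopless := ⟨fun _ h => h.1 rfl⟩

lemma map_keyRing_val [Nonempty (KeyRing K P)] :
    (ringLaw K P).map Subtype.val = keyRingLaw K P := by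
  have hne : Set.Nonempty {S : Finset (Fin P) | S.card = K} := by
    obtain ⟨S⟩ := ‹Nonempty (KeyRing K P)›
    exact ⟨S.1, S.2⟩
  ext t ht
  have hcard : ({S : Finset (Fin P) | S.card = K} : Set (Finset (Fin P))).encard
      = (Set.univ : Set (KeyRing K P)).encard := by
    rw [← Subtype.val_injective.encard_image]; simp
  rw [Measure.map_apply .of_discrete ht, ringLaw, keyRingLaw, uniformOn, uniformOn,
    cond_apply .of_discrete, cond_apply .of_discrete]
  congr 1
  · rw [Measure.count_apply .of_discrete, Measure.count_apply .of_discrete, hcard]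
  · rw [Measure.count_apply .of_discrete, Measure.count_apply .of_discrete,
      ← Subtype.val_injective.encard_image]
    congr 2
    ext x; simp [and_comm]

end Model

/-- The law of the random graph is that of `sampleGraph`: the key rings are moved to a subtype, so that
their law is uniform on a finite type, and the Erdős–Rényi graph is realised by channel states. -/
lemma secureGraph_eq_map {n K P : ℕ} [Nonempty (KeyRing K P)] (p : unitInterval) :
    secureGraph n K P p = (sampleLaw (Fin n) K P p).map sampleGraph := by
  have h1 : randomKeyGraph n K P = (Measure.pi fun _ : Fin n => ringLaw K P).map
      (fun S => keyGraph fun v => (S v).1) := by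
    rw [randomKeyGraph, ← map_keyRing_val]
    have : IsProbabilityMeasure ((ringLaw K P).map Subtype.val) :=
      Measure.isProbabilityMeasure_map .of_discrete
    rw [← Measure.pi_map_pi (f := fun _ => Subtype.val) (fun _ => .of_discrete),
      Measure.map_map .of_discrete .of_discrete]
    rfl
  have h2 : SimpleGraph.binomialRandom (Fin n) p = (Measure.pi fun _ : Sym2 (Fin n) =>
      channelLaw p).map (fun b => SimpleGraph.fromEdgeSet {e | b e}) := by
    rw [SimpleGraph.binomialRandom_eq_map, setBernoulli_eq_map]
    have h3 : (fun i : Sym2 (Fin n) => unitInterval.toNNReal p •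
        Measure.dirac (i ∈ (Sym2.diagSetᶜ : Set (Sym2 (Fin n)))) +
        unitInterval.toNNReal (unitInterval.symm p) • Measure.dirac False) =
        fun i => (channelLaw p).map
          (fun b => b ∧ i ∈ (Sym2.diagSetᶜ : Set (Sym2 (Fin n)))) := by
      ext i : 1
      rw [channelLaw, Measure.map_add _ _ .of_discrete, Measure.map_smul, Measure.map_smul,
        Measure.map_dirac' .of_discrete, Measure.map_dirac' .of_discrete]
      simp
    rw [h3, ← Measure.infinitePi_map_pi _ (fun _ => .of_discrete), Measure.infinitePi_eq_pi,
      Measure.map_map SimpleGraph.measurable_fromEdgeSet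
      .of_discrete, Measure.map_map .of_discrete .of_discrete]
    congr 1
    ext b u v
    simp [SimpleGraph.fromEdgeSet]
  rw [secureGraph, h1, h2, Measure.map_prod_map _ _ .of_discrete .of_discrete,
    Measure.map_map (fun s _ => ?_) .of_discrete, sampleLaw]
  · congr 1
    ext ω u v
    simp [keyGraph, sampleGraph, Finset.not_disjoint_iff]
    tauto
  · have : Finite (SimpleGraph (Fin n)) := Finite.of_injective _ SimpleGraph.edgeSet_injective
    have : MeasurableSingletonClass (SimpleGraph (Fin n)) := ⟨fun _ => measurableSet_simpleGraph _⟩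
    exact .of_discrete

lemma secureGraph_real {n K P : ℕ} [Nonempty (KeyRing K P)] (p : unitInterval)
    (S : Set (SimpleGraph (Fin n))) :
    (secureGraph n K P p).real S = (sampleLaw (Fin n) K P p).real {ω | sampleGraph ω ∈ S} := by
  rw [secureGraph_eq_map, map_measureReal_apply .of_discrete (measurableSet_simpleGraph S)]
  rfl

/-! ### Resampling a vertex -/


section Resample

variable {V : Type*} [Fintype V] [DecidableEq V] {K P : ℕ} {p : unitInterval}

/-- Replace, in `ω`, the ring of `u` and the channels at `u` by those of `ω'`. -/
def resample (u : V) (ω ω' : Sample V K P) : Sample V K P :=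
  (Function.update ω.1 u (ω'.1 u), fun e => if u ∈ e then ω'.2 e else ω.2 e)

/-- Mixing two independent samples along a set of coordinates does not change the law. This is how
conditioning on everything but the vertex `u` is expressed. -/
lemma map_resample [Nonempty (KeyRing K P)] (u : V) :
    ((sampleLaw V K P p).prod (sampleLaw V K P p)).map (fun x => resample u x.1 x.2) =
      sampleLaw V K P p := by
  refine Measure.ext_of_singleton fun a => ?_
  rw [Measure.map_apply .of_discrete .of_discrete]
  have h : (fun x : Sample V K P × Sample V K P => resample u x.1 x.2) ⁻¹' {a} =
      ((Set.univ.pi fun v => if v = u then Set.univ else {a.1 v}) ×ˢ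
        (Set.univ.pi fun e => if u ∈ e then Set.univ else {a.2 e})) ×ˢ
      ((Set.univ.pi fun v => if v = u then {a.1 v} else Set.univ) ×ˢ
        (Set.univ.pi fun e => if u ∈ e then {a.2 e} else Set.univ)) := by
    ext x
    simp only [resample, Set.mem_preimage, Set.mem_singleton_iff, Prod.ext_iff, funext_iff,
      Set.mem_prod, Set.mem_pi, Set.mem_univ, true_imp_iff]
    rw [and_and_and_comm, ← forall_and, ← forall_and]
    refine and_congr (forall_congr' fun v => ?_) (forall_congr' fun e => ?_)
    · by_cases h : v = u
      · subst h; simp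
      · simp [h]
    · by_cases h : u ∈ e <;> simp [h]
  have h' : ({a} : Set (Sample V K P)) =
      (Set.univ.pi fun v => {a.1 v}) ×ˢ (Set.univ.pi fun e => {a.2 e}) := by
    ext x
    simp [Prod.ext_iff, funext_iff]
  rw [h, h']
  simp only [sampleLaw, Measure.prod_prod, Measure.pi_pi]
  rw [mul_mul_mul_comm, ← Finset.prod_mul_distrib, ← Finset.prod_mul_distrib]
  congr 1 <;> refine Finset.prod_congr rfl fun i _ => ?_
  · by_cases h : i = u <;> simp [h]
  · by_cases h : u ∈ i <;> simp [h]

lemma integral_resample [Nonempty (KeyRing K P)] (u : V) (F : Sample V K P → ℝ) :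
    ∫ ω, F ω ∂(sampleLaw V K P p) =
      ∫ ω, ∫ ω', F (resample u ω ω') ∂(sampleLaw V K P p) ∂(sampleLaw V K P p) := by
  conv_lhs => rw [← map_resample (p := p) u]
  rw [integral_map .of_discrete .of_discrete, integral_prod _ .of_finite]

/-! ### The neighbours of a vertex in a set -/

open Classical in
/-- The set of vertices of `T` adjacent to `u`. -/
noncomputable def nbrsIn (ω : Sample V K P) (T : Finset V) (u : V) : Finset V :=
  T.filter fun v => (sampleGraph ω).Adj u v

lemma nbrsIn_subset (ω : Sample V K P) (T : Finset V) (u : V) : nbrsIn ω T u ⊆ T := by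
  classical
  exact Finset.filter_subset _ _

variable (p) in
/-- The conditional probability, given the rings on `T`, that the set of neighbours in `T` of the
vertex `u ∉ T` belongs to `𝒜`. It is encoded as a function of the sample `ω`: the ring of `u` and
the channels at `u` are resampled and averaged out. -/
noncomputable def typeProb (ω : Sample V K P) (T : Finset V) (u : V) (𝒜 : Set (Finset V)) : ℝ :=
  (sampleLaw V K P p).real {ω' | nbrsIn (resample u ω ω') T u ∈ 𝒜}

/-- `F` does not depend on the rings and channels of the vertices outside `T`: resampling such a
vertex leaves `F` unchanged. -/
def DependsOnlyOn {α : Type*} (F : Sample V K P → α) (T : Finset V) : Prop :=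
  ∀ u ∉ T, ∀ ω ω', F (resample u ω ω') = F ω

lemma resample_adj {u v w : V} (hv : v ≠ u) (hw : w ≠ u) (ω ω' : Sample V K P) :
    (sampleGraph (resample u ω ω')).Adj v w ↔ (sampleGraph ω).Adj v w := by
  simp [sampleGraph, resample, hv, hw, hv.symm, hw.symm]

lemma resample_adj_self {u v : V} (hv : v ≠ u) (ω ω' : Sample V K P) :
    (sampleGraph (resample u ω ω')).Adj u v ↔
      ¬ Disjoint (ω'.1 u).1 (ω.1 v).1 ∧ ω'.2 s(u, v) := by
  simp [sampleGraph, resample, hv, hv.symm]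

lemma resample_fst {u v : V} (hv : v ≠ u) (ω ω' : Sample V K P) :
    (resample u ω ω').1 v = ω.1 v := by
  simp [resample, hv]

lemma dependsOnlyOn_nbrsIn {T : Finset V} {u : V} :
    DependsOnlyOn (fun ω : Sample V K P => nbrsIn ω T u) (insert u T) := by
  intro w hw ω ω'
  simp only [Finset.mem_insert, not_or] at hw
  ext v
  simp only [nbrsIn, Finset.mem_filter]
  exact and_congr_right fun hv =>
    resample_adj (Ne.symm hw.1) (ne_of_mem_of_not_mem hv hw.2) _ _

lemma nbrsIn_resample {T : Finset V} {u : V} (hu : u ∉ T) (ω ω' : Sample V K P) (v : V) :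
    v ∈ nbrsIn (resample u ω ω') T u ↔
      v ∈ T ∧ ¬ Disjoint (ω'.1 u).1 (ω.1 v).1 ∧ ω'.2 s(u, v) := by
  simp only [nbrsIn, Finset.mem_filter]
  exact and_congr_right fun hv => resample_adj_self (ne_of_mem_of_not_mem hv hu) _ _

lemma dependsOnlyOn_typeProb {T : Finset V} {u : V} (hu : u ∉ T) (𝒜 : Set (Finset V)) :
    DependsOnlyOn (fun ω : Sample V K P => typeProb p ω T u 𝒜) T := by
  intro w hw ω ω'
  simp only [typeProb]
  congr 1
  ext η
  have : nbrsIn (resample u (resample w ω ω') η) T u = nbrsIn (resample u ω η) T u := by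
    ext v
    rw [nbrsIn_resample hu, nbrsIn_resample hu]
    refine and_congr_right fun hv => ?_
    rw [resample_fst (ne_of_mem_of_not_mem hv hw)]
  simp [this]

lemma typeProb_nonneg (ω : Sample V K P) (T : Finset V) (u : V) (𝒜 : Set (Finset V)) :
    0 ≤ typeProb p ω T u 𝒜 := measureReal_nonneg

open Classical in
/-- Conditioning on everything but one vertex `u`: the neighbourhood of `u` in `T` may be replaced
by its conditional law. -/
lemma integral_mul_nbrsIn [Nonempty (KeyRing K P)] {u : V} (T : Finset V) {Q : Finset V}
    {Φ : Sample V K P → ℝ} (hΦ : DependsOnlyOn Φ Q) (hu : u ∉ Q) (𝒜 : Set (Finset V)) :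
    ∫ ω, Φ ω * (if nbrsIn ω T u ∈ 𝒜 then 1 else 0) ∂(sampleLaw V K P p) =
      ∫ ω, Φ ω * typeProb p ω T u 𝒜 ∂(sampleLaw V K P p) := by
  rw [integral_resample u]
  refine integral_congr_ae (.of_forall fun ω => ?_)
  simp only [hΦ u hu]
  rw [integral_const_mul, typeProb, ← integral_indicator_one .of_discrete]
  rfl

open Classical in
/-- Given the rings and channels inside `T`, the neighbourhoods in `T` of the vertices outside `T`
are independent. -/
lemma integral_mul_prod_nbrsIn [Nonempty (KeyRing K P)] {T : Finset V} (Y : Finset V)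
    (hY : Disjoint Y T) {Φ : Sample V K P → ℝ} (hΦ : DependsOnlyOn Φ T)
    (𝒜 : V → Set (Finset V)) :
    ∫ ω, Φ ω * ∏ u ∈ Y, (if nbrsIn ω T u ∈ 𝒜 u then 1 else 0) ∂(sampleLaw V K P p) =
      ∫ ω, Φ ω * ∏ u ∈ Y, typeProb p ω T u (𝒜 u) ∂(sampleLaw V K P p) := by
  induction Y using Finset.induction_on generalizing Φ with
  | empty => simp
  | insert u Y hu ih =>
    rw [Finset.disjoint_insert_left] at hY
    simp only [Finset.prod_insert hu]
    have hΦ' : DependsOnlyOn (fun ω => Φ ω * ∏ v ∈ Y, (if nbrsIn ω T v ∈ 𝒜 v then (1 : ℝ) else 0))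
        (Y ∪ T) := by
      intro w hw ω ω'
      rw [Finset.mem_union, not_or] at hw
      simp only [hΦ w hw.2]
      congr 1
      refine Finset.prod_congr rfl fun v hv => ?_
      have := dependsOnlyOn_nbrsIn (T := T) (u := v) w (by
        rw [Finset.mem_insert, not_or]; exact ⟨fun h => hw.1 (h ▸ hv), hw.2⟩) ω ω'
      simp only at this
      rw [this]
    have h1 := integral_mul_nbrsIn (p := p) T hΦ' (u := u)
      (by rw [Finset.mem_union, not_or]; exact ⟨hu, hY.1⟩) (𝒜 u)
    have h2 := ih hY.2 (Φ := fun ω => Φ ω * typeProb p ω T u (𝒜 u)) (by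
      intro w hw ω ω'
      have := dependsOnlyOn_typeProb (p := p) hY.1 (𝒜 u) w hw ω ω'
      simp only at this
      simp only [hΦ w hw, this])
    calc _ = _ := by
          refine integral_congr_ae (.of_forall fun ω => ?_)
          simp only
          rw [mul_left_comm, mul_comm]
      _ = _ := h1
      _ = _ := by
          refine integral_congr_ae (.of_forall fun ω => ?_)
          simp only
          rw [mul_right_comm]
      _ = _ := h2
      _ = _ := by
          refine integral_congr_ae (.of_forall fun ω => ?_)
          simp only
          rw [mul_assoc]

end Resample

/-! ### Random key rings -/

section Rings

variable {K P : ℕ}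

lemma ringLaw_real [Nonempty (KeyRing K P)] (A : Set (KeyRing K P)) :
    (ringLaw K P).real A = (A.ncard : ℝ) / (P.choose K : ℝ) := by
  rw [ringLaw, measureReal_def, uniformOn_univ, Measure.count_apply .of_discrete]
  have : Fintype.card (KeyRing K P) = P.choose K := by
    simp
  rw [this, ENNReal.toReal_div, ENNReal.toReal_natCast, ← A.toFinite.cast_ncard_eq]
  rfl

lemma ringLaw_real_subset [Nonempty (KeyRing K P)] (X : Finset (Fin P)) :
    (ringLaw K P).real {R | R.1 ⊆ X} = (X.card.choose K : ℝ) / (P.choose K : ℝ) := by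
  rw [ringLaw_real, ← Finset.card_powersetCard, ← Set.ncard_coe_finset,
    ← Set.ncard_image_of_injective _ Subtype.val_injective]
  congr 3
  ext S
  simp [Finset.mem_powersetCard]

/-- A random `K`-subset is contained in a given set of size `x` with probability at most
`(x / P) ^ K`, in multiplied-out form. -/
lemma choose_mul_pow_le {x P : ℕ} (h : x ≤ P) (K : ℕ) :
    x.choose K * P ^ K ≤ P.choose K * x ^ K := by
  have key : x.descFactorial K * P ^ K ≤ P.descFactorial K * x ^ K := by
    induction K with
    | zero => simp
    | succ K ih =>
      rw [Nat.descFactorial_succ, Nat.descFactorial_succ, pow_succ, pow_succ]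
      have : (x - K) * P ≤ (P - K) * x := by
        rw [Nat.sub_mul, Nat.sub_mul, mul_comm P x]
        exact Nat.sub_le_sub_left (Nat.mul_le_mul_left _ h) _
      calc _ = (x.descFactorial K * P ^ K) * ((x - K) * P) := by ring
        _ ≤ (P.descFactorial K * x ^ K) * ((P - K) * x) := Nat.mul_le_mul ih this
        _ = _ := by ring
  rw [Nat.descFactorial_eq_factorial_mul_choose, Nat.descFactorial_eq_factorial_mul_choose,
    mul_assoc, mul_assoc] at key
  exact Nat.le_of_mul_le_mul_left key (Nat.factorial_pos K)

lemma keyRing_le [h : Nonempty (KeyRing K P)] : K ≤ P := by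
  obtain ⟨S⟩ := h
  simpa [S.2] using Finset.card_le_univ S.1

lemma choose_pos_of_keyRing [Nonempty (KeyRing K P)] : (0 : ℝ) < P.choose K := by
  exact_mod_cast Nat.choose_pos keyRing_le

lemma ringLaw_real_subset_le [Nonempty (KeyRing K P)] (X : Finset (Fin P)) :
    (ringLaw K P).real {R | R.1 ⊆ X} ≤ ((X.card : ℝ) / P) ^ K := by
  rcases Nat.eq_zero_or_pos P with hP | hP
  · have : K = 0 := by have := keyRing_le (K := K) (P := P); omega
    subst this
    simp
  rw [ringLaw_real_subset, div_pow, div_le_div_iff₀ choose_pos_of_keyRing (by positivity)]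
  have := choose_mul_pow_le (x := X.card) (P := P) (by simpa using Finset.card_le_univ X) K
  rw [mul_comm ((X.card : ℝ) ^ K)]
  exact_mod_cast this

lemma ringLaw_real_disjoint [Nonempty (KeyRing K P)] (X : Finset (Fin P)) :
    (ringLaw K P).real {R | Disjoint R.1 X} = ((P - X.card).choose K : ℝ) / (P.choose K : ℝ) := by
  have := ringLaw_real_subset (K := K) Xᶜ
  simpa [Finset.subset_compl_iff_disjoint_right, Finset.card_compl] using this

lemma ringLaw_real_disjoint_le [Nonempty (KeyRing K P)] (X : Finset (Fin P)) :
    (ringLaw K P).real {R | Disjoint R.1 X} ≤ Real.exp (-(K * X.card / P : ℝ)) := by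
  rcases Nat.eq_zero_or_pos P with hP | hP
  · subst hP
    simp
  have h := ringLaw_real_subset_le (K := K) Xᶜ
  simp only [Finset.subset_compl_iff_disjoint_right] at h
  refine h.trans ?_
  have hc : X.card ≤ P := by simpa using Finset.card_le_univ X
  have : -(K * X.card / P : ℝ) = K * (-(X.card / P : ℝ)) := by ring
  rw [this, Real.exp_nat_mul]
  gcongr
  rw [Finset.card_compl, Fintype.card_fin, Nat.cast_sub hc, sub_div, div_self (by positivity)]
  have := Real.add_one_le_exp (-(X.card / P : ℝ))
  linarith

/-- A random `K`-subset contains a given set of size `d` with probability at most `(K / P) ^ d`, in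
multiplied-out form. -/
lemma choose_sub_mul_pow_le {K P : ℕ} (hKP : K ≤ P) (d : ℕ) (hd : d ≤ K) :
    (P - d).choose (P - K) * P ^ d ≤ P.choose K * K ^ d := by
  induction d with
  | zero => simp [Nat.choose_symm hKP]
  | succ d ih =>
    obtain ⟨a, ha⟩ : ∃ a, K = d + 1 + a := ⟨K - (d + 1), by omega⟩
    obtain ⟨b, hb⟩ : ∃ b, P = d + 1 + a + b := ⟨P - K, by omega⟩
    have e1 : P - d = (a + b) + 1 := by omega
    have e2 : P - (d + 1) = a + b := by omega
    have e3 : P - K = b := by omega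
    have ih := ih (by omega)
    rw [e1, e3] at ih
    rw [e2, e3]
    have h := Nat.choose_mul_succ_eq (a + b) b
    rw [show a + b + 1 - b = a + 1 by omega] at h
    have h4 : (a + 1) * P ≤ K * (a + b + 1) := by rw [hb, ha]; nlinarith
    refine Nat.le_of_mul_le_mul_right ?_ (show 0 < a + b + 1 by omega)
    calc (a + b).choose b * P ^ (d + 1) * (a + b + 1)
        = ((a + b).choose b * (a + b + 1)) * P * P ^ d := by ring
      _ = ((a + b + 1).choose b * P ^ d) * ((a + 1) * P) := by rw [h]; ring
      _ ≤ (P.choose K * K ^ d) * (K * (a + b + 1)) := Nat.mul_le_mul ih h4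
      _ = _ := by ring

lemma ringLaw_real_superset_le [Nonempty (KeyRing K P)] (Z : Finset (Fin P)) :
    (ringLaw K P).real {R | Z ⊆ R.1} ≤ ((K : ℝ) / P) ^ Z.card := by
  by_cases hd : K < Z.card
  · have : {R : KeyRing K P | Z ⊆ R.1} = ∅ := by
      ext R
      simp only [Set.mem_ofPred_eq, Set.mem_empty_iff_false, iff_false]
      intro h
      have := Finset.card_le_card h
      rw [R.2] at this
      omega
    rw [this, measureReal_empty]
    positivity
  push Not at hd
  rcases Nat.eq_zero_or_pos P with hP | hP
  · have : Z.card = 0 := by have := keyRing_le (K := K) (P := P); omega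
    simp [this]
  have hcount : {R : KeyRing K P | Z ⊆ R.1}.ncard = (P - Z.card).choose (P - K) := by
    have hinj : Function.Injective fun R : KeyRing K P => R.1ᶜ :=
      compl_injective.comp Subtype.val_injective
    have hZ : Zᶜ.card = P - Z.card := by simp [Finset.card_compl]
    rw [← Set.ncard_image_of_injective _ hinj, ← hZ, ← Finset.card_powersetCard,
      ← Set.ncard_coe_finset]
    congr 1
    ext S
    simp only [Set.mem_image, Set.mem_ofPred_eq, Finset.mem_coe, Finset.mem_powersetCard]
    constructor
    · rintro ⟨R, hR, rfl⟩
      exact ⟨Finset.compl_subset_compl.mpr hR, by simp [Finset.card_compl, R.2]⟩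
    · rintro ⟨h1, h2⟩
      refine ⟨⟨Sᶜ, ?_⟩, ?_, compl_compl S⟩
      · have := keyRing_le (K := K) (P := P)
        rw [Finset.card_compl, h2, Fintype.card_fin]
        omega
      · rwa [le_compl_comm]
  rw [ringLaw_real, hcount, div_pow, div_le_div_iff₀ choose_pos_of_keyRing (by positivity),
    mul_comm ((K : ℝ) ^ Z.card)]
  exact_mod_cast choose_sub_mul_pow_le keyRing_le _ hd

variable (K P) in
/-- The probability that two given key rings meet. -/
noncomputable def meetProb : ℝ := 1 - ((P - K).choose K : ℝ) / (P.choose K : ℝ)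

lemma ringLaw_real_not_disjoint [Nonempty (KeyRing K P)] (S : KeyRing K P) :
    (ringLaw K P).real {R | ¬ Disjoint R.1 S.1} = meetProb K P := by
  have h := probReal_compl_eq_one_sub (μ := ringLaw K P) (s := {R | Disjoint R.1 S.1}) .of_discrete
  rw [ringLaw_real_disjoint, S.2] at h
  exact h

lemma meetProb_nonneg [h : Nonempty (KeyRing K P)] : 0 ≤ meetProb K P := by
  obtain ⟨S⟩ := id h
  rw [← ringLaw_real_not_disjoint S]
  exact measureReal_nonneg

lemma meetProb_le_one : meetProb K P ≤ 1 := by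
  unfold meetProb
  have : 0 ≤ ((P - K).choose K : ℝ) / (P.choose K : ℝ) := by positivity
  linarith

lemma meetProb_le [h : Nonempty (KeyRing K P)] : meetProb K P ≤ (K : ℝ) ^ 2 / P := by
  obtain ⟨S⟩ := id h
  rw [← ringLaw_real_not_disjoint S]
  calc (ringLaw K P).real {R | ¬ Disjoint R.1 S.1}
      ≤ (ringLaw K P).real (⋃ x ∈ S.1, {R | {x} ⊆ R.1}) := by
        refine measureReal_mono ?_ (measure_ne_top _ _)
        intro R hR
        obtain ⟨x, hx, hx'⟩ := Finset.not_disjoint_iff.mp hR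
        simp only [Set.mem_iUnion]
        exact ⟨x, hx', by simpa using hx⟩
    _ ≤ ∑ x ∈ S.1, (ringLaw K P).real {R | {x} ⊆ R.1} := measureReal_biUnion_finset_le _ _
    _ ≤ ∑ x ∈ S.1, (K : ℝ) / P := by
        refine Finset.sum_le_sum fun x _ => ?_
        simpa using ringLaw_real_superset_le (K := K) {x}
    _ = (K : ℝ) ^ 2 / P := by rw [Finset.sum_const, S.2, nsmul_eq_mul]; ring

lemma one_sub_exp_le_meetProb [h : Nonempty (KeyRing K P)] :
    1 - Real.exp (-((K : ℝ) ^ 2 / P)) ≤ meetProb K P := by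
  obtain ⟨S⟩ := id h
  have h1 := ringLaw_real_disjoint_le (K := K) S.1
  rw [ringLaw_real_disjoint, S.2] at h1
  rw [meetProb, sq]
  linarith

/-- A converse to `meetProb_le`: `meetProb` is of order `K ^ 2 / P` as long as it is at most `1 / 2`. -/
lemma sq_div_le_meetProb [h : Nonempty (KeyRing K P)] (hs : meetProb K P ≤ 1 / 2) :
    (K : ℝ) ^ 2 / P ≤ 2 * meetProb K P := by
  have h1 := one_sub_exp_le_meetProb (K := K) (P := P)
  have h0 := meetProb_nonneg (K := K) (P := P)
  set s := meetProb K P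
  set x := (K : ℝ) ^ 2 / P
  by_contra! h2
  have h3 : Real.exp (-x) ≤ Real.exp (-(2 * s)) := Real.exp_le_exp.mpr (by linarith)
  have h4 : Real.exp (-(2 * s)) * (1 + 2 * s) ≤ 1 := by
    have := Real.add_one_le_exp (2 * s)
    calc _ ≤ Real.exp (-(2 * s)) * Real.exp (2 * s) := by gcongr; linarith
      _ = 1 := by rw [← Real.exp_add]; simp
  rcases h0.eq_or_lt with h5 | h5
  · rw [← h5] at h1 h2
    have : Real.exp (-x) < 1 := Real.exp_lt_one_iff.mpr (by linarith)
    linarith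
  · have h6 : Real.exp (-x) < Real.exp (-(2 * s)) := Real.exp_lt_exp.mpr (by linarith)
    have h7 : (1 - s) * (1 + 2 * s) < 1 := by nlinarith
    nlinarith

/-- If two sets of keys of size `K` have at most `d` keys in common, a ring rarely meets both. -/
lemma ringLaw_real_meet_both_le [h : Nonempty (KeyRing K P)] (S S' : KeyRing K P) {d : ℕ}
    (hd : (S.1 ∩ S'.1).card ≤ d) :
    (ringLaw K P).real {R | ¬ Disjoint R.1 S.1 ∧ ¬ Disjoint R.1 S'.1} ≤
      d * ((K : ℝ) / P) + ((K : ℝ) ^ 2 / P) ^ 2 := by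
  calc (ringLaw K P).real {R | ¬ Disjoint R.1 S.1 ∧ ¬ Disjoint R.1 S'.1}
      ≤ (ringLaw K P).real ((⋃ x ∈ S.1 ∩ S'.1, {R | {x} ⊆ R.1}) ∪
        ⋃ z ∈ (S.1 ×ˢ S'.1).filter fun z => z.1 ≠ z.2, {R | {z.1, z.2} ⊆ R.1}) := by
        refine measureReal_mono ?_ (measure_ne_top _ _)
        rintro R ⟨hR, hR'⟩
        obtain ⟨x, hx, hx'⟩ := Finset.not_disjoint_iff.mp hR
        obtain ⟨y, hy, hy'⟩ := Finset.not_disjoint_iff.mp hR'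
        simp only [Set.mem_union, Set.mem_iUnion]
        by_cases hxy : x = y
        · subst hxy
          exact .inl ⟨x, by simp [hx', hy'], by simpa using hx⟩
        · refine .inr ⟨(x, y), by simp [hx', hy', hxy], ?_⟩
          simp only [Set.mem_ofPred_eq]
          intro z hz
          simp only [Finset.mem_insert, Finset.mem_singleton] at hz
          rcases hz with rfl | rfl <;> assumption
    _ ≤ ∑ x ∈ S.1 ∩ S'.1, (ringLaw K P).real {R | {x} ⊆ R.1} +
        ∑ z ∈ (S.1 ×ˢ S'.1).filter fun z => z.1 ≠ z.2,
          (ringLaw K P).real {R | {z.1, z.2} ⊆ R.1} :=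
        (measureReal_union_le _ _).trans
          (add_le_add (measureReal_biUnion_finset_le _ _) (measureReal_biUnion_finset_le _ _))
    _ ≤ ∑ x ∈ S.1 ∩ S'.1, (K : ℝ) / P +
        ∑ z ∈ (S.1 ×ˢ S'.1).filter fun z => z.1 ≠ z.2, ((K : ℝ) / P) ^ 2 := by
        refine add_le_add (Finset.sum_le_sum fun x _ => ?_) (Finset.sum_le_sum fun z hz => ?_)
        · simpa using ringLaw_real_superset_le (K := K) {x}
        · have := ringLaw_real_superset_le (K := K) {z.1, z.2}
          rwa [Finset.card_pair (Finset.mem_filter.mp hz).2] at this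
    _ ≤ _ := by
        rw [Finset.sum_const, Finset.sum_const, nsmul_eq_mul, nsmul_eq_mul]
        have h1 : (((S.1 ×ˢ S'.1).filter fun z => z.1 ≠ z.2).card : ℝ) ≤ (K : ℝ) ^ 2 := by
          have := Finset.card_filter_le (S.1 ×ˢ S'.1) fun z => z.1 ≠ z.2
          rw [Finset.card_product, S.2, S'.2] at this
          rw [sq]; exact_mod_cast this
        have h2 : ((S.1 ∩ S'.1).card : ℝ) ≤ d := by exact_mod_cast hd
        calc _ ≤ d * ((K : ℝ) / P) + (K : ℝ) ^ 2 * ((K : ℝ) / P) ^ 2 := by gcongr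
          _ = _ := by ring

/-- Two rings are unlikely to have many keys in common. -/
lemma ringLaw_real_overlap_le [h : Nonempty (KeyRing K P)] (S : KeyRing K P) (d : ℕ) :
    (ringLaw K P).real {R | d ≤ (S.1 ∩ R.1).card} ≤ ((K : ℝ) ^ 2 / P) ^ d := by
  calc (ringLaw K P).real {R | d ≤ (S.1 ∩ R.1).card}
      ≤ (ringLaw K P).real (⋃ Z ∈ S.1.powersetCard d, {R | Z ⊆ R.1}) := by
        refine measureReal_mono ?_ (measure_ne_top _ _)
        intro R hR
        obtain ⟨Z, hZ, hZd⟩ := Finset.exists_subset_card_eq hR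
        simp only [Set.mem_iUnion]
        exact ⟨Z, Finset.mem_powersetCard.mpr ⟨hZ.trans Finset.inter_subset_left, hZd⟩,
          hZ.trans Finset.inter_subset_right⟩
    _ ≤ ∑ Z ∈ S.1.powersetCard d, (ringLaw K P).real {R | Z ⊆ R.1} :=
        measureReal_biUnion_finset_le _ _
    _ ≤ ∑ Z ∈ S.1.powersetCard d, ((K : ℝ) / P) ^ d := by
        refine Finset.sum_le_sum fun Z hZ => ?_
        have := ringLaw_real_superset_le (K := K) Z
        rwa [(Finset.mem_powersetCard.mp hZ).2] at this
    _ = (K.choose d : ℝ) * ((K : ℝ) / P) ^ d := by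
        rw [Finset.sum_const, Finset.card_powersetCard, S.2, nsmul_eq_mul]
    _ ≤ (K : ℝ) ^ d * ((K : ℝ) / P) ^ d := by
        gcongr
        exact_mod_cast Nat.choose_le_pow K d
    _ = _ := by rw [← mul_pow]; congr 1; ring

end Rings

/-! ### The conditional law of a neighbourhood -/

section TypeProb

variable {V : Type*} [Fintype V] [DecidableEq V] {K P : ℕ} {p : unitInterval}
  [Nonempty (KeyRing K P)]

variable (K P p) in
/-- The edge probability. -/
noncomputable def edgeProb : ℝ := p * meetProb K P

lemma edgeProb_nonneg : 0 ≤ edgeProb K P p := mul_nonneg p.2.1 meetProb_nonneg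

lemma edgeProb_le_one : edgeProb K P p ≤ 1 :=
  mul_le_one₀ p.2.2 meetProb_nonneg meetProb_le_one

/-- A ring and finitely many channels are independent. -/
lemma sampleLaw_real_ring_channels (u : V) (𝓡 : Set (KeyRing K P)) (F : Finset (Sym2 V)) :
    (sampleLaw V K P p).real {ω | ω.1 u ∈ 𝓡 ∧ ∀ e ∈ F, ω.2 e} =
      (ringLaw K P).real 𝓡 * (p : ℝ) ^ F.card := by
  classical
  have : {ω : Sample V K P | ω.1 u ∈ 𝓡 ∧ ∀ e ∈ F, ω.2 e} =
      (Set.univ.pi fun v => if v = u then 𝓡 else Set.univ) ×ˢ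
        (Set.univ.pi fun e => if e ∈ F then {b | b} else Set.univ) := by
    ext ω
    simp only [Set.mem_ofPred_eq, Set.mem_prod, Set.mem_pi, Set.mem_univ, true_imp_iff]
    refine and_congr ⟨fun h v => ?_, fun h => by simpa using h u⟩ (forall_congr' fun e => ?_)
    · by_cases hv : v = u
      · subst hv; simpa using h
      · simp [hv]
    · by_cases he : e ∈ F <;> simp [he]
  rw [this, sampleLaw, measureReal_prod_prod]
  congr 1
  · rw [measureReal_def, Measure.pi_pi, Finset.prod_eq_single u] <;> simp +contextual
    rfl
  · rw [measureReal_def, Measure.pi_pi, ENNReal.toReal_prod]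
    rw [← Finset.prod_const, ← channelLaw_real_on, ← Finset.prod_subset (Finset.subset_univ F)]
    · refine Finset.prod_congr rfl fun e he => ?_
      simp [he, measureReal_def]
    · intro e _ he
      simp [he]

variable (ω : Sample V K P) {T : Finset V} {u : V}

lemma typeProb_mem (hu : u ∉ T) {v : V} (hv : v ∈ T) :
    typeProb p ω T u {A | v ∈ A} = edgeProb K P p := by
  have h := sampleLaw_real_ring_channels (K := K) (P := P) (p := p) u
    {R | ¬ Disjoint R.1 (ω.1 v).1} {s(u, v)}
  rw [ringLaw_real_not_disjoint] at h
  rw [typeProb, edgeProb, mul_comm, ← pow_one (p : ℝ), ← Finset.card_singleton s(u, v), ← h]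
  congr 1
  ext ω'
  simp [nbrsIn_resample hu, hv]

lemma typeProb_mem_both (hu : u ∉ T) {v w : V} (hv : v ∈ T) (hw : w ∈ T) (hvw : v ≠ w) :
    typeProb p ω T u {A | v ∈ A ∧ w ∈ A} = (ringLaw K P).real
      {R | ¬ Disjoint R.1 (ω.1 v).1 ∧ ¬ Disjoint R.1 (ω.1 w).1} * (p : ℝ) ^ 2 := by
  have h := sampleLaw_real_ring_channels (K := K) (P := P) (p := p) u
    {R | ¬ Disjoint R.1 (ω.1 v).1 ∧ ¬ Disjoint R.1 (ω.1 w).1} {s(u, v), s(u, w)}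
  have hne : s(u, v) ≠ s(u, w) := fun h => hvw (Sym2.congr_right.mp h)
  rw [Finset.card_pair hne] at h
  rw [typeProb, ← h]
  congr 1
  ext ω'
  simp [nbrsIn_resample hu, hv, hw]
  tauto

/-- The pair bound that needs no hypothesis on the rings: the two channels are independent. -/
lemma typeProb_mem_both_le (hu : u ∉ T) {v w : V} (hv : v ∈ T) (hw : w ∈ T) (hvw : v ≠ w) :
    typeProb p ω T u {A | v ∈ A ∧ w ∈ A} ≤ p * edgeProb K P p := by
  rw [typeProb_mem_both ω hu hv hw hvw, edgeProb, ← ringLaw_real_not_disjoint (ω.1 v)]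
  have : (ringLaw K P).real {R | ¬ Disjoint R.1 (ω.1 v).1 ∧ ¬ Disjoint R.1 (ω.1 w).1} ≤
      (ringLaw K P).real {R | ¬ Disjoint R.1 (ω.1 v).1} := measureReal_mono fun R hR => hR.1
  have hp := p.2.1
  calc _ ≤ (ringLaw K P).real {R | ¬ Disjoint R.1 (ω.1 v).1} * (p : ℝ) ^ 2 := by gcongr
    _ = _ := by ring

lemma typeProb_mem_both_le_of_overlap (hu : u ∉ T) {v w : V} (hv : v ∈ T) (hw : w ∈ T)
    (hvw : v ≠ w) {d : ℕ} (hd : ((ω.1 v).1 ∩ (ω.1 w).1).card ≤ d) :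
    typeProb p ω T u {A | v ∈ A ∧ w ∈ A} ≤
      p ^ 2 * (d * ((K : ℝ) / P) + ((K : ℝ) ^ 2 / P) ^ 2) := by
  rw [typeProb_mem_both ω hu hv hw hvw, mul_comm]
  have hp := p.2.1
  gcongr
  exact ringLaw_real_meet_both_le _ _ hd

lemma typeProb_mono {𝒜 ℬ : Set (Finset V)} (h : ∀ A ⊆ T, A ∈ 𝒜 → A ∈ ℬ) :
    typeProb p ω T u 𝒜 ≤ typeProb p ω T u ℬ :=
  measureReal_mono fun _ hω' => h _ (nbrsIn_subset _ _ _) hω'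

lemma typeProb_nonempty_le (hu : u ∉ T) :
    typeProb p ω T u {A | A.Nonempty} ≤ T.card * edgeProb K P p := by
  calc typeProb p ω T u {A | A.Nonempty}
      ≤ (sampleLaw V K P p).real
        (⋃ v ∈ T, {ω' | nbrsIn (resample u ω ω') T u ∈ {A | v ∈ A}}) := by
        refine measureReal_mono ?_ (measure_ne_top _ _)
        rintro ω' ⟨v, hv⟩
        simp only [Set.mem_iUnion]
        exact ⟨v, nbrsIn_subset _ _ _ hv, hv⟩
    _ ≤ ∑ v ∈ T, typeProb p ω T u {A | v ∈ A} := measureReal_biUnion_finset_le _ _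
    _ = ∑ v ∈ T, edgeProb K P p := Finset.sum_congr rfl fun v hv => typeProb_mem ω hu hv
    _ = _ := by rw [Finset.sum_const, nsmul_eq_mul]

lemma typeProb_two_le {β : ℝ}
    (hβ : ∀ v ∈ T, ∀ w ∈ T, v ≠ w → typeProb p ω T u {A | v ∈ A ∧ w ∈ A} ≤ β) (hβ0 : 0 ≤ β) :
    typeProb p ω T u {A | 2 ≤ A.card} ≤ (T.card : ℝ) ^ 2 * β := by
  calc typeProb p ω T u {A | 2 ≤ A.card}
      ≤ (sampleLaw V K P p).real (⋃ z ∈ (T ×ˢ T).filter fun z => z.1 ≠ z.2,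
          {ω' | nbrsIn (resample u ω ω') T u ∈ {A | z.1 ∈ A ∧ z.2 ∈ A}}) := by
        refine measureReal_mono ?_ (measure_ne_top _ _)
        intro ω' h
        obtain ⟨v, hv, w, hw, hvw⟩ := Finset.one_lt_card.mp h
        simp only [Set.mem_iUnion]
        refine ⟨(v, w), ?_, hv, hw⟩
        simpa [hvw] using ⟨nbrsIn_subset _ _ _ hv, nbrsIn_subset _ _ _ hw⟩
    _ ≤ ∑ z ∈ (T ×ˢ T).filter fun z => z.1 ≠ z.2,
          typeProb p ω T u {A | z.1 ∈ A ∧ z.2 ∈ A} := measureReal_biUnion_finset_le _ _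
    _ ≤ ∑ z ∈ (T ×ˢ T).filter fun z => z.1 ≠ z.2, β := by
        refine Finset.sum_le_sum fun z hz => ?_
        simp only [Finset.mem_filter, Finset.mem_product] at hz
        exact hβ _ hz.1.1 _ hz.1.2 hz.2
    _ ≤ _ := by
        rw [Finset.sum_const, nsmul_eq_mul]
        gcongr
        have := Finset.card_filter_le (T ×ˢ T) fun z => z.1 ≠ z.2
        rw [Finset.card_product] at this
        rw [sq]; exact_mod_cast this

lemma typeProb_compl (𝒜 : Set (Finset V)) :
    typeProb p ω T u 𝒜ᶜ = 1 - typeProb p ω T u 𝒜 :=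
  probReal_compl_eq_one_sub (s := {ω' | nbrsIn (resample u ω ω') T u ∈ 𝒜}) .of_discrete

lemma typeProb_empty : typeProb p ω T u {∅} = 1 - typeProb p ω T u {A | A.Nonempty} := by
  rw [← typeProb_compl]
  congr 1
  ext A
  simp [Finset.not_nonempty_iff_eq_empty]

lemma one_sub_le_typeProb_empty (hu : u ∉ T) :
    1 - T.card * edgeProb K P p ≤ typeProb p ω T u {∅} := by
  rw [typeProb_empty]
  linarith [typeProb_nonempty_le (p := p) ω hu]

lemma le_typeProb_singleton (hu : u ∉ T) {v : V} (hv : v ∈ T) :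
    edgeProb K P p - typeProb p ω T u {A | 2 ≤ A.card} ≤ typeProb p ω T u {{v}} := by
  rw [← typeProb_mem ω hu hv, sub_le_iff_le_add]
  refine (measureReal_mono ?_ (measure_ne_top _ _)).trans (measureReal_union_le _ _)
  intro ω' h
  by_cases h2 : 2 ≤ (nbrsIn (resample u ω ω') T u).card
  · exact .inr h2
  · refine .inl ?_
    have h1 : (nbrsIn (resample u ω ω') T u).card ≤ 1 := by omega
    simp only [Set.mem_ofPred_eq, Set.mem_singleton_iff] at h ⊢
    exact Finset.eq_singleton_iff_unique_mem.mpr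
      ⟨h, fun w hw => Finset.card_le_one.mp h1 w hw v h⟩

/-- Inclusion–exclusion to second order: the events that `v` is the only neighbour of `u` in `T` are
disjoint. -/
lemma typeProb_empty_le (hu : u ∉ T) :
    typeProb p ω T u {∅} ≤
      1 - T.card * edgeProb K P p + T.card * typeProb p ω T u {A | 2 ≤ A.card} := by
  have h1 : ∑ v ∈ T, (edgeProb K P p - typeProb p ω T u {A | 2 ≤ A.card}) ≤
      typeProb p ω T u {A | A.Nonempty} := by
    calc _ ≤ ∑ v ∈ T, typeProb p ω T u {{v}} :=
          Finset.sum_le_sum fun v hv => le_typeProb_singleton ω hu hv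
      _ = (sampleLaw V K P p).real
          (⋃ v ∈ T, {ω' | nbrsIn (resample u ω ω') T u ∈ ({{v}} : Set (Finset V))}) := by
          rw [measureReal_biUnion_finset _ fun _ _ => .of_discrete]
          · rfl
          · intro v _ w _ hvw
            refine Set.disjoint_left.mpr fun ω' h h' => hvw ?_
            simp only [Set.mem_ofPred_eq, Set.mem_singleton_iff] at h h'
            simpa using h.symm.trans h'
      _ ≤ _ := by
          refine measureReal_mono ?_ (measure_ne_top _ _)
          intro ω' h
          simp only [Set.mem_iUnion, Set.mem_ofPred_eq, Set.mem_singleton_iff] at h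
          obtain ⟨v, -, h⟩ := h
          simp [h]
  rw [Finset.sum_const, nsmul_eq_mul] at h1
  rw [typeProb_empty]
  linarith

/-- A set with two vertices that rarely have a common neighbour is joined to `u` with probability
noticeably larger than the edge probability. -/
lemma typeProb_empty_le_of_pair (hu : u ∉ T) {v w : V} (hv : v ∈ T) (hw : w ∈ T) {β : ℝ}
    (hβ : typeProb p ω T u {A | v ∈ A ∧ w ∈ A} ≤ β) :
    typeProb p ω T u {∅} ≤ 1 - 2 * edgeProb K P p + β := by
  have h := measureReal_union_add_inter (μ := sampleLaw V K P p)
    (s := {ω' | nbrsIn (resample u ω ω') T u ∈ {A | v ∈ A}})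
    (t := {ω' | nbrsIn (resample u ω ω') T u ∈ {A | w ∈ A}}) .of_discrete
  have h1 := typeProb_mem (p := p) ω hu hv
  have h2 := typeProb_mem (p := p) ω hu hw
  have h3 : (sampleLaw V K P p).real ({ω' | nbrsIn (resample u ω ω') T u ∈ {A | v ∈ A}} ∪
      {ω' | nbrsIn (resample u ω ω') T u ∈ {A | w ∈ A}}) ≤ typeProb p ω T u {A | A.Nonempty} := by
    refine measureReal_mono ?_ (measure_ne_top _ _)
    rintro ω' (h | h)
    · exact ⟨v, h⟩
    · exact ⟨w, h⟩
  rw [typeProb_empty]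
  unfold typeProb at h1 h2 hβ h3 ⊢
  have h4 : (sampleLaw V K P p).real ({ω' | nbrsIn (resample u ω ω') T u ∈ {A | v ∈ A}} ∩
      {ω' | nbrsIn (resample u ω ω') T u ∈ {A | w ∈ A}}) ≤ β := hβ
  linarith

lemma exp_neg_min_le {x y : ℝ} (hx : 0 ≤ x) (hy : 0 ≤ y) :
    Real.exp (-min x y) ≤ 1 - (1 - Real.exp (-y)) * (1 - Real.exp (-x)) := by
  have h1 : Real.exp (-x) ≤ 1 := Real.exp_le_one_iff.mpr (by linarith)
  have h2 : Real.exp (-y) ≤ 1 := Real.exp_le_one_iff.mpr (by linarith)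
  have h3 := Real.exp_pos (-x)
  have h4 := Real.exp_pos (-y)
  rcases min_cases x y with ⟨h, -⟩ | ⟨h, -⟩ <;> rw [h] <;> nlinarith

open Classical in
/-- If the rings of each `J ⊆ T` cover many keys, then a vertex `u ∉ T` is likely to have a
neighbour in `T`: condition on the set `J` of vertices of `T` whose channel to `u` is on. -/
lemma typeProb_empty_le_of_expansion (hu : u ∉ T) {a b : ℝ} (ha : 0 ≤ a) (hb : 0 ≤ b)
    (hJ : ∀ J ⊆ T, min (a * J.card) b ≤ K * (J.biUnion fun v => (ω.1 v).1).card / P) :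
    typeProb p ω T u {∅} ≤
      1 - (1 - Real.exp (-b)) * (1 - (1 - p * (1 - Real.exp (-a))) ^ T.card) := by
  set J : (Sym2 V → Prop) → Finset V := fun β => T.filter fun v => β s(u, v)
  set U : (Sym2 V → Prop) → Finset (Fin P) := fun β => (J β).biUnion fun v => (ω.1 v).1
  have h1 : typeProb p ω T u {∅} = (sampleLaw V K P p).real {ω' | Disjoint (ω'.1 u).1 (U ω'.2)} := by
    rw [typeProb]
    congr 1
    ext ω'
    simp only [Set.mem_ofPred_eq, Set.mem_singleton_iff, Finset.eq_empty_iff_forall_notMem,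
      nbrsIn_resample hu, U, J, Finset.disjoint_biUnion_right, Finset.mem_filter]
    refine forall_congr' fun v => ?_
    tauto
  have h2 : (sampleLaw V K P p).real {ω' | Disjoint (ω'.1 u).1 (U ω'.2)} =
      ∫ β, (ringLaw K P).real {R | Disjoint R.1 (U β)} ∂(Measure.pi fun _ : Sym2 V => channelLaw p) := by
    rw [← integral_indicator_one .of_discrete, sampleLaw, integral_prod_symm _ .of_finite]
    refine integral_congr_ae (.of_forall fun β => ?_)
    have h3 : (fun S : V → KeyRing K P => ({ω' | Disjoint (ω'.1 u).1 (U ω'.2)} :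
        Set (Sample V K P)).indicator (1 : Sample V K P → ℝ) (S, β)) =
        (Function.eval u ⁻¹' {R : KeyRing K P | Disjoint R.1 (U β)}).indicator 1 := by
      ext S
      simp [Set.indicator_apply]
    simp only [h3]
    rw [integral_indicator_one .of_discrete]
    exact (measurePreserving_eval (fun _ : V => ringLaw K P) u).measureReal_preimage
      MeasurableSet.of_discrete.nullMeasurableSet
  have hprod : ∀ β : Sym2 V → Prop, Real.exp (-(a * (J β).card)) =
      ∏ e, (if e ∈ T.image (fun v => s(u, v)) then (if β e then Real.exp (-a) else 1) else 1) := by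
    intro β
    rw [Finset.prod_ite_mem, Finset.univ_inter, Finset.prod_image (by simp),
      Finset.prod_ite, Finset.prod_const, Finset.prod_const_one, mul_one, ← Real.exp_nat_mul]
    congr 1
    ring
  have hint : ∫ β, Real.exp (-(a * (J β).card)) ∂(Measure.pi fun _ : Sym2 V => channelLaw p) =
      (1 - p * (1 - Real.exp (-a))) ^ T.card := by
    simp only [hprod]
    rw [integral_fintype_prod_eq_prod (𝕜 := ℝ) (fun (e : Sym2 V) (b : Prop) =>
      if e ∈ T.image (fun v => s(u, v)) then (if b then Real.exp (-a) else 1) else 1)]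
    have : ∀ e : Sym2 V, (∫ b, (if e ∈ T.image (fun v => s(u, v)) then
        (if b then Real.exp (-a) else 1) else 1) ∂(channelLaw p)) =
        if e ∈ T.image (fun v => s(u, v)) then 1 - p * (1 - Real.exp (-a)) else 1 := by
      intro e
      split_ifs with he
      · rw [channelLaw, integral_add_measure .of_finite .of_finite,
          integral_smul_nnreal_measure, integral_smul_nnreal_measure, integral_dirac,
          integral_dirac]
        simp [NNReal.smul_def]
        ring
      · simp
    simp only [this]
    rw [Finset.prod_ite_mem, Finset.univ_inter, Finset.prod_const,
      Finset.card_image_of_injective _ (fun v w h => by simpa using (Sym2.congr_right.mp h))]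
  rw [h1, h2, ← hint]
  calc _ ≤ ∫ β, (1 - (1 - Real.exp (-b)) * (1 - Real.exp (-(a * (J β).card))))
        ∂(Measure.pi fun _ : Sym2 V => channelLaw p) := by
        refine integral_mono .of_finite .of_finite fun β => ?_
        refine (ringLaw_real_disjoint_le _).trans (le_trans ?_ (exp_neg_min_le (by positivity) hb))
        exact Real.exp_le_exp.mpr (neg_le_neg (hJ _ (Finset.filter_subset _ _)))
    _ = _ := by
        rw [integral_sub .of_finite .of_finite, integral_const_mul,
          integral_sub .of_finite .of_finite]
        simp

end TypeProb

/-! ### Events about a set of vertices and its outside -/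

section Events

variable {V : Type*} [Fintype V] [DecidableEq V] {K P : ℕ} {p : unitInterval}
  [Nonempty (KeyRing K P)]

open Classical in
/-- The probability of prescribed types of neighbourhoods in `T`, given an event about `T`. -/
lemma sampleLaw_real_inter_nbrsIn {T Y : Finset V} (hY : Disjoint Y T) {D : Set (Sample V K P)}
    (hD : DependsOnlyOn (fun ω => ω ∈ D) T) (𝒜 : V → Set (Finset V)) :
    (sampleLaw V K P p).real (D ∩ {ω | ∀ u ∈ Y, nbrsIn ω T u ∈ 𝒜 u}) =
      ∫ ω, D.indicator 1 ω * ∏ u ∈ Y, typeProb p ω T u (𝒜 u) ∂(sampleLaw V K P p) := by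
  rw [← integral_mul_prod_nbrsIn Y hY (Φ := D.indicator 1) (𝒜 := 𝒜), ← integral_indicator_one
    .of_discrete]
  · refine integral_congr_ae (.of_forall fun ω => ?_)
    simp only [Set.indicator_apply, Set.mem_inter_iff, Set.mem_ofPred_eq, Pi.one_apply]
    rw [Finset.prod_ite_zero]
    split_ifs <;> simp_all
  · intro u hu ω ω'
    have := hD u hu ω ω'
    simp only [eq_iff_iff] at this
    simp [Set.indicator_apply, this]

lemma sampleLaw_real_inter_nbrsIn_le {T Y : Finset V} (hY : Disjoint Y T)
    {D : Set (Sample V K P)} (hD : DependsOnlyOn (fun ω => ω ∈ D) T) {𝒜 : V → Set (Finset V)}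
    {B : V → ℝ} (hB : ∀ ω ∈ D, ∀ u ∈ Y, typeProb p ω T u (𝒜 u) ≤ B u) :
    (sampleLaw V K P p).real (D ∩ {ω | ∀ u ∈ Y, nbrsIn ω T u ∈ 𝒜 u}) ≤
      (sampleLaw V K P p).real D * ∏ u ∈ Y, B u := by
  rw [sampleLaw_real_inter_nbrsIn hY hD, ← integral_indicator_one .of_discrete,
    ← integral_mul_const]
  refine integral_mono .of_finite .of_finite fun ω => ?_
  by_cases hω : ω ∈ D
  · simp only [hω, Set.indicator_of_mem, Pi.one_apply, one_mul]
    exact Finset.prod_le_prod (fun u _ => typeProb_nonneg _ _ _ _) (hB ω hω)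
  · simp [hω]

lemma le_sampleLaw_real_inter_nbrsIn {T Y : Finset V} (hY : Disjoint Y T)
    {D : Set (Sample V K P)} (hD : DependsOnlyOn (fun ω => ω ∈ D) T) {𝒜 : V → Set (Finset V)}
    {B : V → ℝ} (hB : ∀ ω ∈ D, ∀ u ∈ Y, B u ≤ typeProb p ω T u (𝒜 u)) (hB0 : ∀ u ∈ Y, 0 ≤ B u) :
    (sampleLaw V K P p).real D * ∏ u ∈ Y, B u ≤
      (sampleLaw V K P p).real (D ∩ {ω | ∀ u ∈ Y, nbrsIn ω T u ∈ 𝒜 u}) := by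
  rw [sampleLaw_real_inter_nbrsIn hY hD, ← integral_indicator_one .of_discrete,
    ← integral_mul_const]
  refine integral_mono .of_finite .of_finite fun ω => ?_
  by_cases hω : ω ∈ D
  · simp only [hω, Set.indicator_of_mem, Pi.one_apply, one_mul]
    exact Finset.prod_le_prod hB0 (hB ω hω)
  · simp [hω]

/-! ### Connected sets -/

/-- The edges `v — f v` of a forest are present with the probability of independent edges: peel
off a vertex of maximal rank. -/
lemma sampleLaw_real_forest_le (f : V → V) (g : V → ℕ) (T : Finset V)
    (hg : ∀ v ∈ T, g (f v) < g v) :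
    (sampleLaw V K P p).real {ω | ∀ v ∈ T, (sampleGraph ω).Adj v (f v)} ≤
      edgeProb K P p ^ T.card := by
  induction T using Finset.induction_on_max_value g with
  | empty => simp
  | insert u T hu hmax ih =>
    set Q : Finset V := Finset.univ.erase u
    have hne : ∀ v ∈ insert u T, f v ≠ u := by
      intro v hv h
      have h1 := hg v hv
      rw [h] at h1
      rcases Finset.mem_insert.mp hv with rfl | hv
      · exact absurd h1 (lt_irrefl _)
      · exact absurd (hmax v hv) (by omega)
    have hD : DependsOnlyOn (fun ω : Sample V K P =>
        ω ∈ {ω | ∀ v ∈ T, (sampleGraph ω).Adj v (f v)}) Q := by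
      intro w hw ω ω'
      obtain rfl : w = u := by simpa [Q] using hw
      simp only [Set.mem_ofPred_eq, eq_iff_iff]
      refine forall₂_congr fun v hv => ?_
      exact resample_adj (ne_of_mem_of_not_mem hv hu) (hne v (Finset.mem_insert_of_mem hv)) _ _
    have hfu : u ∉ ({f u} : Finset V) := by
      simpa using (hne u (Finset.mem_insert_self _ _)).symm
    classical
    have h := integral_mul_nbrsIn (p := p) {f u} (Q := Q) (u := u)
      (Φ := Set.indicator {ω : Sample V K P | ∀ v ∈ T, (sampleGraph ω).Adj v (f v)} 1)
      (by
        intro w hw ω ω'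
        have := hD w hw ω ω'
        simp only [eq_iff_iff] at this
        simp only [Set.indicator_apply, this, Pi.one_apply])
      (by simp [Q]) {A | f u ∈ A}
    simp only [typeProb_mem _ hfu (Finset.mem_singleton_self _)] at h
    rw [integral_mul_const, integral_indicator_one .of_discrete] at h
    rw [Finset.card_insert_of_notMem hu, pow_succ]
    calc _ = _ := by
          rw [← integral_indicator_one .of_discrete]
          refine integral_congr_ae (.of_forall fun ω => ?_)
          simp only [Set.indicator_apply, nbrsIn, Finset.mem_insert, forall_eq_or_imp, Set.mem_ofPred_eq,
            Finset.mem_filter, Finset.mem_singleton, true_and, Pi.one_apply]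
          split_ifs <;> simp_all
      _ = _ := h
      _ ≤ _ := by
          gcongr
          · exact edgeProb_nonneg
          · exact ih fun v hv => hg v (Finset.mem_insert_of_mem hv)

end Events

/-- A connected graph on `T` has a spanning tree, given by the parent function `f` towards the root
`r`; the distance `g` to the root decreases along it. Outside `T` the value of `f` is fixed, so that
parent functions can be counted. -/
lemma exists_parent_of_connected {V : Type*} {G : SimpleGraph V} {T : Finset V}
    (hG : (G.induce (T : Set V)).Connected) {r : V} (hr : r ∈ T) :
    ∃ (f : V → V) (g : V → ℕ), (∀ v ∈ T, v ≠ r → f v ∈ T ∧ g (f v) < g v ∧ G.Adj v (f v)) ∧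
      ∀ v, v ∉ T ∨ v = r → f v = r := by
  classical
  let r' : (T : Set V) := ⟨r, hr⟩
  have key : ∀ v : (T : Set V), v ≠ r' → ∃ w : (T : Set V),
      (G.induce (T : Set V)).dist w r' < (G.induce (T : Set V)).dist v r' ∧
      (G.induce (T : Set V)).Adj v w := by
    intro v hv
    obtain ⟨W, hW⟩ := hG.exists_walk_length_eq_dist v r'
    cases W with
    | nil => exact absurd rfl hv
    | cons h W' =>
      refine ⟨_, ?_, h⟩
      rw [← hW, SimpleGraph.Walk.length_cons]
      exact Nat.lt_succ_of_le (SimpleGraph.dist_le _)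
  choose f hf1 hf2 using key
  set F : V → V := fun v => if h : ∃ h : v ∈ T, v ≠ r then
    (f ⟨v, h.1⟩ (fun h' => h.2 (congrArg Subtype.val h'))).1 else r with hF
  set g : V → ℕ := fun v => if h : v ∈ T then (G.induce (T : Set V)).dist ⟨v, h⟩ r' else 0 with hg
  have hgT : ∀ v : (T : Set V), g v.1 = (G.induce (T : Set V)).dist v r' := fun v => dif_pos v.2
  refine ⟨F, g, fun v hv hvr => ?_, fun v hv => ?_⟩
  · have hne : (⟨v, hv⟩ : (T : Set V)) ≠ r' := fun h' => hvr (congrArg Subtype.val h')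
    have hFv : F v = (f ⟨v, hv⟩ hne).1 := dif_pos (⟨hv, hvr⟩ : ∃ h : v ∈ T, v ≠ r)
    rw [hFv]
    refine ⟨(f ⟨v, hv⟩ hne).2, ?_, hf2 ⟨v, hv⟩ hne⟩
    rw [hgT, hgT ⟨v, hv⟩]
    exact hf1 _ _
  · simp only [hF]
    rw [dif_neg]
    rintro ⟨h1, h2⟩
    tauto

section Events

variable {V : Type*} [Fintype V] [DecidableEq V] {K P : ℕ} {p : unitInterval}
  [Nonempty (KeyRing K P)]

/-- A union bound over the rooted spanning trees of `T`, encoded by their parent functions. -/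
lemma sampleLaw_real_connected_le {T : Finset V} (hT : T.Nonempty) :
    (sampleLaw V K P p).real {ω | ((sampleGraph ω).induce (T : Set V)).Connected} ≤
      (T.card * edgeProb K P p) ^ (T.card - 1) := by
  classical
  obtain ⟨r, hr⟩ := hT
  set F : Finset (V → V) := Fintype.piFinset fun v => if v ∈ T.erase r then T else {r} with hF
  set F' := F.filter fun f => ∃ g : V → ℕ, ∀ v ∈ T.erase r, g (f v) < g v
  have hcard : F.card = T.card ^ (T.card - 1) := by
    rw [hF, Fintype.card_piFinset]
    simp only [apply_ite Finset.card, Finset.card_singleton]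
    rw [Finset.prod_ite_mem, Finset.univ_inter, Finset.prod_const, Finset.card_erase_of_mem hr]
  calc _ ≤ (sampleLaw V K P p).real
        (⋃ f ∈ F', {ω | ∀ v ∈ T.erase r, (sampleGraph ω).Adj v (f v)}) := by
        refine measureReal_mono ?_ (measure_ne_top _ _)
        intro ω hω
        obtain ⟨f, g, h1, h2⟩ := exists_parent_of_connected hω hr
        simp only [Set.mem_iUnion]
        refine ⟨f, ?_, fun v hv => ?_⟩
        · refine Finset.mem_filter.mpr ⟨Fintype.mem_piFinset.mpr fun v => ?_, g, fun v hv => ?_⟩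
          · split_ifs with hv
            · exact (h1 v (Finset.mem_of_mem_erase hv) (Finset.ne_of_mem_erase hv)).1
            · rw [Finset.mem_singleton]
              apply h2
              rw [Finset.mem_erase] at hv
              tauto
          · exact (h1 v (Finset.mem_of_mem_erase hv) (Finset.ne_of_mem_erase hv)).2.1
        · exact (h1 v (Finset.mem_of_mem_erase hv) (Finset.ne_of_mem_erase hv)).2.2
    _ ≤ ∑ f ∈ F', (sampleLaw V K P p).real
          {ω | ∀ v ∈ T.erase r, (sampleGraph ω).Adj v (f v)} := measureReal_biUnion_finset_le _ _
    _ ≤ ∑ f ∈ F', edgeProb K P p ^ (T.card - 1) := by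
        refine Finset.sum_le_sum fun f hf => ?_
        obtain ⟨g, hg⟩ := (Finset.mem_filter.mp hf).2
        rw [← Finset.card_erase_of_mem hr]
        exact sampleLaw_real_forest_le f g _ hg
    _ ≤ ∑ f ∈ F, edgeProb K P p ^ (T.card - 1) :=
        Finset.sum_le_sum_of_subset_of_nonneg (Finset.filter_subset _ _)
          fun _ _ _ => pow_nonneg edgeProb_nonneg _
    _ = _ := by rw [Finset.sum_const, hcard, nsmul_eq_mul, mul_pow]; push_cast; ring

/-! ### Overlaps and expansion of key rings -/

lemma sampleLaw_real_overlap_le {v w : V} (hvw : v ≠ w) (d : ℕ) :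
    (sampleLaw V K P p).real {ω | d ≤ ((ω.1 v).1 ∩ (ω.1 w).1).card} ≤ ((K : ℝ) ^ 2 / P) ^ d := by
  rw [← integral_indicator_one .of_discrete, integral_resample w]
  calc _ ≤ ∫ _, ((K : ℝ) ^ 2 / P) ^ d ∂(sampleLaw V K P p) := by
        refine integral_mono .of_finite .of_finite fun ω => ?_
        refine le_trans (le_of_eq ?_) (ringLaw_real_overlap_le (ω.1 v) d)
        have h := sampleLaw_real_ring_channels (p := p) w
          {R : KeyRing K P | d ≤ ((ω.1 v).1 ∩ R.1).card} ∅
        simp only [Finset.notMem_empty, false_imp_iff, implies_true, and_true, Finset.card_empty,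
          pow_zero, mul_one] at h
        rw [← h, ← integral_indicator_one .of_discrete]
        refine integral_congr_ae (.of_forall fun ω' => ?_)
        simp [Set.indicator_apply, resample, hvw]
    _ = _ := by simp

lemma sampleLaw_real_forall_ring (J : Finset V) (𝓡 : Set (KeyRing K P)) :
    (sampleLaw V K P p).real {ω | ∀ v ∈ J, ω.1 v ∈ 𝓡} = (ringLaw K P).real 𝓡 ^ J.card := by
  classical
  have : {ω : Sample V K P | ∀ v ∈ J, ω.1 v ∈ 𝓡} =
      (Set.univ.pi fun v => if v ∈ J then 𝓡 else Set.univ) ×ˢ Set.univ := by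
    ext ω
    simp only [Set.mem_ofPred_eq, Set.mem_prod, Set.mem_pi, Set.mem_univ, true_imp_iff, and_true]
    refine forall_congr' fun v => ?_
    by_cases hv : v ∈ J <;> simp [hv]
  rw [this, sampleLaw, measureReal_prod_prod, measureReal_def, Measure.pi_pi, ENNReal.toReal_prod]
  simp only [probReal_univ, mul_one]
  rw [← Finset.prod_const, ← Finset.prod_subset (Finset.subset_univ J)]
  · exact Finset.prod_congr rfl fun e he => by simp [he, measureReal_def]
  · intro e _ he
    simp [he]

lemma choose_mul_div_pow_le {P x : ℕ} (hP : 0 < P) :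
    (P.choose x : ℝ) * ((x : ℝ) / P) ^ x ≤ Real.exp x := by
  have h1 : (P.choose x : ℝ) ≤ (P : ℝ) ^ x / x.factorial := Nat.choose_le_pow_div x P
  have h2 : (x : ℝ) ^ x / x.factorial ≤ Real.exp x :=
    Real.pow_div_factorial_le_exp _ (by positivity) x
  calc _ ≤ (P : ℝ) ^ x / x.factorial * ((x : ℝ) / P) ^ x := by gcongr
    _ = (x : ℝ) ^ x / x.factorial := by rw [div_pow]; field_simp
    _ ≤ _ := h2

/-- It is unlikely that the rings of `J` cover fewer than a quarter of the keys they could. -/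
lemma sampleLaw_real_not_expand_le (hK : 2 ≤ K) {J : Finset V} (hJ : K * J.card ≤ P)
    (hJ0 : J.Nonempty) :
    (sampleLaw V K P p).real {ω | 4 * (J.biUnion fun v => (ω.1 v).1).card < K * J.card} ≤
      ((K * J.card / P : ℝ) / 2 ^ K) ^ J.card := by
  set j := J.card with hj
  have hj0 : 0 < j := Finset.card_pos.mpr hJ0
  -- The union lies in some set of `x` keys, where `x` is a quarter of the total, rounded down.
  set x := K * j / 4 with hx
  have hP : 0 < P := by nlinarith
  have hx4 : 4 * x ≤ K * j := by omega
  have hxP : x ≤ P := by omega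
  set y : ℝ := K * j / P with hy
  have hy0 : 0 ≤ y := by positivity
  have hy1 : y ≤ 1 := by
    rw [hy, div_le_one (by positivity)]; exact_mod_cast hJ
  have h1 : (sampleLaw V K P p).real {ω | 4 * (J.biUnion fun v => (ω.1 v).1).card < K * j} ≤
      (P.choose x : ℝ) * ((x : ℝ) / P) ^ (K * j) := by
    calc _ ≤ (sampleLaw V K P p).real (⋃ X ∈ Finset.powersetCard x (Finset.univ : Finset (Fin P)),
          {ω | ∀ v ∈ J, ω.1 v ∈ {R : KeyRing K P | R.1 ⊆ X}}) := by
          refine measureReal_mono ?_ (measure_ne_top _ _)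
          intro ω hω
          obtain ⟨X, hX, hXc⟩ := Finset.exists_superset_card_eq
            (s := J.biUnion fun v => (ω.1 v).1) (n := x) (by
              simp only [Set.mem_ofPred_eq] at hω; omega) (by simpa using hxP)
          simp only [Set.mem_iUnion]
          refine ⟨X, by simp [hXc], fun v hv => ?_⟩
          exact (Finset.subset_biUnion_of_mem (fun v => (ω.1 v).1) hv).trans hX
      _ ≤ ∑ X ∈ Finset.powersetCard x (Finset.univ : Finset (Fin P)), (sampleLaw V K P p).real
          {ω | ∀ v ∈ J, ω.1 v ∈ {R : KeyRing K P | R.1 ⊆ X}} := measureReal_biUnion_finset_le _ _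
      _ ≤ ∑ X ∈ Finset.powersetCard x (Finset.univ : Finset (Fin P)),
          ((x : ℝ) / P) ^ (K * j) := by
          refine Finset.sum_le_sum fun X hX => ?_
          rw [sampleLaw_real_forall_ring, pow_mul, ← hj]
          have := ringLaw_real_subset_le (K := K) X
          rw [(Finset.mem_powersetCard.mp hX).2] at this
          gcongr
      _ = _ := by rw [Finset.sum_const, Finset.card_powersetCard, nsmul_eq_mul]; simp
  refine h1.trans ?_
  have hxy : (x : ℝ) / P ≤ y / 4 := by
    rw [hy, div_div, mul_comm (P : ℝ) 4, ← div_div]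
    gcongr
    have : (4 * x : ℝ) ≤ K * j := by exact_mod_cast hx4
    linarith
  obtain ⟨c, hc⟩ : ∃ c, K * j = x + c := ⟨K * j - x, by omega⟩
  have hcj : j ≤ c := by nlinarith
  have hexp : Real.exp x ≤ (4 : ℝ) ^ x := by
    rw [← mul_one (x : ℝ), Real.exp_nat_mul]
    gcongr
    linarith [Real.exp_one_lt_d9]
  calc (P.choose x : ℝ) * ((x : ℝ) / P) ^ (K * j)
      = (P.choose x : ℝ) * ((x : ℝ) / P) ^ x * ((x : ℝ) / P) ^ c := by rw [hc, pow_add, mul_assoc]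
    _ ≤ (4 : ℝ) ^ x * (y / 4) ^ c := by
        gcongr
        exact (choose_mul_div_pow_le hP).trans hexp
    _ = y ^ c * ((4 : ℝ) ^ x / 4 ^ c) := by rw [div_pow]; ring
    _ ≤ y ^ j * (1 / 2 ^ (K * j)) := by
        refine mul_le_mul ?_ ?_ (div_nonneg (pow_nonneg (by norm_num) _) (pow_nonneg (by norm_num) _))
          (pow_nonneg hy0 _)
        · exact pow_le_pow_of_le_one hy0 hy1 hcj
        · have h4 : ∀ i : ℕ, (4 : ℝ) ^ i = 2 ^ (2 * i) := fun i => by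
            rw [pow_mul]; norm_num
          rw [div_le_div_iff₀ (by positivity) (by positivity), one_mul, h4, h4, ← pow_add]
          exact pow_le_pow_right₀ (by norm_num) (by omega)
    _ = _ := by rw [div_pow y, ← pow_mul]; ring

/-- The rings of every set `J ⊆ T` of vertices that hold at most `P` keys in total, counted with
multiplicity, cover at least a quarter of that total. -/
def Expanding (T : Finset V) (ω : Sample V K P) : Prop :=
  ∀ J ⊆ T, K * J.card ≤ P → K * J.card ≤ 4 * (J.biUnion fun v => (ω.1 v).1).card

lemma dependsOnlyOn_expanding (T : Finset V) :
    DependsOnlyOn (fun ω : Sample V K P => Expanding T ω) T := by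
  intro u hu ω ω'
  simp only [Expanding, eq_iff_iff]
  refine forall₃_congr fun J hJ _ => ?_
  have : (J.biUnion fun v => ((resample u ω ω').1 v).1) = J.biUnion fun v => (ω.1 v).1 :=
    Finset.biUnion_congr rfl fun v hv => by
      rw [resample_fst (ne_of_mem_of_not_mem (hJ hv) hu)]
  rw [this]

/-- A union bound over all sets of vertices, dominated by a geometric series of ratio `ρ`. -/
lemma sampleLaw_real_not_expanding_le (hK : 2 ≤ K) {ρ : ℝ}
    (hρ : Real.exp 1 * (Fintype.card V * K / P) / 2 ^ K ≤ ρ) (hρ1 : ρ ≤ 1 / 2) :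
    (sampleLaw V K P p).real {ω | ¬ Expanding (Finset.univ : Finset V) ω} ≤ 2 * ρ := by
  set n := Fintype.card V
  set ρ₀ := Real.exp 1 * (n * K / P) / 2 ^ K with hρ₀
  have hρ0 : 0 ≤ ρ₀ := by positivity
  set 𝒥 := (Finset.univ : Finset (Finset V)).filter fun J => J.Nonempty ∧ K * J.card ≤ P with h𝒥
  calc _ ≤ (sampleLaw V K P p).real
        (⋃ J ∈ 𝒥, {ω | 4 * (J.biUnion fun v => (ω.1 v).1).card < K * J.card}) := by
        refine measureReal_mono ?_ (measure_ne_top _ _)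
        intro ω hω
        simp only [Set.mem_ofPred_eq, Expanding, not_forall, not_le] at hω
        obtain ⟨J, -, hJ, h⟩ := hω
        simp only [Set.mem_iUnion]
        refine ⟨J, Finset.mem_filter.mpr ⟨Finset.mem_univ _, ?_, hJ⟩, h⟩
        rw [Finset.nonempty_iff_ne_empty]
        rintro rfl
        simp at h
    _ ≤ ∑ J ∈ 𝒥, ((K * J.card / P : ℝ) / 2 ^ K) ^ J.card :=
        (measureReal_biUnion_finset_le _ _).trans (Finset.sum_le_sum fun J hJ =>
          sampleLaw_real_not_expand_le hK (Finset.mem_filter.mp hJ).2.2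
            (Finset.mem_filter.mp hJ).2.1)
    _ ≤ ∑ J ∈ (Finset.univ : Finset (Finset V)).filter fun J => J.Nonempty,
          ((K * J.card / P : ℝ) / 2 ^ K) ^ J.card := by
        refine Finset.sum_le_sum_of_subset_of_nonneg ?_ fun _ _ _ => by positivity
        intro J hJ
        simp only [h𝒥, Finset.mem_filter] at hJ ⊢
        exact ⟨hJ.1, hJ.2.1⟩
    _ = ∑ j ∈ Finset.Icc 1 n, (n.choose j : ℝ) * ((K * j / P : ℝ) / 2 ^ K) ^ j := by
        rw [← Finset.sum_fiberwise_of_maps_to (t := Finset.Icc 1 n) (g := Finset.card)]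
        · refine Finset.sum_congr rfl fun j hj => ?_
          rw [Finset.sum_congr rfl (g := fun _ => ((K * j / P : ℝ) / 2 ^ K) ^ j),
            Finset.sum_const, nsmul_eq_mul]
          · congr 2
            rw [show n = (Finset.univ : Finset V).card from rfl, ← Finset.card_powersetCard]
            congr 1
            ext J
            simp only [Finset.mem_filter, Finset.mem_univ, true_and, Finset.mem_powersetCard,
              Finset.subset_univ, and_iff_right_iff_imp]
            rintro rfl
            exact Finset.card_pos.mp (Finset.mem_Icc.mp hj).1
          · intro J hJ
            rw [(Finset.mem_filter.mp hJ).2]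
        · intro J hJ
          exact Finset.mem_Icc.mpr ⟨Finset.card_pos.mpr (Finset.mem_filter.mp hJ).2,
            Finset.card_le_univ J⟩
    _ ≤ ∑ j ∈ Finset.Icc 1 n, ρ₀ ^ j := by
        refine Finset.sum_le_sum fun j _ => ?_
        have h1 : (n.choose j : ℝ) ≤ (n : ℝ) ^ j / j.factorial := Nat.choose_le_pow_div j n
        have h2 : (j : ℝ) ^ j / j.factorial ≤ Real.exp 1 ^ j := by
          rw [← Real.exp_nat_mul, mul_one]
          exact Real.pow_div_factorial_le_exp _ (by positivity) j
        calc _ ≤ (n : ℝ) ^ j / j.factorial * ((K * j / P : ℝ) / 2 ^ K) ^ j := by gcongr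
          _ = (n * K / P / 2 ^ K) ^ j * ((j : ℝ) ^ j / j.factorial) := by
              rw [div_pow, div_pow, div_pow, div_pow, mul_pow, mul_pow]; ring
          _ ≤ (n * K / P / 2 ^ K) ^ j * Real.exp 1 ^ j := by gcongr
          _ = ρ₀ ^ j := by rw [← mul_pow, hρ₀]; congr 1; ring
    _ ≤ ρ₀ / (1 - ρ₀) := by
        have h1 : ∑ j ∈ Finset.Icc 1 n, ρ₀ ^ j = ρ₀ * ∑ j ∈ Finset.range n, ρ₀ ^ j := by
          rw [Finset.mul_sum, Finset.range_eq_Ico]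
          simp only [← pow_succ']
          rw [Finset.sum_Ico_add' (fun j => ρ₀ ^ j) 0 n 1]
          rfl
        rw [h1, div_eq_mul_inv, ← tsum_geometric_of_lt_one hρ0 (by linarith)]
        gcongr
        exact (summable_geometric_of_lt_one hρ0 (by linarith)).sum_le_tsum _
          fun _ _ => by positivity
    _ ≤ _ := by
        rw [div_le_iff₀ (by linarith)]
        nlinarith

end Events

/-! ### Vertex separators -/

section Graph

variable {V : Type*} [Fintype V]

open Classical in
/-- Otherwise deleting the neighbours of `v` would isolate `v`. -/
lemma le_card_neighbors_of_isKConnected {G : SimpleGraph V} {k : ℕ} (hG : G.IsKConnected k)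
    (v : V) : k ≤ (Finset.univ.filter fun w => G.Adj v w).card := by
  by_contra! h
  set S := Finset.univ.filter fun w => G.Adj v w with hS
  have hv : v ∉ S := by simp [hS]
  obtain ⟨w, hw⟩ : ∃ w, w ∉ insert v S := by
    by_contra! h'
    have h1 : Fintype.card V ≤ (insert v S).card := by
      rw [← Finset.card_univ]; exact Finset.card_le_card fun x _ => h' x
    have h2 := Finset.card_insert_le v S
    have h3 := hG.1
    omega
  rw [Finset.mem_insert, not_or] at hw
  obtain ⟨W⟩ := (hG.2 S h).preconnected ⟨v, hv⟩ ⟨w, hw.2⟩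
  cases W with
  | nil => exact hw.1 rfl
  | @cons _ x _ hx _ =>
    refine x.2 ?_
    have hx' : G.Adj v x.1 := hx
    simpa [hS] using hx'

open Classical in
/-- If no vertex has fewer than `k` neighbours, failure of `k`-connectivity is witnessed by a
connected set of between `2` and `|V| / 2` vertices with fewer than `k` outer neighbours. -/
lemma exists_connected_of_not_isKConnected {G : SimpleGraph V} {k : ℕ} (hk : k < Fintype.card V)
    (hdeg : ∀ v, k ≤ (Finset.univ.filter fun w => G.Adj v w).card) (hG : ¬ G.IsKConnected k) :
    ∃ T : Finset V, 2 ≤ T.card ∧ 2 * T.card ≤ Fintype.card V ∧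
      (G.induce (T : Set V)).Connected ∧
      (Finset.univ.filter fun u => u ∉ T ∧ ∃ v ∈ T, G.Adj u v).card < k := by
  simp only [SimpleGraph.IsKConnected, not_and, not_forall] at hG
  obtain ⟨S, hS, hc⟩ := hG hk
  set H := G.induce {v : V | v ∉ S} with hH
  have hne : Nonempty {v : V | v ∉ S} := by
    by_contra h
    rw [not_nonempty_iff, isEmpty_subtype] at h
    have : Fintype.card V ≤ S.card := by
      rw [← Finset.card_univ]
      exact Finset.card_le_card fun x _ => by simpa using h x
    omega
  have hpre : ¬ H.Preconnected := fun h => hc ⟨h⟩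
  simp only [SimpleGraph.Preconnected, not_forall] at hpre
  obtain ⟨x, y, hxy⟩ := hpre
  -- One of two distinct components of the graph without `S` has at most half of the vertices.
  set comp : {v : V | v ∉ S} → Finset V := fun x =>
    (Finset.univ.filter fun z : {v : V | v ∉ S} => H.Reachable x z).map
      ⟨Subtype.val, Subtype.val_injective⟩
    with hcomp
  have mem_comp : ∀ (x : {v : V | v ∉ S}) (v : V), v ∈ comp x ↔ ∃ h : v ∉ S, H.Reachable x ⟨v, h⟩ := by
    intro x v
    simp [hcomp]
  have hdisj : Disjoint (comp x) (comp y) := by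
    rw [Finset.disjoint_left]
    intro v hv hv'
    obtain ⟨h1, h2⟩ := (mem_comp _ _).mp hv
    obtain ⟨h3, h4⟩ := (mem_comp _ _).mp hv'
    exact hxy (h2.trans h4.symm)
  obtain ⟨z, hz⟩ : ∃ z, 2 * (comp z).card ≤ Fintype.card V := by
    have h1 := Finset.card_union_of_disjoint hdisj
    have h2 := Finset.card_le_univ (comp x ∪ comp y)
    rcases le_total (comp x).card (comp y).card with h | h
    · exact ⟨x, by omega⟩
    · exact ⟨y, by omega⟩
  have hN : (Finset.univ.filter fun u => u ∉ comp z ∧ ∃ v ∈ comp z, G.Adj u v).card < k := by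
    refine (Finset.card_le_card ?_).trans_lt hS
    intro u hu
    simp only [Finset.mem_filter, Finset.mem_univ, true_and] at hu
    obtain ⟨hu, v, hv, huv⟩ := hu
    by_contra huS
    obtain ⟨h1, h2⟩ := (mem_comp _ _).mp hv
    refine hu ((mem_comp _ _).mpr ⟨huS, h2.trans (SimpleGraph.Adj.reachable ?_)⟩)
    exact huv.symm
  have hzmem : z.1 ∈ comp z := (mem_comp _ _).mpr ⟨z.2, SimpleGraph.Reachable.refl _⟩
  refine ⟨comp z, ?_, hz, ?_, hN⟩
  -- A component with a single vertex would give a vertex of degree less than `k`.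
  · by_contra! h
    have h1 : (comp z).card = 1 := by
      have := Finset.card_pos.mpr ⟨_, hzmem⟩
      omega
    obtain ⟨a, ha⟩ := Finset.card_eq_one.mp h1
    refine absurd (hdeg a) (not_le.mpr (lt_of_le_of_lt (Finset.card_le_card ?_) hN))
    intro w hw
    simp only [Finset.mem_filter, Finset.mem_univ, true_and] at hw ⊢
    rw [ha]
    exact ⟨by simpa using hw.ne', a, by simp, hw.symm⟩
  · have hCc := (H.connectedComponentMk z).connected_toSimpleGraph
    let φ : (H.connectedComponentMk z).toSimpleGraph →g G.induce (comp z : Set V) :=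
      { toFun := fun v => ⟨v.1.1, (mem_comp _ _).mpr ⟨v.1.2, (SimpleGraph.ConnectedComponent.exact v.2).symm⟩⟩
        map_rel' := fun h => h }
    refine hCc.map φ ?_
    rintro ⟨v, hv⟩
    obtain ⟨h1, h2⟩ := (mem_comp _ _).mp hv
    exact ⟨⟨⟨v, h1⟩, SimpleGraph.ConnectedComponent.sound h2.symm⟩, rfl⟩

end Graph

/-! ### The method of moments for the probability of zero -/

/-- The Bonferroni inequalities, in the form of a pointwise bound. -/
lemma abs_ite_sub_sum_choose_le (X J : ℕ) (hJ : 1 ≤ J) :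
    |(if X = 0 then (1 : ℝ) else 0) - ∑ j ∈ Finset.range J, (-1) ^ j * (X.choose j : ℝ)| ≤
      X.choose J := by
  obtain ⟨J, rfl⟩ := Nat.exists_eq_add_of_le' hJ
  rcases Nat.eq_zero_or_pos X with rfl | hX
  · rw [Finset.sum_eq_single 0] <;> simp +contextual [Nat.choose_eq_zero_of_lt, Nat.pos_iff_ne_zero]
  · obtain ⟨X, rfl⟩ := Nat.exists_eq_add_of_le' hX
    have h := Int.alternating_sum_range_choose_eq_choose (n := X) (m := J)
    have h' : ∑ j ∈ Finset.range (J + 1), (-1 : ℝ) ^ j * ((X + 1).choose j : ℝ) =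
        (-1) ^ J * X.choose J := by exact_mod_cast h
    rw [h', if_neg (by omega), zero_sub, abs_neg, abs_mul, abs_pow, abs_neg, abs_one, one_pow,
      one_mul, Nat.abs_cast]
    rw [Nat.choose_succ_succ]
    exact_mod_cast Nat.le_add_right _ _

/-- Convergence of all binomial moments to those of a Poisson law gives convergence of the
probability of zero. -/
lemma tendsto_exp_neg_of_bonferroni {ι : Type*} {l : Filter ι} {a : ι → ℝ} {M : ℕ → ι → ℝ} {c : ℝ}
    (ha : ∀ᶠ n in l, ∀ J, 1 ≤ J → |a n - ∑ j ∈ Finset.range J, (-1) ^ j * M j n| ≤ M J n)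
    (hM : ∀ j, Tendsto (M j) l (𝓝 (c ^ j / j.factorial))) :
    Tendsto a l (𝓝 (Real.exp (-c))) := by
  have hexp : Tendsto (fun J => ∑ j ∈ Finset.range J, (-1) ^ j * (c ^ j / j.factorial)) atTop
      (𝓝 (Real.exp (-c))) := by
    have h := (NormedSpace.expSeries_div_hasSum_exp (-c)).tendsto_sum_nat
    rw [← Real.exp_eq_exp_ℝ] at h
    refine h.congr fun J => Finset.sum_congr rfl fun j _ => ?_
    rw [neg_pow]; ring
  have hzero : Tendsto (fun J : ℕ => c ^ J / (J.factorial : ℝ)) atTop (𝓝 0) :=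
    FloorSemiring.tendsto_pow_div_factorial_atTop c
  rw [Metric.tendsto_nhds]
  intro ε hε
  obtain ⟨J, hJ1, hJ2, hJ3⟩ := ((eventually_ge_atTop 1).and
    (((Metric.tendsto_nhds.mp hexp) (ε / 3) (by positivity)).and
      (hzero.eventually_lt_const (show (0 : ℝ) < ε / 3 by positivity)))).exists
  have hsum : Tendsto (fun n => ∑ j ∈ Finset.range J, (-1) ^ j * M j n) l
      (𝓝 (∑ j ∈ Finset.range J, (-1) ^ j * (c ^ j / j.factorial))) :=
    tendsto_finsetSum _ fun j _ => (hM j).const_mul _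
  filter_upwards [ha, (Metric.tendsto_nhds.mp hsum) (ε / 3) (by positivity),
    (hM J).eventually_lt_const hJ3] with n h1 h2 h3
  have h4 := h1 J hJ1
  rw [Real.dist_eq] at *
  rw [abs_lt] at *
  rw [abs_le] at h4
  constructor <;> linarith [h4.1, h4.2, h2.1, h2.2, hJ2.1, hJ2.2]

/-! ### Connected sets with few outer neighbours -/

section Isolated

variable {V : Type*} [Fintype V] [DecidableEq V] {K P : ℕ} {p : unitInterval}
  [Nonempty (KeyRing K P)]

open Classical in
/-- The vertices outside `T` with a neighbour in `T`. -/
noncomputable def outerNbrs (ω : Sample V K P) (T : Finset V) : Finset V :=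
  Finset.univ.filter fun u => u ∉ T ∧ (nbrsIn ω T u).Nonempty

lemma mem_outerNbrs {ω : Sample V K P} {T : Finset V} {u : V} :
    u ∈ outerNbrs ω T ↔ u ∉ T ∧ (nbrsIn ω T u).Nonempty := by
  simp [outerNbrs]

/-- The event that the vertices of `T` span a connected graph. -/
def connectedOn (T : Finset V) : Set (Sample V K P) :=
  {ω | ((sampleGraph ω).induce (T : Set V)).Connected}

lemma dependsOnlyOn_connectedOn (T : Finset V) :
    DependsOnlyOn (fun ω : Sample V K P => ω ∈ connectedOn T) T := by
  intro u hu ω ω'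
  have : (sampleGraph (resample u ω ω')).induce (T : Set V) =
      (sampleGraph ω).induce (T : Set V) := by
    ext v w
    simp only [SimpleGraph.comap_adj, Function.Embedding.subtype_apply]
    exact resample_adj (ne_of_mem_of_not_mem v.2 hu) (ne_of_mem_of_not_mem w.2 hu) _ _
  simp only [connectedOn, Set.mem_ofPred_eq, this]

lemma DependsOnlyOn.inter {D E : Set (Sample V K P)} {T : Finset V}
    (hD : DependsOnlyOn (fun ω => ω ∈ D) T) (hE : DependsOnlyOn (fun ω => ω ∈ E) T) :
    DependsOnlyOn (fun ω => ω ∈ D ∩ E) T := by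
  intro u hu ω ω'
  simp only [Set.mem_inter_iff]
  have h1 := hD u hu ω ω'
  have h2 := hE u hu ω ω'
  simp only at h1 h2
  rw [h1, h2]

/-- A sum over the sets of at most `k` vertices; all terms are compared with that for `k`, because
`n * y ≥ 1`. -/
lemma sum_pow_card_le (S : Finset V) (k : ℕ) {y : ℝ} (hy : 0 ≤ y)
    (hy1 : 1 ≤ Fintype.card V * y) :
    ∑ U ∈ S.powerset.filter (fun U => U.card ≤ k), y ^ U.card ≤
      (k + 1) * (Fintype.card V * y) ^ k := by
  set n := Fintype.card V
  rw [← Finset.sum_fiberwise_of_maps_to (t := Finset.range (k + 1)) (g := Finset.card)]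
  · calc _ ≤ ∑ j ∈ Finset.range (k + 1), (n * y) ^ k := by
          refine Finset.sum_le_sum fun j hj => ?_
          calc _ ≤ ∑ U ∈ S.powersetCard j, y ^ j := by
                rw [Finset.sum_congr rfl (g := fun _ => y ^ j)]
                · refine Finset.sum_le_sum_of_subset_of_nonneg ?_ fun _ _ _ => by positivity
                  intro U hU
                  simp only [Finset.mem_filter, Finset.mem_powerset] at hU
                  exact Finset.mem_powersetCard.mpr ⟨hU.1.1, hU.2⟩
                · intro U hU
                  rw [(Finset.mem_filter.mp hU).2]
            _ = (S.card.choose j : ℝ) * y ^ j := by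
                rw [Finset.sum_const, Finset.card_powersetCard, nsmul_eq_mul]
            _ ≤ (n : ℝ) ^ j * y ^ j := by
                gcongr
                have h1 : S.card.choose j ≤ S.card ^ j := Nat.choose_le_pow _ _
                have h2 : S.card ^ j ≤ n ^ j := Nat.pow_le_pow_left (Finset.card_le_univ S) j
                exact_mod_cast h1.trans h2
            _ = (n * y) ^ j := by rw [mul_pow]
            _ ≤ _ := pow_le_pow_right₀ hy1 (by have := Finset.mem_range.mp hj; omega)
      _ = _ := by simp
  · intro U hU
    have := (Finset.mem_filter.mp hU).2
    exact Finset.mem_range.mpr (by omega)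

/-- If every outside vertex misses `T` with conditional probability at most `F`, then it is
unlikely that `T` has few outer neighbours. -/
lemma sampleLaw_real_outerNbrs_le (k : ℕ) {T : Finset V} {D : Set (Sample V K P)}
    (hD : DependsOnlyOn (fun ω => ω ∈ D) T) {F : ℝ} (hF0 : 0 ≤ F) (hF1 : F ≤ 1)
    (hF : ∀ ω ∈ D, ∀ u ∉ T, typeProb p ω T u {∅} ≤ F)
    (hq : 1 ≤ Fintype.card V * (T.card * edgeProb K P p)) :
    (sampleLaw V K P p).real (D ∩ {ω | (outerNbrs ω T).card ≤ k}) ≤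
      (sampleLaw V K P p).real D * ((k + 1) * (Fintype.card V * (T.card * edgeProb K P p)) ^ k *
        F ^ (Fintype.card V - T.card - k)) := by
  classical
  set n := Fintype.card V
  set y := T.card * edgeProb K P p with hy
  have hy0 : 0 ≤ y := mul_nonneg (by positivity) edgeProb_nonneg
  have key : ∀ U ∈ Tᶜ.powerset.filter (fun U => U.card ≤ k),
      (sampleLaw V K P p).real (D ∩ {ω | outerNbrs ω T = U}) ≤
        (sampleLaw V K P p).real D * (y ^ U.card * F ^ (n - T.card - k)) := by
    intro U hU
    simp only [Finset.mem_filter, Finset.mem_powerset] at hU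
    have h := sampleLaw_real_inter_nbrsIn_le (p := p) (Y := Tᶜ) disjoint_compl_left hD
      (𝒜 := fun u => if u ∈ U then {A | A.Nonempty} else {∅})
      (B := fun u => if u ∈ U then y else F) (by
        intro ω hω u hu
        rw [Finset.mem_compl] at hu
        split_ifs
        · exact typeProb_nonempty_le ω hu
        · exact hF ω hω u hu)
    refine le_trans (measureReal_mono ?_ (measure_ne_top _ _)) (h.trans ?_)
    · rintro ω ⟨hω, hωU⟩
      refine ⟨hω, fun u hu => ?_⟩
      rw [Finset.mem_compl] at hu
      simp only [Set.mem_ofPred_eq] at hωU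
      have hmem := mem_outerNbrs (ω := ω) (T := T) (u := u)
      rw [hωU] at hmem
      split_ifs with huU
      · exact (hmem.mp huU).2
      · rw [Set.mem_singleton_iff, ← Finset.not_nonempty_iff_eq_empty]
        exact fun h => huU (hmem.mpr ⟨hu, h⟩)
    · refine mul_le_mul_of_nonneg_left ?_ measureReal_nonneg
      rw [Finset.prod_ite, Finset.prod_const, Finset.prod_const,
        Finset.filter_mem_eq_inter, Finset.inter_eq_right.mpr hU.1]
      refine mul_le_mul_of_nonneg_left (pow_le_pow_of_le_one hF0 hF1 ?_) (by positivity)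
      rw [Finset.filter_not, Finset.filter_mem_eq_inter, Finset.inter_eq_right.mpr hU.1,
        Finset.card_sdiff_of_subset hU.1, Finset.card_compl]
      omega
  calc _ ≤ (sampleLaw V K P p).real
        (⋃ U ∈ Tᶜ.powerset.filter (fun U => U.card ≤ k), D ∩ {ω | outerNbrs ω T = U}) := by
        refine measureReal_mono ?_ (measure_ne_top _ _)
        rintro ω ⟨hω, hk⟩
        simp only [Set.mem_iUnion]
        refine ⟨outerNbrs ω T, ?_, hω, rfl⟩
        simp only [Finset.mem_filter, Finset.mem_powerset]
        refine ⟨fun u hu => ?_, hk⟩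
        rw [Finset.mem_compl]
        exact (mem_outerNbrs.mp hu).1
    _ ≤ ∑ U ∈ Tᶜ.powerset.filter (fun U => U.card ≤ k),
          (sampleLaw V K P p).real D * (y ^ U.card * F ^ (n - T.card - k)) :=
        (measureReal_biUnion_finset_le _ _).trans (Finset.sum_le_sum key)
    _ = (sampleLaw V K P p).real D * ((∑ U ∈ Tᶜ.powerset.filter (fun U => U.card ≤ k),
          y ^ U.card) * F ^ (n - T.card - k)) := by rw [← Finset.mul_sum, ← Finset.sum_mul]
    _ ≤ _ := by
        gcongr
        exact sum_pow_card_le _ k hy0 hq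

/-- The event that some connected set of `r` vertices satisfying `Q` has at most `k` outer
neighbours. -/
def hasIsolated (k r : ℕ) (Q : Finset V → Set (Sample V K P)) : Set (Sample V K P) :=
  {ω | ∃ T : Finset V, T.card = r ∧ ω ∈ connectedOn T ∧ ω ∈ Q T ∧ (outerNbrs ω T).card ≤ k}

/-- The union bound over the sets `T` of size `r`, with a bound `c` for the probability that `T` is
connected left open. -/
lemma sampleLaw_real_hasIsolated_le_sum (k : ℕ) {r : ℕ} {Q : Finset V → Set (Sample V K P)}
    (hQ : ∀ T, DependsOnlyOn (fun ω => ω ∈ Q T) T) {F : ℝ} (hF0 : 0 ≤ F) (hF1 : F ≤ 1)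
    (hF : ∀ T : Finset V, T.card = r → ∀ ω ∈ Q T, ∀ u ∉ T, typeProb p ω T u {∅} ≤ F)
    (hr : 1 ≤ r) (hq : 1 ≤ Fintype.card V * edgeProb K P p) {c : ℝ}
    (hc : ∀ T : Finset V, T.card = r → (sampleLaw V K P p).real (connectedOn T) ≤ c) :
    (sampleLaw V K P p).real (hasIsolated k r Q) ≤
      (Fintype.card V).choose r * (c * ((k + 1) * (Fintype.card V * (r * edgeProb K P p)) ^ k *
        F ^ (Fintype.card V - r - k))) := by
  have hr1 : (1 : ℝ) ≤ r := by exact_mod_cast hr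
  have hq' : 1 ≤ Fintype.card V * (r * edgeProb K P p) := by
    rw [mul_left_comm]
    exact one_le_mul_of_one_le_of_one_le hr1 hq
  calc _ ≤ (sampleLaw V K P p).real (⋃ T ∈ Finset.powersetCard r (Finset.univ : Finset V),
        (connectedOn T ∩ Q T) ∩ {ω | (outerNbrs ω T).card ≤ k}) := by
        refine measureReal_mono ?_ (measure_ne_top _ _)
        rintro ω ⟨T, h1, h2, h3, h4⟩
        simp only [Set.mem_iUnion]
        exact ⟨T, by simp [h1], ⟨h2, h3⟩, h4⟩
    _ ≤ ∑ T ∈ Finset.powersetCard r (Finset.univ : Finset V), (sampleLaw V K P p).real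
          ((connectedOn T ∩ Q T) ∩ {ω | (outerNbrs ω T).card ≤ k}) :=
        measureReal_biUnion_finset_le _ _
    _ ≤ ∑ T ∈ Finset.powersetCard r (Finset.univ : Finset V),
          (c * ((k + 1) * (Fintype.card V * (r * edgeProb K P p)) ^ k *
        F ^ (Fintype.card V - r - k))) := by
        refine Finset.sum_le_sum fun T hT => ?_
        have hTr := (Finset.mem_powersetCard.mp hT).2
        have := sampleLaw_real_outerNbrs_le (p := p) k
          ((dependsOnlyOn_connectedOn T).inter (hQ T)) hF0 hF1
          (fun ω hω u hu => hF T hTr ω hω.2 u hu) (by rwa [hTr])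
        rw [hTr] at this
        refine this.trans (mul_le_mul_of_nonneg_right ?_ (by positivity))
        exact (measureReal_mono Set.inter_subset_left (measure_ne_top _ _)).trans (hc T hTr)
    _ = _ := by
        rw [Finset.sum_const, Finset.card_powersetCard, nsmul_eq_mul]
        rfl

/-- `sampleLaw_real_hasIsolated_le_sum` with the tree bound for `c`. -/
lemma sampleLaw_real_hasIsolated_le (k : ℕ) {r : ℕ} {Q : Finset V → Set (Sample V K P)}
    (hQ : ∀ T, DependsOnlyOn (fun ω => ω ∈ Q T) T) {F : ℝ} (hF0 : 0 ≤ F) (hF1 : F ≤ 1)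
    (hF : ∀ T : Finset V, T.card = r → ∀ ω ∈ Q T, ∀ u ∉ T, typeProb p ω T u {∅} ≤ F)
    (hr : 1 ≤ r) (hq : 1 ≤ Fintype.card V * edgeProb K P p) :
    (sampleLaw V K P p).real (hasIsolated k r Q) ≤
      Fintype.card V * Real.exp 1 ^ r * (Fintype.card V * edgeProb K P p) ^ (r - 1) *
        ((k + 1) * (Fintype.card V * (r * edgeProb K P p)) ^ k *
        F ^ (Fintype.card V - r - k)) := by
  set n := Fintype.card V
  set q := edgeProb K P p
  have hq0 : 0 ≤ q := edgeProb_nonneg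
  refine (sampleLaw_real_hasIsolated_le_sum k hQ hF0 hF1 hF hr hq (c := (r * q) ^ (r - 1)) ?_).trans
    ?_
  · intro T hT
    have := sampleLaw_real_connected_le (K := K) (P := P) (p := p) (T := T)
      (Finset.card_pos.mp (by omega))
    rwa [hT] at this
  · rw [← mul_assoc]
    refine mul_le_mul_of_nonneg_right ?_ (by positivity)
    have h1 : (n.choose r : ℝ) ≤ (n : ℝ) ^ r / r.factorial := Nat.choose_le_pow_div r n
    have h2 : (r : ℝ) ^ (r - 1) / r.factorial ≤ Real.exp 1 ^ r := by
      rw [← Real.exp_nat_mul, mul_one]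
      refine le_trans ?_ (Real.pow_div_factorial_le_exp (r : ℝ) (by positivity) r)
      gcongr
      · exact_mod_cast hr
      · omega
    calc (n.choose r : ℝ) * (r * q) ^ (r - 1)
        ≤ (n : ℝ) ^ r / r.factorial * (r * q) ^ (r - 1) := by gcongr
      _ = n * ((r : ℝ) ^ (r - 1) / r.factorial) * (n * q) ^ (r - 1) := by
          obtain ⟨t, rfl⟩ := Nat.exists_eq_add_of_le' hr
          rw [Nat.add_sub_cancel, mul_pow, mul_pow, pow_succ]; ring
      _ ≤ _ := by gcongr

/-- `sampleLaw_real_hasIsolated_le_sum` with the trivial bound `c = 1`. -/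
lemma sampleLaw_real_hasIsolated_le' (k : ℕ) {r : ℕ} {Q : Finset V → Set (Sample V K P)}
    (hQ : ∀ T, DependsOnlyOn (fun ω => ω ∈ Q T) T) {F : ℝ} (hF0 : 0 ≤ F) (hF1 : F ≤ 1)
    (hF : ∀ T : Finset V, T.card = r → ∀ ω ∈ Q T, ∀ u ∉ T, typeProb p ω T u {∅} ≤ F)
    (hr : 1 ≤ r) (hq : 1 ≤ Fintype.card V * edgeProb K P p) :
    (sampleLaw V K P p).real (hasIsolated k r Q) ≤
      2 ^ Fintype.card V * ((k + 1) * (Fintype.card V * (r * edgeProb K P p)) ^ k *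
        F ^ (Fintype.card V - r - k)) := by
  have hq0 : 0 ≤ edgeProb K P p := edgeProb_nonneg
  refine (sampleLaw_real_hasIsolated_le_sum k hQ hF0 hF1 hF hr hq (c := 1)
    fun _ _ => measureReal_le_one).trans ?_
  rw [one_mul]
  refine mul_le_mul_of_nonneg_right ?_ (by positivity)
  exact_mod_cast Nat.choose_le_two_pow _ _

/-- In an expanding configuration, a vertex outside `T` is joined to `T` with conditional
probability at least of the order of `min 1 (|T| q)`. -/
lemma typeProb_empty_le_of_expanding (hK : 1 ≤ K) {ω : Sample V K P} {T : Finset V}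
    (hω : Expanding T ω) {u : V} (hu : u ∉ T) :
    typeProb p ω T u {∅} ≤ 1 - (1 - Real.exp (-(K / 8 : ℝ))) *
      (1 - Real.exp (-(T.card * edgeProb K P p / 8))) := by
  have hKP : K ≤ P := keyRing_le
  have hP : 0 < P := by omega
  have hs := meetProb_le (K := K) (P := P)
  have hs0 := meetProb_nonneg (K := K) (P := P)
  have hs1 := meetProb_le_one (K := K) (P := P)
  have hp0 := p.2.1
  have hp1 := p.2.2
  set a : ℝ := K ^ 2 / P / 4 with ha
  have hlow : ∀ J ⊆ T, min (a * J.card) (K / 8 : ℝ) ≤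
      K * (J.biUnion fun v => (ω.1 v).1).card / P := by
    intro J hJ
    by_cases hJP : K * J.card ≤ P
    · refine (min_le_left _ _).trans ?_
      have h1 : (K * J.card : ℝ) ≤ 4 * (J.biUnion fun v => (ω.1 v).1).card := by
        exact_mod_cast hω J hJ hJP
      rw [ha, div_div, div_mul_eq_mul_div, div_le_div_iff₀ (by positivity) (by positivity)]
      have h2 : (K : ℝ) * P * (K * J.card) ≤ K * P * (4 * (J.biUnion fun v => (ω.1 v).1).card) := by
        gcongr
      linarith
    -- A subset of `P / K` vertices of `J` already covers an eighth of the pool.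
    · refine (min_le_right _ _).trans ?_
      have hdiv : K * (P / K) ≤ P := Nat.mul_div_le P K
      have hdiv2 : P < K * (P / K) + K := by
        have := Nat.lt_mul_div_succ P (show 0 < K by omega)
        linarith [Nat.mul_succ K (P / K)]
      have hdiv3 : K ≤ K * (P / K) := by
        have : 1 ≤ P / K := (Nat.one_le_div_iff (by omega)).mpr hKP
        nlinarith
      obtain ⟨J', hJ', hJ'c⟩ := Finset.exists_subset_card_eq (s := J) (n := P / K) (by
        push Not at hJP
        have : P / K < J.card := (Nat.div_lt_iff_lt_mul (by omega)).mpr (by linarith)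
        omega)
      have h1 := hω J' (hJ'.trans hJ) (by rw [hJ'c]; exact hdiv)
      have h2 : (J'.biUnion fun v => (ω.1 v).1).card ≤ (J.biUnion fun v => (ω.1 v).1).card :=
        Finset.card_le_card (Finset.biUnion_subset_biUnion_of_subset_left _ hJ')
      rw [hJ'c] at h1
      have h3 : P ≤ 8 * (J.biUnion fun v => (ω.1 v).1).card := by omega
      have h4 : (P : ℝ) ≤ 8 * (J.biUnion fun v => (ω.1 v).1).card := by exact_mod_cast h3
      rw [div_le_div_iff₀ (by norm_num) (by positivity)]
      have : (K : ℝ) * P ≤ K * (8 * (J.biUnion fun v => (ω.1 v).1).card) := by gcongr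
      linarith
  refine (typeProb_empty_le_of_expansion ω hu (by positivity) (by positivity) hlow).trans ?_
  have hb : 0 ≤ 1 - Real.exp (-(K / 8 : ℝ)) := by
    rw [sub_nonneg, Real.exp_le_one_iff]
    have : (0 : ℝ) ≤ K / 8 := by positivity
    linarith
  refine sub_le_sub_left (mul_le_mul_of_nonneg_left (sub_le_sub_left ?_ _) hb) _
  have h1 : meetProb K P / 8 ≤ 1 - Real.exp (-a) := by
    have h2 : meetProb K P / 4 ≤ a := by rw [ha]; linarith
    have h3 : Real.exp (-a) ≤ Real.exp (-(meetProb K P / 4)) := Real.exp_le_exp.mpr (by linarith)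
    have h4 := Real.add_one_le_exp (meetProb K P / 4)
    have h5 : Real.exp (-(meetProb K P / 4)) * Real.exp (meetProb K P / 4) = 1 := by
      rw [← Real.exp_add]; simp
    have h6 := Real.exp_pos (-(meetProb K P / 4))
    nlinarith
  have h7 : 0 ≤ 1 - p * (1 - Real.exp (-a)) := by
    have := Real.exp_pos (-a)
    nlinarith
  have h8 : 1 - p * (1 - Real.exp (-a)) ≤ Real.exp (-(edgeProb K P p / 8)) := by
    have := Real.add_one_le_exp (-(edgeProb K P p / 8))
    have h9 : (p : ℝ) * (meetProb K P / 8) ≤ p * (1 - Real.exp (-a)) := by gcongr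
    rw [edgeProb] at *
    linarith
  calc _ ≤ Real.exp (-(edgeProb K P p / 8)) ^ T.card := by gcongr
    _ = _ := by rw [← Real.exp_nat_mul]; congr 1; ring

end Isolated

/-! ### Minimum degree `k` almost implies `k`-connectivity -/

section Separators

variable {V : Type*} [Fintype V] [DecidableEq V] {K P : ℕ} {p : unitInterval}
  [Nonempty (KeyRing K P)]

open Classical in
/-- The event that every vertex has at least `k` neighbours. -/
def minDegreeGE (V : Type*) [Fintype V] (K P k : ℕ) : Set (Sample V K P) :=
  {ω | ∀ v, k ≤ (Finset.univ.filter fun w => (sampleGraph ω).Adj v w).card}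

/-- The witnesses for failure of `k`-connectivity are split by size: sets of fewer than `R` vertices are
constrained by `Q`, larger ones by expansion. -/
lemma sampleLaw_real_not_isKConnected_le {k R : ℕ} (hk : k < Fintype.card V)
    (Q : Finset V → Set (Sample V K P)) :
    (sampleLaw V K P p).real
        (minDegreeGE V K P k ∩ {ω | ¬ (sampleGraph ω).IsKConnected k}) ≤
      (sampleLaw V K P p).real {ω | ¬ Expanding (Finset.univ : Finset V) ω} +
      (sampleLaw V K P p).real {ω | ∃ T, ω ∉ Q T} +
      ∑ r ∈ Finset.Ico 2 R, (sampleLaw V K P p).real (hasIsolated k r Q) +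
      ∑ r ∈ (Finset.range (Fintype.card V)).filter (fun r => R ≤ r ∧ 2 * r ≤ Fintype.card V),
        (sampleLaw V K P p).real (hasIsolated k r fun T => {ω | Expanding T ω}) := by
  classical
  have hsub : minDegreeGE V K P k ∩ {ω | ¬ (sampleGraph ω).IsKConnected k} ⊆
      (({ω | ¬ Expanding (Finset.univ : Finset V) ω} ∪ {ω | ∃ T, ω ∉ Q T}) ∪
      ⋃ r ∈ Finset.Ico 2 R, hasIsolated k r Q) ∪
      ⋃ r ∈ (Finset.range (Fintype.card V)).filter (fun r => R ≤ r ∧ 2 * r ≤ Fintype.card V),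
        hasIsolated k r fun T => {ω | Expanding T ω} := by
    rintro ω ⟨hdeg, hcon⟩
    by_cases hE : Expanding (Finset.univ : Finset V) ω
    swap
    · exact .inl (.inl (.inl hE))
    by_cases hQ : ∃ T, ω ∉ Q T
    · exact .inl (.inl (.inr hQ))
    push Not at hQ
    obtain ⟨T, hT2, hTn, hTc, hTN⟩ := exists_connected_of_not_isKConnected hk hdeg hcon
    have hN : (outerNbrs ω T).card ≤ k := by
      refine le_trans (le_of_eq ?_) hTN.le
      congr 1
      ext u
      simp [mem_outerNbrs, nbrsIn, Finset.Nonempty]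
    by_cases hR : T.card < R
    · refine .inl (.inr ?_)
      simp only [Set.mem_iUnion]
      exact ⟨T.card, Finset.mem_Ico.mpr ⟨hT2, hR⟩, T, rfl, hTc, hQ T, hN⟩
    · refine .inr ?_
      simp only [Set.mem_iUnion]
      refine ⟨T.card, ?_, T, rfl, hTc, fun J _ => hE J (Finset.subset_univ _), hN⟩
      simp only [Finset.mem_filter, Finset.mem_range]
      omega
  refine (measureReal_mono hsub (measure_ne_top _ _)).trans ?_
  refine (measureReal_union_le _ _).trans (add_le_add ?_ (measureReal_biUnion_finset_le _ _))
  refine (measureReal_union_le _ _).trans (add_le_add ?_ (measureReal_biUnion_finset_le _ _))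
  exact measureReal_union_le _ _

lemma one_sub_exp_neg_ge {y Y : ℝ} (hy : 0 ≤ y) (hY : y ≤ Y) :
    y / (1 + Y) ≤ 1 - Real.exp (-y) := by
  have h1 := Real.add_one_le_exp y
  have h2 : Real.exp (-y) * Real.exp y = 1 := by rw [← Real.exp_add]; simp
  have h3 := Real.exp_pos (-y)
  have h4 : Real.exp (-y) ≤ 1 / (1 + y) := by
    rw [le_div_iff₀ (by linarith)]
    nlinarith
  calc y / (1 + Y) ≤ y / (1 + y) := by gcongr
    _ = 1 - 1 / (1 + y) := by field_simp; ring
    _ ≤ _ := by linarith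

lemma exp_neg_le_of_seven_le {y : ℝ} (hy : 7 ≤ y) : Real.exp (-y) ≤ 1 / 2 ^ 9 := by
  have h : (2.7 : ℝ) ^ 7 ≤ Real.exp y := by
    calc (2.7 : ℝ) ^ 7 ≤ Real.exp 1 ^ 7 := by
          gcongr; linarith [Real.exp_one_gt_d9]
      _ = Real.exp 7 := by rw [← Real.exp_nat_mul]; norm_num
      _ ≤ _ := Real.exp_le_exp.mpr hy
  rw [Real.exp_neg, inv_eq_one_div]
  apply one_div_le_one_div_of_le (by norm_num)
  refine le_trans ?_ h
  norm_num

/-- The bound for large connected sets: when `r q ≤ 56` the tree count is used, and otherwise the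
trivial count of all sets suffices, since then an outside vertex misses the set with probability at
most `2 ^ (-8)` and there are at least `n / 4` outside vertices that have to. -/
lemma sampleLaw_real_hasIsolated_expanding_le (k : ℕ) {r : ℕ} (hK : 56 ≤ K) (hr : 1 ≤ r)
    (hrn : 2 * r ≤ Fintype.card V) (hkn : 4 * k ≤ Fintype.card V)
    (hq : 1 ≤ Fintype.card V * edgeProb K P p) :
    (sampleLaw V K P p).real (hasIsolated k r fun T => {ω | Expanding T ω}) ≤
      Fintype.card V * ((k + 1) * (Fintype.card V * (Fintype.card V * edgeProb K P p)) ^ k) *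
        (Real.exp 1 * (Fintype.card V * edgeProb K P p) *
          Real.exp (-(Fintype.card V * edgeProb K P p / 512))) ^ r +
      (k + 1) * (Fintype.card V : ℝ) ^ (2 * k) / 2 ^ Fintype.card V := by
  set n := Fintype.card V with hn
  set q := edgeProb K P p with hqdef
  have hq0 : 0 ≤ q := edgeProb_nonneg
  have hq1 : q ≤ 1 := edgeProb_le_one
  have hn1 : (1 : ℝ) ≤ n := by exact_mod_cast (show 1 ≤ n by omega)
  have hQ : ∀ T : Finset V, DependsOnlyOn (fun ω : Sample V K P => ω ∈ {ω | Expanding T ω}) T :=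
    dependsOnlyOn_expanding
  have hb : Real.exp (-(K / 8 : ℝ)) ≤ 1 / 2 ^ 9 := by
    apply exp_neg_le_of_seven_le
    have : (56 : ℝ) ≤ K := by exact_mod_cast hK
    linarith
  have hb0 := Real.exp_pos (-(K / 8 : ℝ))
  have hm : n ≤ 4 * (n - r - k) := by omega
  have hrn' : (r : ℝ) ≤ n := by exact_mod_cast (show r ≤ n by omega)
  by_cases hM : r * q ≤ 56
  · have h := sampleLaw_real_hasIsolated_le (p := p) k hQ (r := r)
      (F := Real.exp (-(r * q / 128))) (Real.exp_pos _).le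
      (by rw [Real.exp_le_one_iff]; have : 0 ≤ r * q / 128 := by positivity
          linarith) (by
        intro T hT ω hω u hu
        refine (typeProb_empty_le_of_expanding (by omega) hω hu).trans ?_
        rw [hT]
        have h1 := one_sub_exp_neg_ge (y := r * q / 8) (Y := 7) (by positivity) (by linarith)
        have h2 := Real.add_one_le_exp (-(r * q / 128))
        have h3 : (1 / 2 : ℝ) ≤ 1 - Real.exp (-(K / 8 : ℝ)) := by
          have : (1 : ℝ) / 2 ^ 9 ≤ 1 / 2 := by norm_num
          linarith
        have h4 : (0 : ℝ) ≤ r * q / 8 / (1 + 7) := by positivity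
        have h5 : (1 / 2 : ℝ) * (r * q / 8 / (1 + 7)) ≤
            (1 - Real.exp (-(K / 8 : ℝ))) * (1 - Real.exp (-(r * q / 8))) := by gcongr
        linarith) hr hq
    refine h.trans (le_trans ?_ (le_add_of_nonneg_right (by positivity)))
    have hpow : Real.exp (-(r * q / 128)) ^ (n - r - k) ≤ Real.exp (-(n * q / 512)) ^ r := by
      rw [← Real.exp_nat_mul, ← Real.exp_nat_mul]
      apply Real.exp_le_exp.mpr
      have h6 : (n : ℝ) ≤ 4 * (n - r - k : ℕ) := by exact_mod_cast hm
      have h7 : (n : ℝ) * (r * q / 512) ≤ 4 * (n - r - k : ℕ) * (r * q / 512) := by gcongr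
      linarith
    have hx : (n * q) ^ (r - 1) ≤ (n * q) ^ r := pow_le_pow_right₀ hq (by omega)
    calc _ ≤ n * Real.exp 1 ^ r * (n * q) ^ r * ((k + 1) * (n * (n * q)) ^ k *
          Real.exp (-(n * q / 512)) ^ r) := by gcongr
      _ = _ := by rw [mul_pow, mul_pow]; ring
  · push Not at hM
    have h := sampleLaw_real_hasIsolated_le' (p := p) k hQ (r := r)
      (F := 1 / 2 ^ 8) (by norm_num) (by norm_num) (by
        intro T hT ω hω u hu
        refine (typeProb_empty_le_of_expanding (by omega) hω hu).trans ?_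
        rw [hT]
        have h1 := exp_neg_le_of_seven_le (y := r * q / 8) (by linarith)
        have h2 := Real.exp_pos (-(r * q / 8))
        have h3 : (1 : ℝ) / 2 ^ 8 = 1 / 2 ^ 9 + 1 / 2 ^ 9 := by norm_num
        rw [h3]
        nlinarith [mul_pos hb0 h2]) hr hq
    refine h.trans (le_trans ?_ (le_add_of_nonneg_left (by positivity)))
    have hpow : ((1 : ℝ) / 2 ^ 8) ^ (n - r - k) ≤ 1 / 2 ^ (2 * n) := by
      rw [div_pow, one_pow, ← pow_mul]
      apply one_div_le_one_div_of_le (by positivity)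
      exact pow_le_pow_right₀ (by norm_num) (by omega)
    have hnk : (n * (r * q)) ^ k ≤ (n : ℝ) ^ (2 * k) := by
      rw [pow_mul]
      gcongr
      rw [sq]
      have : r * q ≤ n * 1 := by gcongr
      rw [mul_one] at this
      gcongr
    calc _ ≤ 2 ^ n * ((k + 1) * (n : ℝ) ^ (2 * k) * (1 / 2 ^ (2 * n))) := by gcongr
      _ = _ := by rw [two_mul n, pow_add]; field_simp

/-- The bound for small connected sets, two vertices of which rarely have a common neighbour. -/
lemma sampleLaw_real_hasIsolated_pair_le (k : ℕ) {r : ℕ} {Q : Finset V → Set (Sample V K P)}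
    (hQ : ∀ T, DependsOnlyOn (fun ω => ω ∈ Q T) T)
    (hpair : ∀ T, ∀ ω ∈ Q T, ∀ u ∉ T, ∀ v ∈ T, ∀ w ∈ T, v ≠ w →
      typeProb p ω T u {A | v ∈ A ∧ w ∈ A} ≤ edgeProb K P p / 2) (hr : 2 ≤ r)
    (hq : 1 ≤ Fintype.card V * edgeProb K P p) :
    (sampleLaw V K P p).real (hasIsolated k r Q) ≤
      Real.exp 1 ^ r * (k + 1) * r ^ k * Real.exp (3 / 2 * (r + k)) *
      (Fintype.card V * Real.exp (-(Fintype.card V * edgeProb K P p))) *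
      ((Fintype.card V * edgeProb K P p) ^ (r - 1 + k) *
        Real.exp (-(Fintype.card V * edgeProb K P p / 2))) := by
  set n := Fintype.card V with hn
  set q := edgeProb K P p with hqdef
  have hq0 : 0 ≤ q := edgeProb_nonneg
  have hq1 : q ≤ 1 := edgeProb_le_one
  have h := sampleLaw_real_hasIsolated_le (p := p) k hQ (r := r)
    (F := Real.exp (-(3 / 2 * q))) (Real.exp_pos _).le
    (by rw [Real.exp_le_one_iff]; linarith) (by
      intro T hT ω hω u hu
      obtain ⟨v, hv, w, hw, hvw⟩ := Finset.one_lt_card.mp (show 1 < T.card by omega)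
      refine (typeProb_empty_le_of_pair ω hu hv hw (hpair T ω hω u hu v hv w hw hvw)).trans ?_
      have := Real.add_one_le_exp (-(3 / 2 * q))
      linarith) (by omega) hq
  refine h.trans ?_
  have hpow : Real.exp (-(3 / 2 * q)) ^ (n - r - k) ≤
      Real.exp (3 / 2 * (r + k)) * Real.exp (-(n * q)) * Real.exp (-(n * q / 2)) := by
    rw [← Real.exp_nat_mul, ← Real.exp_add, ← Real.exp_add]
    apply Real.exp_le_exp.mpr
    have h1 : (n : ℝ) ≤ (n - r - k : ℕ) + r + k := by
      exact_mod_cast (show n ≤ (n - r - k) + r + k by omega)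
    have h2 : (n : ℝ) * q ≤ ((n - r - k : ℕ) + r + k) * q := by gcongr
    have h3 : ((r : ℝ) + k) * q ≤ (r + k) * 1 := by gcongr
    linarith
  calc _ ≤ n * Real.exp 1 ^ r * (n * q) ^ (r - 1) * ((k + 1) * (n * (r * q)) ^ k *
        (Real.exp (3 / 2 * (r + k)) * Real.exp (-(n * q)) * Real.exp (-(n * q / 2)))) := by gcongr
    _ = _ := by rw [mul_left_comm (n : ℝ) r q, mul_pow (r : ℝ), pow_add]; ring

end Separators

section Asymptotics

variable {l : Filter ℕ} {K P : ℕ → ℕ} {p : ℕ → unitInterval}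
  [∀ n, Nonempty (KeyRing (K n) (P n))]

lemma tendsto_pow_mul_exp_neg_half (m : ℕ) :
    Tendsto (fun x : ℝ => x ^ m * Real.exp (-(x / 2))) atTop (𝓝 0) := by
  have h := (Real.tendsto_pow_mul_exp_neg_atTop_nhds_zero m).comp
    (tendsto_id.atTop_div_const (show (0 : ℝ) < 2 by norm_num))
  have h' := h.const_mul ((2 : ℝ) ^ m)
  rw [mul_zero] at h'
  refine h'.congr fun x => ?_
  simp only [Function.comp_apply, id]
  rw [div_pow]
  field_simp

/-- With high probability, minimum degree at least `k` implies `k`-connectivity. The events `Q n T`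
hold simultaneously with high probability, and on `Q n T` an outside vertex is adjacent to two given
vertices of `T` with conditional probability at most half of the edge probability. -/
lemma tendsto_minDegreeGE_not_isKConnected (k : ℕ) (hl : l ≤ atTop)
    (hx : Tendsto (fun n : ℕ => n * edgeProb (K n) (P n) (p n)) l atTop) {C : ℝ}
    (hC : ∀ᶠ n : ℕ in l, (n : ℝ) ≤ C * Real.exp (n * edgeProb (K n) (P n) (p n)))
    (hK : Tendsto K l atTop) {C' : ℝ} (hP : ∀ᶠ n : ℕ in l, (n : ℝ) ≤ C' * P n)
    (Q : ∀ n, Finset (Fin n) → Set (Sample (Fin n) (K n) (P n)))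
    (hQ : ∀ n T, DependsOnlyOn (fun ω => ω ∈ Q n T) T)
    (hpair : ∀ᶠ n in l, ∀ T, ∀ ω ∈ Q n T, ∀ u ∉ T, ∀ v ∈ T, ∀ w ∈ T, v ≠ w →
      typeProb (p n) ω T u {A | v ∈ A ∧ w ∈ A} ≤ edgeProb (K n) (P n) (p n) / 2)
    (hQ0 : Tendsto (fun n => (sampleLaw (Fin n) (K n) (P n) (p n)).real {ω | ∃ T, ω ∉ Q n T})
      l (𝓝 0)) :
    Tendsto (fun n => (sampleLaw (Fin n) (K n) (P n) (p n)).real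
        (minDegreeGE (Fin n) (K n) (P n) k ∩ {ω | ¬ (sampleGraph ω).IsKConnected k})) l (𝓝 0) := by
  set x : ℕ → ℝ := fun n => n * edgeProb (K n) (P n) (p n) with hxdef
  -- From this size on, `exp (-(x / 1024)) ^ R` outweighs the factor `n ^ (k + 2)`, as `n = O(exp x)`.
  set R : ℕ := 1024 * (k + 4) with hR
  have hxpow : ∀ m, Tendsto (fun n => x n ^ m * Real.exp (-(x n / 2))) l (𝓝 0) :=
    fun m => (tendsto_pow_mul_exp_neg_half m).comp hx
  -- Failure of expansion has probability `O(K * 2 ^ (-K))`.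
  have hE : Tendsto (fun n => (sampleLaw (Fin n) (K n) (P n) (p n)).real
      {ω | ¬ Expanding (Finset.univ : Finset (Fin n)) ω}) l (𝓝 0) := by
    set ρ : ℕ → ℝ := fun n => Real.exp 1 * C' * ((K n : ℝ) ^ 1 / 2 ^ K n) with hρ
    have hρ0 : Tendsto ρ l (𝓝 0) := by
      have := ((tendsto_pow_const_div_const_pow_of_one_lt 1
        (show (1 : ℝ) < 2 by norm_num)).comp hK).const_mul (Real.exp 1 * C')
      simpa [hρ] using this
    refine squeeze_zero' (.of_forall fun n => measureReal_nonneg) ?_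
      (by simpa using hρ0.const_mul 2)
    filter_upwards [hP, hK.eventually_ge_atTop 2, hρ0.eventually_le_const
      (show (0 : ℝ) < 1 / 2 by norm_num)] with n h1 h2 h3
    refine sampleLaw_real_not_expanding_le h2 ?_ h3
    have hP0 : (0 : ℝ) < P n := by
      have := keyRing_le (K := K n) (P := P n)
      exact_mod_cast (show 0 < P n by omega)
    simp only [hρ, pow_one, Fintype.card_fin]
    have h4 : (n * K n / P n : ℝ) ≤ C' * K n := by
      rw [div_le_iff₀ hP0]
      calc (n : ℝ) * K n ≤ C' * P n * K n := by gcongr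
        _ = _ := by ring
    calc _ ≤ Real.exp 1 * (C' * K n) / 2 ^ K n := by gcongr
      _ = _ := by ring
  -- For connected sets of bounded size.
  have hsmall : Tendsto (fun n => ∑ r ∈ Finset.Ico 2 R,
      (sampleLaw (Fin n) (K n) (P n) (p n)).real (hasIsolated k r (Q n))) l (𝓝 0) := by
    rw [← Finset.sum_const_zero (s := Finset.Ico 2 R)]
    refine tendsto_finsetSum _ fun r hr => ?_
    have hr2 := (Finset.mem_Ico.mp hr).1
    set c : ℝ := Real.exp 1 ^ r * (k + 1) * r ^ k * Real.exp (3 / 2 * (r + k)) with hc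
    refine squeeze_zero' (.of_forall fun n => measureReal_nonneg) ?_
      (by simpa using (hxpow (r - 1 + k)).const_mul (c * C))
    filter_upwards [hpair, hC, hx.eventually_ge_atTop 1] with n h1 h2 h3
    refine (sampleLaw_real_hasIsolated_pair_le k (hQ n) h1 hr2 (by simpa using h3)).trans ?_
    simp only [Fintype.card_fin]
    have hx0 : 0 ≤ x n := by linarith
    have h4 : n * Real.exp (-x n) ≤ C := by
      calc n * Real.exp (-x n) ≤ C * Real.exp (x n) * Real.exp (-x n) := by gcongr
        _ = C := by rw [mul_assoc, ← Real.exp_add]; simp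
    exact mul_le_mul_of_nonneg_right (mul_le_mul_of_nonneg_left h4 (by positivity))
      (by positivity)
  -- For connected sets of at least `R` vertices.
  have hlarge : Tendsto (fun n => ∑ r ∈ (Finset.range (Fintype.card (Fin n))).filter
      (fun r => R ≤ r ∧ 2 * r ≤ Fintype.card (Fin n)),
      (sampleLaw (Fin n) (K n) (P n) (p n)).real (hasIsolated k r fun T => {ω | Expanding T ω}))
      l (𝓝 0) := by
    have hlim1 : Tendsto (fun n => C ^ (k + 2) * (k + 1) * (x n ^ k * Real.exp (-(x n / 2)))) l
        (𝓝 0) := by simpa using (hxpow k).const_mul (C ^ (k + 2) * (k + 1))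
    have hlim2 : Tendsto (fun n : ℕ => ((k : ℝ) + 1) * ((n : ℝ) ^ (2 * k + 1) / 2 ^ n)) l
        (𝓝 0) := by
      have := ((tendsto_pow_const_div_const_pow_of_one_lt (2 * k + 1)
        (show (1 : ℝ) < 2 by norm_num)).mono_left hl).const_mul ((k : ℝ) + 1)
      simpa using this
    refine squeeze_zero' (.of_forall fun n => Finset.sum_nonneg fun _ _ => measureReal_nonneg) ?_
      (by simpa using hlim1.add hlim2)
    have hxe : ∀ᶠ n in l, Real.exp 1 * x n * Real.exp (-(x n / 512)) ≤
        Real.exp (-(x n / 1024)) := by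
      have h1 := ((Real.tendsto_pow_mul_exp_neg_atTop_nhds_zero 1).comp
        (hx.atTop_div_const (show (0 : ℝ) < 1024 by norm_num))).const_mul (Real.exp 1 * 1024)
      rw [mul_zero] at h1
      filter_upwards [h1.eventually_le_const (show (0 : ℝ) < 1 by norm_num)] with n hn
      simp only [Function.comp_apply, pow_one] at hn
      have : Real.exp (-(x n / 512)) = Real.exp (-(x n / 1024)) * Real.exp (-(x n / 1024)) := by
        rw [← Real.exp_add]; congr 1; ring
      rw [this]
      calc _ = (Real.exp 1 * 1024 * (x n / 1024 * Real.exp (-(x n / 1024)))) *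
            Real.exp (-(x n / 1024)) := by ring
        _ ≤ 1 * Real.exp (-(x n / 1024)) := by gcongr
        _ = _ := one_mul _
    filter_upwards [hC, hx.eventually_ge_atTop 1, hK.eventually_ge_atTop 56, hxe,
      hl (eventually_ge_atTop (4 * k))] with n h1 h2 h3 h4 h5
    have hx0 : 0 ≤ x n := by linarith
    have hterm : ∀ r ∈ (Finset.range (Fintype.card (Fin n))).filter
        (fun r => R ≤ r ∧ 2 * r ≤ Fintype.card (Fin n)),
        (sampleLaw (Fin n) (K n) (P n) (p n)).real (hasIsolated k r fun T => {ω | Expanding T ω}) ≤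
        n * ((k + 1) * (n * x n) ^ k) * Real.exp (-((k + 4) * x n)) +
          (k + 1) * (n : ℝ) ^ (2 * k) / 2 ^ n := by
      intro r hr
      simp only [Finset.mem_filter] at hr
      refine (sampleLaw_real_hasIsolated_expanding_le k h3 (by omega) hr.2.2 (by simpa using h5)
        (by simpa using h2)).trans ?_
      simp only [Fintype.card_fin]
      have h6 : (Real.exp 1 * x n * Real.exp (-(x n / 512))) ^ r ≤
          Real.exp (-((k + 4) * x n)) := by
        calc _ ≤ Real.exp (-(x n / 1024)) ^ r := by gcongr
          _ = Real.exp (-(r * (x n / 1024))) := by rw [← Real.exp_nat_mul]; congr 1; ring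
          _ ≤ _ := by
            apply Real.exp_le_exp.mpr
            have h7 : ((1024 * (k + 4) : ℕ) : ℝ) ≤ r := by exact_mod_cast hr.2.1
            push_cast at h7
            have h8 : 1024 * ((k : ℝ) + 4) * (x n / 1024) ≤ r * (x n / 1024) := by gcongr
            linarith
      gcongr
    refine (Finset.sum_le_card_nsmul _ _ _ hterm).trans ?_
    rw [nsmul_eq_mul]
    have hcard : ((((Finset.range (Fintype.card (Fin n))).filter
        (fun r => R ≤ r ∧ 2 * r ≤ Fintype.card (Fin n))).card : ℕ) : ℝ) ≤ n := by
      have := Finset.card_filter_le (Finset.range (Fintype.card (Fin n)))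
        (fun r => R ≤ r ∧ 2 * r ≤ Fintype.card (Fin n))
      rw [Finset.card_range] at this
      simpa using this
    refine (mul_le_mul_of_nonneg_right hcard (by positivity)).trans ?_
    rw [mul_add]
    refine add_le_add ?_ (le_of_eq ?_)
    · have h6 : (n : ℝ) ^ (k + 2) ≤ C ^ (k + 2) * Real.exp ((k + 2) * x n) := by
        calc (n : ℝ) ^ (k + 2) ≤ (C * Real.exp (x n)) ^ (k + 2) := by gcongr
          _ = _ := by rw [mul_pow, ← Real.exp_nat_mul]; push_cast; rfl
      calc _ = (n : ℝ) ^ (k + 2) * ((k + 1) * x n ^ k * Real.exp (-((k + 4) * x n))) := by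
            rw [mul_pow]; ring
        _ ≤ C ^ (k + 2) * Real.exp ((k + 2) * x n) *
            ((k + 1) * x n ^ k * Real.exp (-((k + 4) * x n))) := by gcongr
        _ = C ^ (k + 2) * (k + 1) * (x n ^ k *
            (Real.exp ((k + 2) * x n) * Real.exp (-((k + 4) * x n)))) := by ring
        _ = C ^ (k + 2) * (k + 1) * (x n ^ k * Real.exp (-(2 * x n))) := by
            rw [← Real.exp_add]; congr 3; ring_nf
        _ ≤ _ := by
            have hCk : 0 ≤ C ^ (k + 2) := by
              have : 0 ≤ C := by
                by_contra! hneg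
                have h7 : C * Real.exp (x n) < 0 := mul_neg_of_neg_of_pos hneg (Real.exp_pos _)
                have h8 : (0 : ℝ) ≤ n := Nat.cast_nonneg n
                have h9 : (n : ℝ) ≤ C * Real.exp (x n) := h1
                linarith
              positivity
            gcongr
            linarith
    · rw [pow_succ]; ring
  have htot := ((hE.add hQ0).add hsmall).add hlarge
  simp only [add_zero] at htot
  refine squeeze_zero' (.of_forall fun n => measureReal_nonneg) ?_ htot
  filter_upwards [hl (eventually_gt_atTop k)] with n hn
  exact sampleLaw_real_not_isKConnected_le (by simpa using hn) (Q n)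

end Asymptotics

/-! ### Sets of vertices of low degree -/

section LowDegree

variable {V : Type*} [Fintype V] [DecidableEq V] {K P : ℕ} {p : unitInterval}
  [Nonempty (KeyRing K P)]

open Classical in
/-- The event that every vertex of `A` has at most `h` neighbours. -/
def lowDegree (K P h : ℕ) (A : Finset V) : Set (Sample V K P) :=
  {ω | ∀ v ∈ A, (Finset.univ.filter fun w => (sampleGraph ω).Adj v w).card ≤ h}

open Classical in
/-- The neighbours of `v` outside `A`. -/
noncomputable def nbrsOutside (ω : Sample V K P) (A : Finset V) (v : V) : Finset V :=
  Aᶜ.filter fun u => (sampleGraph ω).Adj u v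

/-- The set of neighbours in `A` that a family `W` of outer neighbourhoods prescribes for `u`. -/
def typeOf (A : Finset V) (W : V → Finset V) (u : V) : Finset V := A.filter fun v => u ∈ W v

lemma typeOf_nbrsOutside (ω : Sample V K P) {A : Finset V} {W : V → Finset V}
    (hW : ∀ v ∈ A, W v = nbrsOutside ω A v) {u : V} (hu : u ∉ A) :
    typeOf A W u = nbrsIn ω A u := by
  classical
  ext v
  simp only [typeOf, nbrsIn, Finset.mem_filter]
  refine and_congr_right fun hv => ?_
  rw [hW v hv]
  simp [nbrsOutside, hu]

/-- Double counting of the pairs `(v, u)` with `u ∈ W v`. -/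
lemma sum_card_eq_sum_card_typeOf {A : Finset V} {W : V → Finset V} (hW : ∀ v ∈ A, W v ⊆ Aᶜ) :
    ∑ v ∈ A, (W v).card = ∑ u ∈ Aᶜ, (typeOf A W u).card := by
  have := Finset.sum_card_bipartiteAbove_eq_sum_card_bipartiteBelow (s := A) (t := Aᶜ)
    (fun v u => u ∈ W v)
  simp only [Finset.bipartiteAbove, Finset.bipartiteBelow] at this
  simp only [typeOf]
  rw [← this]
  refine Finset.sum_congr rfl fun v hv => ?_
  congr 1
  ext u
  simp only [Finset.mem_filter]
  exact ⟨fun h => ⟨hW v hv h, h⟩, fun h => h.2⟩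

lemma nbrsOutside_card_le {ω : Sample V K P} {h : ℕ} {A : Finset V} (hω : ω ∈ lowDegree K P h A)
    {v : V} (hv : v ∈ A) : (nbrsOutside ω A v).card ≤ h := by
  classical
  refine (Finset.card_le_card ?_).trans (hω v hv)
  intro u hu
  simp only [nbrsOutside, Finset.mem_filter, Finset.mem_univ, true_and] at hu ⊢
  exact hu.2.symm

/-- Low degrees in `A` leave `A` with few outer neighbours. -/
lemma outerNbrs_card_le {ω : Sample V K P} {h : ℕ} {A : Finset V} (hω : ω ∈ lowDegree K P h A) :
    (outerNbrs ω A).card ≤ A.card * h := by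
  classical
  refine (Finset.card_le_card (t := A.biUnion fun v => nbrsOutside ω A v) ?_).trans
    (Finset.card_biUnion_le_card_mul _ _ _ fun v hv => nbrsOutside_card_le hω hv)
  intro u hu
  obtain ⟨hu, v, hv⟩ := mem_outerNbrs.mp hu
  simp only [nbrsIn, Finset.mem_filter] at hv
  simp only [Finset.mem_biUnion, nbrsOutside, Finset.mem_filter, Finset.mem_compl]
  exact ⟨v, hv.1, hu, hv.2⟩

lemma nbrsOutside_subset (ω : Sample V K P) (A : Finset V) (v : V) : nbrsOutside ω A v ⊆ Aᶜ := by
  classical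
  exact Finset.filter_subset _ _

/-- The contribution to `lowDegree` of the configurations in which no outside vertex has two
neighbours in `A`: sum over the families of outer neighbourhoods. -/
lemma sampleLaw_real_lowDegree_simple_le (h : ℕ) {A : Finset V} {D : Set (Sample V K P)}
    (hD : DependsOnlyOn (fun ω => ω ∈ D) A) {F : ℝ} (hF0 : 0 ≤ F) (hF1 : F ≤ 1)
    (hF : ∀ ω ∈ D, ∀ u ∉ A, typeProb p ω A u {∅} ≤ F) :
    (sampleLaw V K P p).real
        (D ∩ lowDegree K P h A ∩ {ω | ∀ u ∉ A, (nbrsIn ω A u).card ≤ 1}) ≤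
      (sampleLaw V K P p).real D *
        ((∑ j ∈ Finset.range (h + 1), (Fintype.card V * edgeProb K P p) ^ j / j.factorial) ^ A.card *
          F ^ (Fintype.card V - A.card - A.card * h)) := by
  classical
  set n := Fintype.card V
  set q := edgeProb K P p with hq
  have hq0 : 0 ≤ q := edgeProb_nonneg
  -- The families of outer neighbourhoods, extended by `∅` outside `A`.
  set 𝒮 := Aᶜ.powerset.filter (fun U => U.card ≤ h) with h𝒮
  set 𝒲 : Finset (V → Finset V) := Fintype.piFinset fun v => if v ∈ A then 𝒮 else {∅} with h𝒲
  set E : (V → Finset V) → Set (Sample V K P) := fun W =>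
    D ∩ {ω | ∀ u ∈ Aᶜ, nbrsIn ω A u ∈ {B : Finset V | B = typeOf A W u ∧ B.card ≤ 1}} with hE
  have mem𝒲 : ∀ W ∈ 𝒲, ∀ v ∈ A, W v ⊆ Aᶜ ∧ (W v).card ≤ h := by
    intro W hW v hv
    have := Fintype.mem_piFinset.mp hW v
    rw [if_pos hv, h𝒮, Finset.mem_filter, Finset.mem_powerset] at this
    exact this
  have key : ∀ W ∈ 𝒲, (sampleLaw V K P p).real (E W) ≤
      (sampleLaw V K P p).real D * ((∏ v ∈ A, q ^ (W v).card) * F ^ (n - A.card - A.card * h)) := by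
    intro W hW
    have hW' := mem𝒲 W hW
    by_cases hdis : ∀ u ∈ Aᶜ, (typeOf A W u).card ≤ 1
    swap
    -- A family which is not disjoint prescribes two neighbours for some `u`.
    · have : E W = ∅ := by
        refine Set.eq_empty_of_forall_notMem fun ω hω => hdis fun u hu => ?_
        have := hω.2 u hu
        rw [← this.1]
        exact this.2
      rw [this, measureReal_empty]
      positivity
    have hsum : ∑ v ∈ A, (W v).card = (Aᶜ.filter fun u => (typeOf A W u).Nonempty).card := by
      rw [sum_card_eq_sum_card_typeOf fun v hv => (hW' v hv).1, Finset.card_filter]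
      refine Finset.sum_congr rfl fun u hu => ?_
      have h1 := hdis u hu
      split_ifs with h2
      · have := Finset.card_pos.mpr h2
        omega
      · rw [Finset.not_nonempty_iff_eq_empty.mp h2, Finset.card_empty]
    refine (sampleLaw_real_inter_nbrsIn_le (p := p) (Y := Aᶜ) disjoint_compl_left hD
      (B := fun u => if (typeOf A W u).Nonempty then q else F) ?_).trans ?_
    · intro ω hω u hu
      have hu' := Finset.mem_compl.mp hu
      split_ifs with hne
      · obtain ⟨v, hv⟩ := hne
        have hvA : v ∈ A := (Finset.mem_filter.mp hv).1
        rw [hq, ← typeProb_mem ω hu' hvA]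
        refine typeProb_mono ω fun B _ hB => ?_
        simp only [Set.mem_ofPred_eq] at hB ⊢
        rw [hB.1]; exact hv
      · refine le_trans (typeProb_mono ω fun B _ hB => ?_) (hF ω hω u hu')
        rw [Set.mem_singleton_iff, hB.1, Finset.not_nonempty_iff_eq_empty.mp hne]
    · refine mul_le_mul_of_nonneg_left ?_ measureReal_nonneg
      rw [Finset.prod_ite, Finset.prod_const, Finset.prod_const, ← hsum, Finset.prod_pow_eq_pow_sum]
      refine mul_le_mul_of_nonneg_left (pow_le_pow_of_le_one hF0 hF1 ?_) (by positivity)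
      have h1 := Finset.card_filter_add_card_filter_not (s := Aᶜ)
        (fun u => (typeOf A W u).Nonempty)
      rw [← hsum, Finset.card_compl] at h1
      have h2 : ∑ v ∈ A, (W v).card ≤ A.card * h := by
        rw [← smul_eq_mul]
        exact Finset.sum_le_card_nsmul _ _ _ fun v hv => (hW' v hv).2
      omega
  calc _ ≤ (sampleLaw V K P p).real (⋃ W ∈ 𝒲, E W) := by
        refine measureReal_mono ?_ (measure_ne_top _ _)
        rintro ω ⟨⟨hω, hlow⟩, h1⟩
        simp only [Set.mem_iUnion]
        refine ⟨fun v => if v ∈ A then nbrsOutside ω A v else ∅, ?_, hω, ?_⟩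
        · rw [h𝒲, Fintype.mem_piFinset]
          intro v
          split_ifs with hv
          · rw [h𝒮, Finset.mem_filter, Finset.mem_powerset]
            exact ⟨nbrsOutside_subset ω A v, nbrsOutside_card_le hlow hv⟩
          · simp
        · intro u hu
          rw [Finset.mem_compl] at hu
          refine ⟨(typeOf_nbrsOutside ω (fun v hv => by simp [hv]) hu).symm, h1 u hu⟩
    _ ≤ ∑ W ∈ 𝒲, (sampleLaw V K P p).real D *
          ((∏ v ∈ A, q ^ (W v).card) * F ^ (n - A.card - A.card * h)) :=
        (measureReal_biUnion_finset_le _ _).trans (Finset.sum_le_sum key)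
    _ = (sampleLaw V K P p).real D *
          ((∑ U ∈ 𝒮, q ^ U.card) ^ A.card * F ^ (n - A.card - A.card * h)) := by
        rw [← Finset.mul_sum, ← Finset.sum_mul]
        congr 2
        have h1 : ∀ W : V → Finset V, ∏ v ∈ A, q ^ (W v).card =
            ∏ v, (fun (v : V) (U : Finset V) => if v ∈ A then q ^ U.card else 1) v (W v) := by
          intro W
          rw [Finset.prod_ite_mem, Finset.univ_inter]
        rw [Finset.sum_congr rfl fun W _ => h1 W, h𝒲, ← Finset.prod_univ_sum
          (fun v => if v ∈ A then 𝒮 else {∅})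
          (fun (v : V) (U : Finset V) => if v ∈ A then q ^ U.card else 1)]
        rw [← Finset.prod_subset (Finset.subset_univ A)]
        · rw [← Finset.prod_const]
          refine Finset.prod_congr rfl fun v hv => ?_
          simp [hv]
        · intro v _ hv
          simp [hv]
    _ ≤ _ := by
        refine mul_le_mul_of_nonneg_left ?_ measureReal_nonneg
        gcongr
        rw [h𝒮, ← Finset.sum_fiberwise_of_maps_to (t := Finset.range (h + 1)) (g := Finset.card)]
        · refine Finset.sum_le_sum fun j hj => ?_
          calc _ ≤ ∑ U ∈ Aᶜ.powersetCard j, q ^ j := by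
                rw [Finset.sum_congr rfl (g := fun _ => q ^ j)]
                · refine Finset.sum_le_sum_of_subset_of_nonneg ?_ fun _ _ _ => by positivity
                  intro U hU
                  simp only [Finset.mem_filter, Finset.mem_powerset] at hU
                  exact Finset.mem_powersetCard.mpr ⟨hU.1.1, hU.2⟩
                · intro U hU
                  rw [(Finset.mem_filter.mp hU).2]
            _ = (Aᶜ.card.choose j : ℝ) * q ^ j := by
                rw [Finset.sum_const, Finset.card_powersetCard, nsmul_eq_mul]
            _ ≤ (n : ℝ) ^ j / j.factorial * q ^ j := by
                gcongr
                refine (Nat.choose_le_pow_div j _).trans ?_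
                gcongr
                exact Finset.card_le_univ _
            _ = _ := by rw [mul_pow]; ring
        · intro U hU
          have := (Finset.mem_filter.mp hU).2
          exact Finset.mem_range.mpr (by omega)

/-- The contribution to `lowDegree` of the configurations in which some outside vertex has two
neighbours in `A`: sum over the set `Y` of outer neighbours and such a vertex `u₀ ∈ Y`. -/
lemma sampleLaw_real_lowDegree_double_le (h : ℕ) {A : Finset V} {D : Set (Sample V K P)}
    (hD : DependsOnlyOn (fun ω => ω ∈ D) A) {F β : ℝ} (hF0 : 0 ≤ F) (hF1 : F ≤ 1) (hβ0 : 0 ≤ β)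
    (hF : ∀ ω ∈ D, ∀ u ∉ A, typeProb p ω A u {∅} ≤ F)
    (hβ : ∀ ω ∈ D, ∀ u ∉ A, typeProb p ω A u {B | 2 ≤ B.card} ≤ β)
    (hq : 1 ≤ Fintype.card V * (A.card * edgeProb K P p)) :
    (sampleLaw V K P p).real
        (D ∩ lowDegree K P h A ∩ {ω | ¬ ∀ u ∉ A, (nbrsIn ω A u).card ≤ 1}) ≤
      (sampleLaw V K P p).real D * ((A.card * h : ℕ) * (Fintype.card V * β) *
        (((A.card * h : ℕ) + 1) * (Fintype.card V * (A.card * edgeProb K P p)) ^ (A.card * h)) *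
          F ^ (Fintype.card V - A.card - A.card * h)) := by
  classical
  set n := Fintype.card V with hn
  set y := A.card * edgeProb K P p with hy
  set L := A.card * h with hL
  have hy0 : 0 < y := by
    rcases (mul_nonneg (Nat.cast_nonneg A.card) (edgeProb_nonneg (K := K) (P := P) (p := p))).lt_or_eq
      with h1 | h1
    · exact h1
    · rw [hy, ← h1] at hq; norm_num at hq
  have hn0 : (0 : ℝ) ≤ n := Nat.cast_nonneg _
  set 𝒮 := Aᶜ.powerset.filter (fun U => U.card ≤ L) with h𝒮
  set E : Finset V → V → Set (Sample V K P) := fun Y u₀ => D ∩ {ω | ∀ u ∈ Aᶜ, nbrsIn ω A u ∈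
    (if u = u₀ then {B : Finset V | 2 ≤ B.card} else if u ∈ Y then {B | B.Nonempty} else {∅})}
    with hE
  have key : ∀ Y ∈ 𝒮, ∀ u₀ ∈ Y, (sampleLaw V K P p).real (E Y u₀) ≤
      (sampleLaw V K P p).real D * (β / y * (y ^ Y.card * F ^ (n - A.card - L))) := by
    intro Y hY u₀ hu₀
    simp only [h𝒮, Finset.mem_filter, Finset.mem_powerset] at hY
    refine (sampleLaw_real_inter_nbrsIn_le (p := p) (Y := Aᶜ) disjoint_compl_left hD
      (B := fun u => if u = u₀ then β else if u ∈ Y then y else F) ?_).trans ?_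
    · intro ω hω u hu
      have hu' := Finset.mem_compl.mp hu
      split_ifs
      · exact hβ ω hω u hu'
      · exact typeProb_nonempty_le ω hu'
      · exact hF ω hω u hu'
    · refine mul_le_mul_of_nonneg_left ?_ measureReal_nonneg
      rw [← Finset.mul_prod_erase _ _ (hY.1 hu₀), if_pos rfl,
        Finset.prod_congr rfl (g := fun u => if u ∈ Y then y else F)
          (fun u hu => by rw [if_neg (Finset.ne_of_mem_erase hu)]),
        Finset.prod_ite, Finset.prod_const, Finset.prod_const]
      have h1 : ((Aᶜ.erase u₀).filter fun u => u ∈ Y).card = Y.card - 1 := by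
        rw [← Finset.card_erase_of_mem hu₀]
        congr 1
        ext u
        simp only [Finset.mem_filter, Finset.mem_erase]
        exact ⟨fun h => ⟨h.1.1, h.2⟩, fun h => ⟨⟨h.1, hY.1 h.2⟩, h.2⟩⟩
      have h2 := Finset.card_filter_add_card_filter_not (s := Aᶜ.erase u₀) (fun u => u ∈ Y)
      rw [h1, Finset.card_erase_of_mem (hY.1 hu₀), Finset.card_compl] at h2
      have h3 : 0 < Y.card := Finset.card_pos.mpr ⟨_, hu₀⟩
      have h4 : β / y * y ^ Y.card = β * y ^ (Y.card - 1) := by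
        obtain ⟨t, ht⟩ := Nat.exists_eq_add_of_le' h3
        rw [ht, Nat.add_sub_cancel, pow_succ]
        field_simp
      rw [h1, ← mul_assoc, ← mul_assoc, h4]
      refine mul_le_mul_of_nonneg_left (pow_le_pow_of_le_one hF0 hF1 ?_) (by positivity)
      have := hY.2
      omega
  calc _ ≤ (sampleLaw V K P p).real (⋃ Y ∈ 𝒮, ⋃ u₀ ∈ Y, E Y u₀) := by
        refine measureReal_mono ?_ (measure_ne_top _ _)
        rintro ω ⟨⟨hω, hlow⟩, h1⟩
        simp only [Set.mem_ofPred_eq, not_forall, not_le] at h1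
        obtain ⟨u₀, hu₀, h1⟩ := h1
        simp only [Set.mem_iUnion]
        refine ⟨outerNbrs ω A, ?_, u₀, ?_, hω, ?_⟩
        · simp only [h𝒮, Finset.mem_filter, Finset.mem_powerset]
          refine ⟨fun u hu => Finset.mem_compl.mpr (mem_outerNbrs.mp hu).1, outerNbrs_card_le hlow⟩
        · exact mem_outerNbrs.mpr ⟨hu₀, Finset.card_pos.mp (by omega)⟩
        · intro u hu
          rw [Finset.mem_compl] at hu
          split_ifs with h2 h3
          · subst h2; exact h1
          · exact (mem_outerNbrs.mp h3).2
          · rw [Set.mem_singleton_iff, ← Finset.not_nonempty_iff_eq_empty]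
            exact fun h4 => h3 (mem_outerNbrs.mpr ⟨hu, h4⟩)
    _ ≤ ∑ Y ∈ 𝒮, ∑ u₀ ∈ Y, (sampleLaw V K P p).real (E Y u₀) :=
        (measureReal_biUnion_finset_le _ _).trans
          (Finset.sum_le_sum fun Y _ => measureReal_biUnion_finset_le _ _)
    _ ≤ ∑ Y ∈ 𝒮, L * ((sampleLaw V K P p).real D *
          (β / y * (y ^ Y.card * F ^ (n - A.card - L)))) := by
        refine Finset.sum_le_sum fun Y hY => ?_
        refine (Finset.sum_le_card_nsmul _ _ _ (key Y hY)).trans ?_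
        rw [nsmul_eq_mul]
        refine mul_le_mul_of_nonneg_right ?_ (by positivity)
        exact_mod_cast (Finset.mem_filter.mp hY).2
    _ = (sampleLaw V K P p).real D * (L * (β / y) * (∑ Y ∈ 𝒮, y ^ Y.card) *
          F ^ (n - A.card - L)) := by
        simp only [Finset.mul_sum, Finset.sum_mul]
        refine Finset.sum_congr rfl fun Y _ => by ring
    _ ≤ _ := by
        refine mul_le_mul_of_nonneg_left ?_ measureReal_nonneg
        have h1 : β / y ≤ n * β := by
          rw [div_le_iff₀ hy0]
          calc β = β * 1 := (mul_one _).symm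
            _ ≤ β * (n * y) := by gcongr
            _ = _ := by ring
        have h2 := sum_pow_card_le Aᶜ L hy0.le hq
        gcongr

/-- A lower bound for the number of families of disjoint `h`-subsets of `S` indexed by `A`, choosing
the members one after the other. -/
lemma le_card_disjoint_families (h : ℕ) (S A : Finset V) :
    ((S.card - A.card * h).choose h) ^ A.card ≤
      ((Finset.univ : Finset (V → Finset V)).filter fun W => (∀ v ∉ A, W v = ∅) ∧
        (∀ v ∈ A, W v ⊆ S ∧ (W v).card = h) ∧
        ∀ v ∈ A, ∀ w ∈ A, v ≠ w → Disjoint (W v) (W w)).card := by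
  induction A using Finset.induction_on with
  | empty =>
    simp only [Finset.card_empty, pow_zero, Nat.one_le_iff_ne_zero, ← Nat.pos_iff_ne_zero,
      Finset.card_pos]
    exact ⟨fun _ => ∅, by simp⟩
  | insert a A ha ih =>
    set 𝒲 := (Finset.univ : Finset (V → Finset V)).filter fun W => (∀ v ∉ A, W v = ∅) ∧
        (∀ v ∈ A, W v ⊆ S ∧ (W v).card = h) ∧
        ∀ v ∈ A, ∀ w ∈ A, v ≠ w → Disjoint (W v) (W w) with h𝒲
    set c := (S.card - (insert a A).card * h).choose h with hc
    have hcard : (insert a A).card = A.card + 1 := Finset.card_insert_of_notMem ha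
    have hfib : ∀ W ∈ 𝒲, c ≤ ((S \ A.biUnion W).powersetCard h).card := by
      intro W hW
      simp only [h𝒲, Finset.mem_filter, Finset.mem_univ, true_and] at hW
      rw [Finset.card_powersetCard, hc]
      refine Nat.choose_le_choose _ ?_
      have h1 : (A.biUnion W).card ≤ A.card * h :=
        Finset.card_biUnion_le_card_mul _ _ _ fun v hv => (hW.2.1 v hv).2.le
      have h2 := Finset.le_card_sdiff (A.biUnion W) S
      rw [hcard, Nat.add_mul]
      omega
    calc c ^ (insert a A).card = c ^ A.card * c := by rw [hcard, pow_succ]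
      _ ≤ 𝒲.card * c := by
          gcongr
          refine le_trans (Nat.pow_le_pow_left (Nat.choose_le_choose _ ?_) _) ih
          rw [hcard, Nat.add_mul]
          omega
      _ ≤ (𝒲.sigma fun W => (S \ A.biUnion W).powersetCard h).card := by
          rw [Finset.card_sigma, ← smul_eq_mul]
          exact Finset.card_nsmul_le_sum _ _ _ hfib
      _ ≤ _ := by
          refine Finset.card_le_card_of_injOn (fun x => Function.update x.1 a x.2) ?_ ?_
          · rintro ⟨W, B⟩ hx
            simp only [Finset.coe_sigma, Set.mem_sigma_iff, Finset.mem_coe, h𝒲, Finset.mem_filter,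
              Finset.mem_univ, true_and, Finset.mem_powersetCard] at hx ⊢
            obtain ⟨⟨hW1, hW2, hW3⟩, hB1, hB2⟩ := hx
            have hne : ∀ v ∈ A, v ≠ a := fun v hv => ne_of_mem_of_not_mem hv ha
            have hBW : ∀ v ∈ A, Disjoint B (W v) := by
              intro v hv
              rw [Finset.disjoint_left]
              intro z hz hz'
              exact (Finset.mem_sdiff.mp (hB1 hz)).2 (Finset.mem_biUnion.mpr ⟨v, hv, hz'⟩)
            refine ⟨?_, ?_, ?_⟩
            · intro v hv
              rw [Finset.mem_insert, not_or] at hv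
              rw [Function.update_of_ne hv.1, hW1 v hv.2]
            · intro v hv
              rcases Finset.mem_insert.mp hv with rfl | hv
              · rw [Function.update_self]
                exact ⟨hB1.trans Finset.sdiff_subset, hB2⟩
              · rw [Function.update_of_ne (hne v hv)]
                exact hW2 v hv
            · intro v hv w hw hvw
              rcases Finset.mem_insert.mp hv with hv | hv <;>
                rcases Finset.mem_insert.mp hw with hw | hw
              · exact absurd (hv.trans hw.symm) hvw
              · rw [hv, Function.update_self, Function.update_of_ne (hne w hw)]
                exact hBW w hw
              · rw [hw, Function.update_self, Function.update_of_ne (hne v hv)]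
                exact (hBW v hv).symm
              · rw [Function.update_of_ne (hne v hv), Function.update_of_ne (hne w hw)]
                exact hW3 v hv w hw hvw
          · rintro ⟨W, B⟩ hx ⟨W', B'⟩ hx' heq
            simp only [Finset.coe_sigma, Set.mem_sigma_iff, Finset.mem_coe, h𝒲, Finset.mem_filter,
              Finset.mem_univ, true_and] at hx hx' heq
            have h1 : W = W' := by
              funext v
              by_cases hv : v = a
              · subst hv
                rw [hx.1.1 v ha, hx'.1.1 v ha]
              · have := congrFun heq v
                rwa [Function.update_of_ne hv, Function.update_of_ne hv] at this
            have h2 : B = B' := by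
              have := congrFun heq a
              rwa [Function.update_self, Function.update_self] at this
            subst h1 h2
            rfl

/-- A lower bound for the probability of `lowDegree`, from the configurations in which `A` is
independent and its vertices have `h` outer neighbours each, all distinct. -/
lemma le_sampleLaw_real_lowDegree (h : ℕ) {A : Finset V} {D : Set (Sample V K P)}
    (hD : DependsOnlyOn (fun ω => ω ∈ D) A) {b : ℝ}
    (hDA : ∀ ω ∈ D, ∀ v ∈ A, ∀ w ∈ A, ¬ (sampleGraph ω).Adj v w)
    (hb : ∀ ω ∈ D, ∀ u ∉ A, typeProb p ω A u {B | 2 ≤ B.card} ≤ b)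
    (hqb : b ≤ edgeProb K P p) (hq1 : A.card * edgeProb K P p ≤ 1) :
    (sampleLaw V K P p).real D *
      (((Fintype.card V - A.card - A.card * h).choose h : ℝ) ^ A.card *
        (edgeProb K P p - b) ^ (A.card * h) * (1 - A.card * edgeProb K P p) ^ Fintype.card V) ≤
      (sampleLaw V K P p).real (lowDegree K P h A) := by
  classical
  set n := Fintype.card V with hn
  set q := edgeProb K P p with hq
  have hq0 : 0 ≤ q := edgeProb_nonneg
  set 𝒲 := (Finset.univ : Finset (V → Finset V)).filter fun W => (∀ v ∉ A, W v = ∅) ∧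
        (∀ v ∈ A, W v ⊆ Aᶜ ∧ (W v).card = h) ∧
        ∀ v ∈ A, ∀ w ∈ A, v ≠ w → Disjoint (W v) (W w) with h𝒲
  have hcount := le_card_disjoint_families h Aᶜ A
  rw [Finset.card_compl] at hcount
  set E : (V → Finset V) → Set (Sample V K P) := fun W =>
    D ∩ {ω | ∀ u ∈ Aᶜ, nbrsIn ω A u ∈ ({typeOf A W u} : Set (Finset V))} with hE
  have mem𝒲 : ∀ W ∈ 𝒲, (∀ v ∉ A, W v = ∅) ∧ (∀ v ∈ A, W v ⊆ Aᶜ ∧ (W v).card = h) ∧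
        ∀ v ∈ A, ∀ w ∈ A, v ≠ w → Disjoint (W v) (W w) := fun W hW => by
    simpa [h𝒲] using hW
  have key : ∀ W ∈ 𝒲, (sampleLaw V K P p).real D *
      ((q - b) ^ (A.card * h) * (1 - A.card * q) ^ n) ≤ (sampleLaw V K P p).real (E W) := by
    intro W hW
    obtain ⟨-, hW1, hW2⟩ := mem𝒲 W hW
    have hone : ∀ u, (typeOf A W u).card ≤ 1 := by
      intro u
      rw [Finset.card_le_one]
      intro v hv w hw
      by_contra hvw
      rw [typeOf, Finset.mem_filter] at hv hw
      exact Finset.disjoint_left.mp (hW2 v hv.1 w hw.1 hvw) hv.2 hw.2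
    have hsum : A.card * h = (Aᶜ.filter fun u => (typeOf A W u).Nonempty).card := by
      have h0 : ∑ v ∈ A, (W v).card = A.card * h := by
        rw [Finset.sum_congr rfl fun v hv => (hW1 v hv).2, Finset.sum_const, smul_eq_mul]
      rw [← h0, sum_card_eq_sum_card_typeOf fun v hv => (hW1 v hv).1, Finset.card_filter]
      refine Finset.sum_congr rfl fun u hu => ?_
      have h1 := hone u
      split_ifs with h2
      · have := Finset.card_pos.mpr h2
        omega
      · rw [Finset.not_nonempty_iff_eq_empty.mp h2, Finset.card_empty]
    refine le_trans ?_ (le_sampleLaw_real_inter_nbrsIn (p := p) (Y := Aᶜ) disjoint_compl_left hD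
      (B := fun u => if (typeOf A W u).Nonempty then q - b else 1 - A.card * q) ?_ ?_)
    · refine mul_le_mul_of_nonneg_left ?_ measureReal_nonneg
      rw [Finset.prod_ite, Finset.prod_const, Finset.prod_const, ← hsum]
      have h0 : 0 ≤ q - b := by linarith
      have h1 : 0 ≤ 1 - A.card * q := by linarith
      refine mul_le_mul_of_nonneg_left (pow_le_pow_of_le_one h1 ?_ ?_) (pow_nonneg h0 _)
      · have : 0 ≤ A.card * q := mul_nonneg (Nat.cast_nonneg _) hq0
        linarith
      · exact (Finset.card_filter_le _ _).trans (Finset.card_le_univ _)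
    · intro ω hω u hu
      have hu' := Finset.mem_compl.mp hu
      split_ifs with hne
      · obtain ⟨v, hv⟩ := hne
        have hvA : v ∈ A := (Finset.mem_filter.mp hv).1
        have : typeOf A W u = {v} := Finset.eq_singleton_iff_unique_mem.mpr
          ⟨hv, fun w hw => Finset.card_le_one.mp (hone u) w hw v hv⟩
        rw [this]
        linarith [le_typeProb_singleton (p := p) ω hu' hvA, hb ω hω u hu']
      · rw [Finset.not_nonempty_iff_eq_empty.mp hne]
        exact one_sub_le_typeProb_empty ω hu'
    · intro u _
      split_ifs <;> linarith
  have hdisj : (𝒲 : Set (V → Finset V)).PairwiseDisjoint E := by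
    intro W hW W' hW' hne
    obtain ⟨hW0, hW1, -⟩ := mem𝒲 W hW
    obtain ⟨hW0', hW1', -⟩ := mem𝒲 W' hW'
    refine Set.disjoint_left.mpr fun ω hω hω' => hne ?_
    funext v
    by_cases hv : v ∈ A
    · ext u
      by_cases hu : u ∈ Aᶜ
      · have h1 : typeOf A W u = typeOf A W' u :=
          (Set.mem_singleton_iff.mp (hω.2 u hu)).symm.trans (Set.mem_singleton_iff.mp (hω'.2 u hu))
        have h2 := congrArg (fun B => v ∈ B) h1
        simpa [typeOf, hv] using h2
      · exact ⟨fun h => absurd ((hW1 v hv).1 h) hu, fun h => absurd ((hW1' v hv).1 h) hu⟩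
    · rw [hW0 v hv, hW0' v hv]
  calc _ ≤ (𝒲.card : ℝ) * ((sampleLaw V K P p).real D *
        ((q - b) ^ (A.card * h) * (1 - A.card * q) ^ n)) := by
        have h1 : ((n - A.card - A.card * h).choose h : ℝ) ^ A.card ≤ 𝒲.card := by
          exact_mod_cast hcount
        have h2 : 0 ≤ q - b := by linarith
        have h3 : 0 ≤ 1 - A.card * q := by linarith
        calc _ = ((n - A.card - A.card * h).choose h : ℝ) ^ A.card * ((sampleLaw V K P p).real D *
              ((q - b) ^ (A.card * h) * (1 - A.card * q) ^ n)) := by ring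
          _ ≤ _ := mul_le_mul_of_nonneg_right h1 (mul_nonneg measureReal_nonneg
            (mul_nonneg (pow_nonneg h2 _) (pow_nonneg h3 _)))
    _ ≤ ∑ W ∈ 𝒲, (sampleLaw V K P p).real (E W) := by
        rw [← nsmul_eq_mul]
        exact Finset.card_nsmul_le_sum _ _ _ key
    _ = (sampleLaw V K P p).real (⋃ W ∈ 𝒲, E W) :=
        (measureReal_biUnion_finset hdisj fun _ _ => .of_discrete).symm
    _ ≤ _ := by
        refine measureReal_mono ?_ (measure_ne_top _ _)
        intro ω hω
        simp only [Set.mem_iUnion] at hω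
        obtain ⟨W, hW, hω, htype⟩ := hω
        obtain ⟨-, hW1, -⟩ := mem𝒲 W hW
        intro v hv
        rw [← (hW1 v hv).2]
        refine Finset.card_le_card fun u hu => ?_
        simp only [Finset.mem_filter, Finset.mem_univ, true_and] at hu
        have huA : u ∉ A := fun h' => hDA ω hω v hv u h' hu
        have h1 := Set.mem_singleton_iff.mp (htype u (Finset.mem_compl.mpr huA))
        have h2 : v ∈ nbrsIn ω A u := by
          simp only [nbrsIn, Finset.mem_filter]
          exact ⟨hv, hu.symm⟩
        rw [h1] at h2
        exact (Finset.mem_filter.mp h2).2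

end LowDegree

/-! ### Binomial moments of the number of vertices of low degree -/

section Moments

variable {V : Type*} [Fintype V] [DecidableEq V] {K P : ℕ} {p : unitInterval}
  [Nonempty (KeyRing K P)]

open Classical in
/-- The Bonferroni inequalities for the number of vertices of degree at most `h`. -/
lemma abs_real_minDegreeGE_sub_le (h J : ℕ) (hJ : 1 ≤ J) :
    |(sampleLaw V K P p).real (minDegreeGE V K P (h + 1)) - ∑ j ∈ Finset.range J, (-1) ^ j *
      ∑ A ∈ Finset.powersetCard j (Finset.univ : Finset V),
        (sampleLaw V K P p).real (lowDegree K P h A)| ≤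
      ∑ A ∈ Finset.powersetCard J (Finset.univ : Finset V),
        (sampleLaw V K P p).real (lowDegree K P h A) := by
  set S : Sample V K P → Finset V := fun ω => Finset.univ.filter fun v =>
    (Finset.univ.filter fun w => (sampleGraph ω).Adj v w).card ≤ h with hS
  have hmom : ∀ j, ∫ ω, ((S ω).card.choose j : ℝ) ∂(sampleLaw V K P p) =
      ∑ A ∈ Finset.powersetCard j (Finset.univ : Finset V),
        (sampleLaw V K P p).real (lowDegree K P h A) := by
    intro j
    have h1 : ∀ ω, ((S ω).card.choose j : ℝ) =
        ∑ A ∈ Finset.powersetCard j (Finset.univ : Finset V),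
          (lowDegree K P h A).indicator (1 : Sample V K P → ℝ) ω := by
      intro ω
      rw [← Finset.card_powersetCard, Finset.card_eq_sum_ones]
      push_cast
      simp only [Set.indicator_apply, Pi.one_apply]
      rw [← Finset.sum_filter]
      refine Finset.sum_congr ?_ fun _ _ => rfl
      ext A
      rw [Finset.mem_filter, Finset.mem_powersetCard, Finset.mem_powersetCard]
      simp only [lowDegree, Set.mem_ofPred_eq, hS, Finset.subset_iff, Finset.mem_filter,
        Finset.mem_univ, true_and, implies_true]
      exact and_comm
    simp only [h1]
    rw [integral_finsetSum _ fun _ _ => .of_finite]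
    exact Finset.sum_congr rfl fun A _ => integral_indicator_one .of_discrete
  have hzero : (sampleLaw V K P p).real (minDegreeGE V K P (h + 1)) =
      ∫ ω, (if (S ω).card = 0 then (1 : ℝ) else 0) ∂(sampleLaw V K P p) := by
    rw [← integral_indicator_one .of_discrete]
    refine integral_congr_ae (.of_forall fun ω => ?_)
    simp only [Set.indicator_apply, Pi.one_apply, minDegreeGE, Set.mem_ofPred_eq,
      Finset.card_eq_zero, hS, Finset.filter_eq_empty_iff, Finset.mem_univ, true_imp_iff, not_le,
      Nat.succ_le_iff]
  simp only [← hmom, hzero]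
  have hsum : ∑ j ∈ Finset.range J, (-1 : ℝ) ^ j *
      ∫ ω, ((S ω).card.choose j : ℝ) ∂(sampleLaw V K P p) =
      ∫ ω, ∑ j ∈ Finset.range J, (-1 : ℝ) ^ j * ((S ω).card.choose j : ℝ) ∂(sampleLaw V K P p) := by
    rw [integral_finsetSum _ fun _ _ => .of_finite]
    exact Finset.sum_congr rfl fun j _ => (integral_const_mul _ _).symm
  rw [hsum, ← integral_sub .of_finite .of_finite]
  refine (abs_integral_le_integral_abs).trans ?_
  exact integral_mono .of_finite .of_finite fun ω => abs_ite_sub_sum_choose_le _ _ hJ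

lemma exp_neg_sub_sq_le {y : ℝ} (hy0 : 0 ≤ y) (hy1 : y ≤ 1 / 2) :
    Real.exp (-y - y ^ 2) ≤ 1 - y := by
  have h := Real.quadratic_le_exp_of_nonneg (show 0 ≤ y + y ^ 2 by positivity)
  have h3 : 1 ≤ (1 - y) * (1 + (y + y ^ 2) + (y + y ^ 2) ^ 2 / 2) := by
    have h4 : 0 ≤ 1 - y - y ^ 2 - y ^ 3 := by
      have : y ^ 2 ≤ (1 / 2) ^ 2 := by gcongr
      have : y ^ 3 ≤ (1 / 2) ^ 3 := by gcongr
      linarith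
    have h5 : (1 - y) * (1 + (y + y ^ 2) + (y + y ^ 2) ^ 2 / 2) =
        1 + y ^ 2 / 2 * (1 - y - y ^ 2 - y ^ 3) := by ring
    rw [h5]
    have : 0 ≤ y ^ 2 / 2 * (1 - y - y ^ 2 - y ^ 3) := by positivity
    linarith
  have h4 : 1 ≤ (1 - y) * Real.exp (y + y ^ 2) :=
    h3.trans (mul_le_mul_of_nonneg_left h (by linarith))
  rw [show -y - y ^ 2 = -(y + y ^ 2) by ring, Real.exp_neg, inv_le_iff_one_le_mul₀ (Real.exp_pos _)]
  exact h4

/-- The two contributions to `lowDegree` together. An outside vertex misses `A` with conditional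
probability at most `exp (-|A| (q - β))`; the exponent lost by raising this to a power less than `n`
is collected in the last factor. -/
lemma sampleLaw_real_inter_lowDegree_le (h : ℕ) {A : Finset V} {D : Set (Sample V K P)}
    (hD : DependsOnlyOn (fun ω => ω ∈ D) A) {β : ℝ} (hβ0 : 0 ≤ β)
    (hβq : β ≤ edgeProb K P p)
    (hβ : ∀ ω ∈ D, ∀ u ∉ A, typeProb p ω A u {B | 2 ≤ B.card} ≤ β)
    (hq : 1 ≤ Fintype.card V * (A.card * edgeProb K P p)) :
    (sampleLaw V K P p).real (D ∩ lowDegree K P h A) ≤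
      ((∑ j ∈ Finset.range (h + 1), (Fintype.card V * edgeProb K P p) ^ j / j.factorial) ^ A.card +
        (A.card * h : ℕ) * (Fintype.card V * β) *
          (((A.card * h : ℕ) + 1) * (Fintype.card V * (A.card * edgeProb K P p)) ^ (A.card * h))) *
        (Real.exp (-(Fintype.card V * edgeProb K P p)) ^ A.card *
          Real.exp (A.card * (Fintype.card V * β) +
            A.card * (A.card + A.card * h : ℕ) * edgeProb K P p)) := by
  set n := Fintype.card V with hn
  set q := edgeProb K P p with hqdef
  set m := A.card with hm
  have hq0 : 0 ≤ q := edgeProb_nonneg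
  set F := Real.exp (-(m * (q - β))) with hFdef
  have hF : ∀ ω ∈ D, ∀ u ∉ A, typeProb p ω A u {∅} ≤ F := by
    intro ω hω u hu
    refine (typeProb_empty_le ω hu).trans ?_
    have h1 := hβ ω hω u hu
    have h2 := Real.add_one_le_exp (-(m * (q - β)))
    have h3 : (m : ℝ) * typeProb p ω A u {B | 2 ≤ B.card} ≤ m * β := by gcongr
    calc _ ≤ 1 - m * q + m * β := by linarith
      _ = -(m * (q - β)) + 1 := by ring
      _ ≤ _ := h2
  have hF0 : 0 ≤ F := (Real.exp_pos _).le
  have hF1 : F ≤ 1 := Real.exp_le_one_iff.mpr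
    (neg_nonpos.mpr (mul_nonneg (Nat.cast_nonneg _) (sub_nonneg.mpr hβq)))
  have hFp : F ^ (n - m - m * h) ≤ Real.exp (-(n * q)) ^ m *
      Real.exp (m * (n * β) + m * (m + m * h : ℕ) * q) := by
    rw [hFdef, ← Real.exp_nat_mul, ← Real.exp_nat_mul, ← Real.exp_add, Real.exp_le_exp]
    have h1 : (n : ℝ) - (m + m * h : ℕ) ≤ (n - m - m * h : ℕ) := by
      have : n ≤ (n - m - m * h) + (m + m * h) := by omega
      have : (n : ℝ) ≤ ((n - m - m * h : ℕ) : ℝ) + ((m + m * h : ℕ) : ℝ) := by exact_mod_cast this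
      linarith
    have h2 : 0 ≤ (m : ℝ) * (q - β) := mul_nonneg (Nat.cast_nonneg _) (sub_nonneg.mpr hβq)
    have h3 := mul_le_mul_of_nonneg_right h1 h2
    have h4 : 0 ≤ (m : ℝ) * (m + m * h : ℕ) * β := by positivity
    linarith
  have h1 := sampleLaw_real_lowDegree_simple_le h hD hF0 hF1 hF
  have h2 := sampleLaw_real_lowDegree_double_le h hD hF0 hF1 hβ0 hF hβ hq
  have hD1 : (sampleLaw V K P p).real D ≤ 1 := measureReal_le_one
  have hx0 : 0 ≤ (n : ℝ) * q := by positivity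
  set E := {ω : Sample V K P | ∀ u ∉ A, (nbrsIn ω A u).card ≤ 1} with hE
  have hcov : D ∩ lowDegree K P h A ⊆
      (D ∩ lowDegree K P h A ∩ E) ∪ (D ∩ lowDegree K P h A ∩ {ω | ¬ ∀ u ∉ A, (nbrsIn ω A u).card ≤ 1}) := by
    intro ω hω
    by_cases h' : ω ∈ E
    · exact Or.inl ⟨hω, h'⟩
    · exact Or.inr ⟨hω, h'⟩
  refine (measureReal_mono hcov (measure_ne_top _ _)).trans ((measureReal_union_le _ _).trans ?_)
  refine (add_le_add h1 h2).trans ?_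
  rw [← mul_add, ← add_mul]
  have hnn : 0 ≤ (∑ j ∈ Finset.range (h + 1), ((n : ℝ) * q) ^ j / j.factorial) ^ m +
      ((m * h : ℕ) : ℝ) * (n * β) * ((((m * h : ℕ) : ℝ) + 1) * (n * (m * q)) ^ (m * h)) := by
    positivity
  calc _ ≤ 1 * (((∑ j ∈ Finset.range (h + 1), ((n : ℝ) * q) ^ j / j.factorial) ^ m +
      ((m * h : ℕ) : ℝ) * (n * β) * ((((m * h : ℕ) : ℝ) + 1) * (n * (m * q)) ^ (m * h))) *
        F ^ (n - m - m * h)) := by gcongr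
    _ ≤ _ := by rw [one_mul]; gcongr

end Moments

section MomentLimit

variable {l : Filter ℕ}

lemma tendsto_choose_sub_div_pow (d m : ℕ) :
    Tendsto (fun n : ℕ => ((n - d).choose m : ℝ) / (n : ℝ) ^ m) atTop (𝓝 (1 / m.factorial)) := by
  have h1 : Tendsto (fun n : ℕ => (n.choose m : ℝ) / (n : ℝ) ^ m) atTop (𝓝 (1 / m.factorial)) := by
    have h2 := (isEquivalent_choose m).div
      (Asymptotics.IsEquivalent.refl (u := fun n : ℕ => (n : ℝ) ^ m) (l := atTop))
    refine (h2.symm.tendsto_nhds_iff).mp ?_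
    refine tendsto_const_nhds.congr' ?_
    filter_upwards [eventually_gt_atTop 0] with n hn
    have : (n : ℝ) ≠ 0 := by positivity
    simp only [Pi.div_apply]
    field_simp
  have h3 : Tendsto (fun n : ℕ => ((n - d : ℕ) : ℝ) / n) atTop (𝓝 1) := by
    have h4 : Tendsto (fun n : ℕ => 1 - (d : ℝ) / n) atTop (𝓝 (1 - 0)) :=
      tendsto_const_nhds.sub (tendsto_const_div_atTop_nhds_zero_nat _)
    rw [sub_zero] at h4
    refine h4.congr' ?_
    filter_upwards [eventually_gt_atTop d] with n hn
    have : (n : ℝ) ≠ 0 := by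
      have : n ≠ 0 := by omega
      exact_mod_cast this
    rw [Nat.cast_sub hn.le]
    field_simp
  have h5 := (h1.comp (tendsto_sub_atTop_nat d)).mul (h3.pow m)
  rw [one_pow, mul_one] at h5
  refine h5.congr' ?_
  filter_upwards [eventually_gt_atTop d] with n hn
  have h6 : ((n - d : ℕ) : ℝ) ≠ 0 := by
    have : n - d ≠ 0 := by omega
    exact_mod_cast this
  simp only [Function.comp, div_pow]
  field_simp

/-- If all terms of a sum over the `m`-subsets of `Fin n` are asymptotic to `c / n ^ m`, the sum
tends to `c / m!`. -/
lemma tendsto_sum_powersetCard (hl : l ≤ atTop) (m : ℕ) {f : ∀ n, Finset (Fin n) → ℝ}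
    {lo hi : ℕ → ℝ} {c : ℝ}
    (hlo : ∀ᶠ n in l, ∀ A : Finset (Fin n), A.card = m → lo n ≤ f n A)
    (hhi : ∀ᶠ n in l, ∀ A : Finset (Fin n), A.card = m → f n A ≤ hi n)
    (hlo' : Tendsto (fun n : ℕ => (n : ℝ) ^ m * lo n) l (𝓝 c))
    (hhi' : Tendsto (fun n : ℕ => (n : ℝ) ^ m * hi n) l (𝓝 c)) :
    Tendsto (fun n => ∑ A ∈ Finset.powersetCard m Finset.univ, f n A) l
      (𝓝 (c / m.factorial)) := by
  have hch : Tendsto (fun n : ℕ => (n.choose m : ℝ) / (n : ℝ) ^ m) l (𝓝 (1 / m.factorial)) := by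
    simpa using (tendsto_choose_sub_div_pow 0 m).mono_left hl
  have hpos : ∀ᶠ n : ℕ in l, 0 < n := hl (eventually_gt_atTop 0)
  have key : ∀ g : ℕ → ℝ, Tendsto (fun n : ℕ => (n : ℝ) ^ m * g n) l (𝓝 c) →
      Tendsto (fun n => (n.choose m : ℝ) * g n) l (𝓝 (c / m.factorial)) := by
    intro g hg
    have h1 := hch.mul hg
    rw [one_div_mul_eq_div] at h1
    refine h1.congr' ?_
    filter_upwards [hpos] with n hn
    have : (n : ℝ) ≠ 0 := by positivity
    field_simp
  refine tendsto_of_tendsto_of_tendsto_of_le_of_le' (key lo hlo') (key hi hhi') ?_ ?_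
  · filter_upwards [hlo] with n hn
    have := Finset.card_nsmul_le_sum (Finset.powersetCard m (Finset.univ : Finset (Fin n))) (f n) (lo n)
      fun A hA => hn A (Finset.mem_powersetCard.mp hA).2
    simpa using this
  · filter_upwards [hhi] with n hn
    have := Finset.sum_le_card_nsmul (Finset.powersetCard m (Finset.univ : Finset (Fin n))) (f n) (hi n)
      fun A hA => hn A (Finset.mem_powersetCard.mp hA).2
    simpa using this

end MomentLimit

section Independent

variable {V : Type*} [Fintype V] [DecidableEq V] {K P : ℕ}

/-- The event that no two vertices of `A` are adjacent. -/
def independentOn (A : Finset V) : Set (Sample V K P) :=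
  {ω | ∀ v ∈ A, ∀ w ∈ A, ¬ (sampleGraph ω).Adj v w}

lemma dependsOnlyOn_independentOn (A : Finset V) :
    DependsOnlyOn (fun ω : Sample V K P => ω ∈ independentOn A) A := by
  intro u hu ω ω'
  simp only [independentOn, Set.mem_ofPred_eq, eq_iff_iff]
  refine forall₂_congr fun v hv => forall₂_congr fun w hw => ?_
  rw [resample_adj (ne_of_mem_of_not_mem hv hu) (ne_of_mem_of_not_mem hw hu)]

end Independent

section MomentLimit

variable {l : Filter ℕ} {K P : ℕ → ℕ} {p : ℕ → unitInterval}
  [∀ n, Nonempty (KeyRing (K n) (P n))]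

/-- Convergence of the `m`-th binomial moment of the number of vertices of degree at most `h`.
On the event `D n A`, an outside vertex is adjacent to two vertices of `A` with conditional
probability at most `β n = o(1 / n)`. The complement of `D n A` need not have probability
`o(n ^ (-m))`; it suffices that its intersection with `lowDegree` does. -/
lemma tendsto_sum_lowDegree (hl : l ≤ atTop) (h : ℕ) {m : ℕ} (hm : 1 ≤ m) {c : ℝ}
    (hx : Tendsto (fun n : ℕ => n * edgeProb (K n) (P n) (p n)) l atTop)
    (hc : Tendsto (fun n : ℕ => n * (n * edgeProb (K n) (P n) (p n)) ^ h *
      Real.exp (-(n * edgeProb (K n) (P n) (p n)))) l (𝓝 c))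
    (hxq : Tendsto (fun n : ℕ => n * edgeProb (K n) (P n) (p n) * edgeProb (K n) (P n) (p n)) l
      (𝓝 0))
    {D : ∀ n, Finset (Fin n) → Set (Sample (Fin n) (K n) (P n))}
    (hD : ∀ n A, DependsOnlyOn (fun ω => ω ∈ D n A) A) {β ε η : ℕ → ℝ} (hβ0 : ∀ n, 0 ≤ β n)
    (hβ : ∀ᶠ n in l, ∀ A : Finset (Fin n), A.card = m → ∀ ω ∈ D n A, ∀ u ∉ A,
      typeProb (p n) ω A u {B | 2 ≤ B.card} ≤ β n)
    (hnβ : Tendsto (fun n : ℕ => n * β n) l (𝓝 0))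
    (hε : ∀ᶠ n in l, ∀ A : Finset (Fin n), A.card = m →
      (sampleLaw (Fin n) (K n) (P n) (p n)).real ((D n A)ᶜ ∩ lowDegree (K n) (P n) h A) ≤ ε n)
    (hnε : Tendsto (fun n : ℕ => (n : ℝ) ^ m * ε n) l (𝓝 0))
    (hη : ∀ᶠ n in l, ∀ A : Finset (Fin n), A.card = m →
      1 - η n ≤ (sampleLaw (Fin n) (K n) (P n) (p n)).real (D n A ∩ independentOn A))
    (hη0 : Tendsto η l (𝓝 0)) :
    Tendsto (fun n => ∑ A ∈ Finset.powersetCard m (Finset.univ : Finset (Fin n)),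
      (sampleLaw (Fin n) (K n) (P n) (p n)).real (lowDegree (K n) (P n) h A)) l
      (𝓝 ((c / h.factorial) ^ m / m.factorial)) := by
  set q : ℕ → ℝ := fun n => edgeProb (K n) (P n) (p n) with hq
  have hq0 : ∀ n, 0 ≤ q n := fun n => edgeProb_nonneg
  have hq_def : ∀ n, edgeProb (K n) (P n) (p n) = q n := fun n => rfl
  simp only [hq_def] at hx hc hxq
  have hqlim : Tendsto q l (𝓝 0) := by
    refine squeeze_zero' (.of_forall hq0) ?_ hxq
    filter_upwards [hx.eventually_ge_atTop 1] with n hn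
    exact le_mul_of_one_le_left (hq0 n) hn
  have hpos : ∀ᶠ n : ℕ in l, 0 < n := hl (eventually_gt_atTop 0)
  have hβq : ∀ᶠ n in l, β n ≤ q n := by
    filter_upwards [hpos, hx.eventually_ge_atTop 1, hnβ.eventually_le_const zero_lt_one]
      with n hn h1 h2
    exact le_of_mul_le_mul_left (h2.trans h1) (by exact_mod_cast hn)
  refine tendsto_sum_powersetCard hl m
    (lo := fun n => (1 - η n) * (((n - m - m * h).choose h : ℝ) ^ m * (q n - β n) ^ (m * h) *
      Real.exp (-(m * q n) - (m * q n) ^ 2) ^ n))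
    (hi := fun n => ((∑ j ∈ Finset.range (h + 1), (n * q n) ^ j / j.factorial) ^ m +
        (m * h : ℕ) * (n * β n) * (((m * h : ℕ) + 1) * (n * (m * q n)) ^ (m * h))) *
        (Real.exp (-(n * q n)) ^ m *
          Real.exp (m * (n * β n) + m * (m + m * h : ℕ) * q n)) + ε n) ?_ ?_ ?_ ?_
  · have hmq : Tendsto (fun n => m * q n) l (𝓝 0) := by simpa using hqlim.const_mul (m : ℝ)
    filter_upwards [hβ, hη, hβq, hmq.eventually_le_const (show (0 : ℝ) < 1 / 2 by norm_num)]
      with n h1 h2 h3 h4 A hA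
    have h5 := le_sampleLaw_real_lowDegree (p := p n) h (A := A) (D := D n A ∩ independentOn A)
      ((hD n A).inter (dependsOnlyOn_independentOn A)) (b := β n) (fun ω hω => hω.2)
      (fun ω hω => h1 A hA ω hω.1) h3 (by rw [hA, hq_def]; linarith)
    rw [hA, Fintype.card_fin, hq_def] at h5
    refine le_trans ?_ h5
    have h6 : 0 ≤ q n - β n := sub_nonneg.mpr h3
    have h7 := exp_neg_sub_sq_le (mul_nonneg (Nat.cast_nonneg m) (hq0 n)) h4
    have h8 : 0 ≤ 1 - m * q n := by linarith
    refine mul_le_mul (h2 A hA) ?_ (by positivity) measureReal_nonneg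
    gcongr
  · filter_upwards [hβ, hε, hβq, hx.eventually_ge_atTop 1] with n h1 h2 h3 h4 A hA
    have h5 := sampleLaw_real_inter_lowDegree_le (p := p n) h (hD n A) (hβ0 n) h3 (h1 A hA) (by
      rw [hA, hq_def, Fintype.card_fin]
      have : (1 : ℝ) ≤ m := by exact_mod_cast hm
      calc (1 : ℝ) ≤ n * q n := h4
        _ = 1 * (n * q n) := (one_mul _).symm
        _ ≤ m * (n * q n) := by gcongr
        _ = _ := by ring)
    rw [hA, Fintype.card_fin, hq_def] at h5
    have h6 : lowDegree (K n) (P n) h A ⊆ (D n A ∩ lowDegree (K n) (P n) h A) ∪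
        ((D n A)ᶜ ∩ lowDegree (K n) (P n) h A) := by
      rw [← Set.union_inter_distrib_right, Set.union_compl_self, Set.univ_inter]
    exact (measureReal_mono h6 (measure_ne_top _ _)).trans
      ((measureReal_union_le _ _).trans (add_le_add h5 (h2 A hA)))
  · have h1 : Tendsto (fun n : ℕ => ((n - (m + m * h)).choose h : ℝ) / (n : ℝ) ^ h *
        (1 - n * β n / (n * q n)) ^ h * (n * (n * q n) ^ h * Real.exp (-(n * q n)))) l
        (𝓝 (1 / h.factorial * (1 - 0) ^ h * c)) :=
      (((tendsto_choose_sub_div_pow (m + m * h) h).mono_left hl).mul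
        ((tendsto_const_nhds.sub (hnβ.div_atTop hx)).pow h)).mul hc
    have h2 : Tendsto (fun n : ℕ => (1 - η n) * (((n - (m + m * h)).choose h : ℝ) / (n : ℝ) ^ h *
        (1 - n * β n / (n * q n)) ^ h * (n * (n * q n) ^ h * Real.exp (-(n * q n)))) ^ m *
        Real.exp (-(m ^ 2 * (n * q n * q n)))) l
        (𝓝 ((1 - 0) * (1 / h.factorial * (1 - 0) ^ h * c) ^ m * Real.exp (-(m ^ 2 * 0)))) :=
      ((tendsto_const_nhds.sub hη0).mul (h1.pow m)).mul
        ((Real.continuous_exp.tendsto _).comp (hxq.const_mul _).neg)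
    have h3 : (1 - 0) * (1 / (h.factorial : ℝ) * (1 - 0) ^ h * c) ^ m * Real.exp (-(m ^ 2 * 0)) =
        (c / h.factorial) ^ m := by simp [div_eq_inv_mul]
    rw [h3] at h2
    refine h2.congr' ?_
    filter_upwards [hpos, hx.eventually_gt_atTop 0] with n hn hxn
    have hn' : (n : ℝ) ≠ 0 := by positivity
    have hq' : q n ≠ 0 := fun h0 => by simp [h0] at hxn
    have h4 : Real.exp (-(m * q n) - (m * q n) ^ 2) ^ n =
        Real.exp (-(n * q n)) ^ m * Real.exp (-(m ^ 2 * (n * q n * q n))) := by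
      rw [← Real.exp_nat_mul, ← Real.exp_nat_mul, ← Real.exp_add]
      congr 1
      ring
    have h5 : (1 - n * β n / (n * q n)) ^ h * (n * q n) ^ h = (n : ℝ) ^ h * (q n - β n) ^ h := by
      rw [← mul_pow, ← mul_pow]
      congr 1
      field_simp
    have h6 : ((n - (m + m * h)).choose h : ℝ) / (n : ℝ) ^ h *
        (1 - n * β n / (n * q n)) ^ h * (n * (n * q n) ^ h * Real.exp (-(n * q n))) =
        n * ((n - m - m * h).choose h : ℝ) * (q n - β n) ^ h * Real.exp (-(n * q n)) := by
      calc _ = ((n - (m + m * h)).choose h : ℝ) / (n : ℝ) ^ h *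
            ((1 - n * β n / (n * q n)) ^ h * (n * q n) ^ h) * (n * Real.exp (-(n * q n))) := by ring
        _ = _ := by
          rw [h5, Nat.sub_sub]
          field_simp
    rw [h6, h4, mul_comm m h, pow_mul]
    ring
  · have hQ : Tendsto (fun n : ℕ => ∑ j ∈ Finset.range (h + 1),
        n * (n * q n) ^ j * Real.exp (-(n * q n)) / j.factorial) l (𝓝 (c / h.factorial)) := by
      have h1 : ∑ j ∈ Finset.range (h + 1), (if j = h then c else 0) / (j.factorial : ℝ) =
          c / h.factorial := by
        rw [Finset.sum_eq_single h]
        · simp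
        · intro j _ hj; simp [hj]
        · intro hh; simp at hh
      rw [← h1]
      refine tendsto_finsetSum _ fun j hj => Tendsto.div_const ?_ _
      -- Only the top term `j = h` of the truncated exponential survives.
      split_ifs with hjh
      · subst hjh; exact hc
      · have hlt : j < h := lt_of_le_of_ne (Nat.lt_succ_iff.mp (Finset.mem_range.mp hj)) hjh
        have h2 := hc.div_atTop ((tendsto_pow_atTop (Nat.sub_ne_zero_of_lt hlt)).comp hx)
        refine h2.congr' ?_
        filter_upwards [hx.eventually_gt_atTop 0] with n hn
        have hn' : (n * q n) ≠ 0 := hn.ne'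
        simp only [Function.comp]
        rw [div_eq_iff (pow_ne_zero _ hn')]
        conv_lhs => rw [← Nat.add_sub_cancel' hlt.le, pow_add]
        ring
    have h2 : Tendsto (fun n : ℕ => ((∑ j ∈ Finset.range (h + 1),
        n * (n * q n) ^ j * Real.exp (-(n * q n)) / j.factorial) ^ m +
        (m * h : ℕ) * (n * β n) * ((((m * h : ℕ) : ℝ) + 1) * (m : ℝ) ^ (m * h) *
          (n * (n * q n) ^ h * Real.exp (-(n * q n))) ^ m)) *
        Real.exp (m * (n * β n) + m * (m + m * h : ℕ) * q n) + (n : ℝ) ^ m * ε n) l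
        (𝓝 (((c / h.factorial) ^ m + (m * h : ℕ) * 0 * ((((m * h : ℕ) : ℝ) + 1) * (m : ℝ) ^ (m * h) *
          c ^ m)) * Real.exp (m * 0 + m * (m + m * h : ℕ) * 0) + 0)) :=
      (((hQ.pow m).add ((hnβ.const_mul _).mul ((hc.pow m).const_mul _))).mul
        ((Real.continuous_exp.tendsto _).comp
          ((hnβ.const_mul _).add (hqlim.const_mul _)))).add hnε
    simp only [mul_zero, zero_mul, add_zero, Real.exp_zero, mul_one] at h2
    refine h2.congr fun n => ?_
    have h3 : ∑ j ∈ Finset.range (h + 1), n * (n * q n) ^ j * Real.exp (-(n * q n)) / j.factorial =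
        n * (∑ j ∈ Finset.range (h + 1), (n * q n) ^ j / j.factorial) * Real.exp (-(n * q n)) := by
      rw [Finset.mul_sum, Finset.sum_mul]
      exact Finset.sum_congr rfl fun j _ => by ring
    have h4 : ((n : ℝ) * (m * q n)) ^ (m * h) = (m : ℝ) ^ (m * h) * ((n * q n) ^ h) ^ m := by
      rw [← pow_mul, mul_comm h m, ← mul_pow]
      congr 1
      ring
    rw [h3, h4]
    ring

end MomentLimit

/-! ### Overlaps between the key rings of a set of vertices -/

section Overlap

variable {V : Type*} [Fintype V] [DecidableEq V] {K P : ℕ} {p : unitInterval}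

/-- The event that any two vertices of `A` share at most `d` keys. -/
def overlapLE (K P d : ℕ) (A : Finset V) : Set (Sample V K P) :=
  {ω | ∀ v ∈ A, ∀ w ∈ A, v ≠ w → ((ω.1 v).1 ∩ (ω.1 w).1).card ≤ d}

lemma dependsOnlyOn_overlapLE (d : ℕ) (A : Finset V) :
    DependsOnlyOn (fun ω : Sample V K P => ω ∈ overlapLE K P d A) A := by
  intro u hu ω ω'
  simp only [overlapLE, Set.mem_ofPred_eq, eq_iff_iff]
  refine forall₂_congr fun v hv => forall₂_congr fun w hw => ?_
  rw [resample_fst (ne_of_mem_of_not_mem hv hu), resample_fst (ne_of_mem_of_not_mem hw hu)]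

lemma DependsOnlyOn.compl {D : Set (Sample V K P)} {T : Finset V}
    (hD : DependsOnlyOn (fun ω => ω ∈ D) T) : DependsOnlyOn (fun ω => ω ∈ Dᶜ) T := by
  intro u hu ω ω'
  have := hD u hu ω ω'
  simp only [Set.mem_compl_iff, eq_iff_iff] at this ⊢
  rw [this]

lemma overlapLE_zero_subset (A : Finset V) :
    overlapLE K P 0 A ⊆ (independentOn A : Set (Sample V K P)) := by
  intro ω hω v hv w hw hvw
  have h1 := hω v hv w hw hvw.ne
  rw [Nat.le_zero, Finset.card_eq_zero, ← Finset.disjoint_iff_inter_eq_empty] at h1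
  exact hvw.2.1 h1

variable [Nonempty (KeyRing K P)]

/-- A union bound over the pairs of distinct elements of `A`. -/
lemma sampleLaw_real_exists_pair_le {A : Finset V} {E : V → V → Set (Sample V K P)} {b : ℝ}
    (hb : 0 ≤ b) (hE : ∀ v w, v ≠ w → (sampleLaw V K P p).real (E v w) ≤ b) :
    (sampleLaw V K P p).real {ω | ∃ v ∈ A, ∃ w ∈ A, v ≠ w ∧ ω ∈ E v w} ≤ (A.card : ℝ) ^ 2 * b := by
  calc _ ≤ (sampleLaw V K P p).real (⋃ z ∈ (A ×ˢ A).filter fun z => z.1 ≠ z.2, E z.1 z.2) := by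
        refine measureReal_mono ?_ (measure_ne_top _ _)
        rintro ω ⟨v, hv, w, hw, hvw, hω⟩
        simp only [Set.mem_iUnion]
        exact ⟨(v, w), by simp [hv, hw, hvw], hω⟩
    _ ≤ ∑ z ∈ (A ×ˢ A).filter fun z => z.1 ≠ z.2, (sampleLaw V K P p).real (E z.1 z.2) :=
        measureReal_biUnion_finset_le _ _
    _ ≤ ∑ z ∈ (A ×ˢ A).filter fun z => z.1 ≠ z.2, b :=
        Finset.sum_le_sum fun z hz => hE _ _ (Finset.mem_filter.mp hz).2
    _ ≤ _ := by
        rw [Finset.sum_const, nsmul_eq_mul]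
        gcongr
        have := Finset.card_filter_le (A ×ˢ A) fun z => z.1 ≠ z.2
        rw [Finset.card_product] at this
        rw [sq]; exact_mod_cast this

lemma sampleLaw_real_compl_overlapLE_le (hs : meetProb K P ≤ 1 / 2) (d : ℕ) (A : Finset V) :
    (sampleLaw V K P p).real (overlapLE K P d A)ᶜ ≤
      (A.card : ℝ) ^ 2 * (2 * meetProb K P) ^ (d + 1) := by
  have hs0 := meetProb_nonneg (K := K) (P := P)
  refine le_trans (measureReal_mono ?_ (measure_ne_top _ _))
    (sampleLaw_real_exists_pair_le (A := A)
      (E := fun v w => {ω | d + 1 ≤ ((ω.1 v).1 ∩ (ω.1 w).1).card}) (by positivity) fun v w hvw => ?_)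
  · intro ω hω
    simp only [overlapLE, Set.mem_compl_iff, Set.mem_ofPred_eq, not_forall, not_le] at hω
    obtain ⟨v, hv, w, hw, hvw, h⟩ := hω
    exact ⟨v, hv, w, hw, hvw, h⟩
  · refine (sampleLaw_real_overlap_le hvw _).trans ?_
    gcongr
    exact sq_div_le_meetProb hs

lemma sampleLaw_real_adj {u v : V} (huv : u ≠ v) :
    (sampleLaw V K P p).real {ω | (sampleGraph ω).Adj u v} = edgeProb K P p := by
  rw [← integral_indicator_one .of_discrete, integral_resample u]
  have hu : u ∉ ({v} : Finset V) := by simpa using huv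
  calc _ = ∫ _, edgeProb K P p ∂(sampleLaw V K P p) := by
        refine integral_congr_ae (.of_forall fun ω => ?_)
        simp only
        rw [← typeProb_mem (p := p) ω hu (Finset.mem_singleton_self v), typeProb,
          ← integral_indicator_one .of_discrete]
        refine integral_congr_ae (.of_forall fun ω' => ?_)
        simp only [nbrsIn, Finset.mem_filter, Finset.mem_singleton, Set.mem_ofPred_eq, true_and]
        rfl
    _ = _ := by simp

lemma one_sub_le_sampleLaw_real_independentOn (A : Finset V) :
    1 - (A.card : ℝ) ^ 2 * edgeProb K P p ≤ (sampleLaw V K P p).real (independentOn A) := by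
  have h1 : (sampleLaw V K P p).real (independentOn A)ᶜ ≤ (A.card : ℝ) ^ 2 * edgeProb K P p := by
    refine le_trans (measureReal_mono ?_ (measure_ne_top _ _))
      (sampleLaw_real_exists_pair_le (A := A)
        (E := fun v w => {ω | (sampleGraph ω).Adj v w}) edgeProb_nonneg fun v w hvw =>
          (sampleLaw_real_adj hvw).le)
    intro ω hω
    simp only [independentOn, Set.mem_compl_iff, Set.mem_ofPred_eq, not_forall, not_not] at hω
    obtain ⟨v, hv, w, hw, h⟩ := hω
    exact ⟨v, hv, w, hw, h.ne, h⟩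
  have h2 := probReal_compl_eq_one_sub (μ := sampleLaw V K P p) (s := independentOn A) .of_discrete
  linarith

/-- If `v` and `w` share at most `d` keys, a vertex adjacent to `v` is unlikely to be adjacent
to `w` too. -/
lemma typeProb_mem_both_le_of_overlapLE (hs : meetProb K P ≤ 1 / 2) (hK : 0 < K) {d : ℕ}
    {A T : Finset V} {ω : Sample V K P} (hω : ω ∈ overlapLE K P d A) (hTA : T ⊆ A) {u v w : V}
    (hu : u ∉ T) (hv : v ∈ T) (hw : w ∈ T) (hvw : v ≠ w) :
    typeProb p ω T u {B | v ∈ B ∧ w ∈ B} ≤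
      edgeProb K P p * (2 * d / K + 4 * edgeProb K P p) := by
  refine (typeProb_mem_both_le_of_overlap ω hu hv hw hvw
    (hω v (hTA hv) w (hTA hw) hvw)).trans ?_
  have h1 := sq_div_le_meetProb hs
  have hs0 := meetProb_nonneg (K := K) (P := P)
  have hK' : (0 : ℝ) < K := by exact_mod_cast hK
  have h2 : (K : ℝ) / P ≤ 2 * meetProb K P / K := by
    rw [le_div_iff₀ hK']
    calc (K : ℝ) / P * K = (K : ℝ) ^ 2 / P := by ring
      _ ≤ _ := h1
  have hp0 := p.2.1
  have hp1 := p.2.2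
  calc _ ≤ (p : ℝ) ^ 2 * (d * (2 * meetProb K P / K) + (2 * meetProb K P) ^ 2) := by gcongr
    _ = p * (edgeProb K P p * (2 * d / K)) + 4 * edgeProb K P p ^ 2 := by unfold edgeProb; ring
    _ ≤ 1 * (edgeProb K P p * (2 * d / K)) + 4 * edgeProb K P p ^ 2 := by
        have := edgeProb_nonneg (K := K) (P := P) (p := p)
        gcongr
    _ = _ := by ring

end Overlap

/-! ### Sparse channels and sparse key sharing -/

section Regimes

variable {l : Filter ℕ} {K P : ℕ → ℕ} {p : ℕ → unitInterval}
  [∀ n, Nonempty (KeyRing (K n) (P n))]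

/-- Convergence of the binomial moments when the channel probability is small: two edges at a
common vertex are then nearly independent whatever the key rings are. -/
lemma tendsto_sum_lowDegree_of_channel (hl : l ≤ atTop) (h : ℕ) {m : ℕ} (hm : 1 ≤ m) {c : ℝ}
    (hx : Tendsto (fun n : ℕ => n * edgeProb (K n) (P n) (p n)) l atTop)
    (hc : Tendsto (fun n : ℕ => n * (n * edgeProb (K n) (P n) (p n)) ^ h *
      Real.exp (-(n * edgeProb (K n) (P n) (p n)))) l (𝓝 c))
    (hp : Tendsto (fun n : ℕ => n * edgeProb (K n) (P n) (p n) * p n) l (𝓝 0)) :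
    Tendsto (fun n => ∑ A ∈ Finset.powersetCard m (Finset.univ : Finset (Fin n)),
      (sampleLaw (Fin n) (K n) (P n) (p n)).real (lowDegree (K n) (P n) h A)) l
      (𝓝 ((c / h.factorial) ^ m / m.factorial)) := by
  have hq0 : ∀ n, 0 ≤ edgeProb (K n) (P n) (p n) := fun n => edgeProb_nonneg
  have hqp : ∀ n, edgeProb (K n) (P n) (p n) ≤ p n := fun n =>
    mul_le_of_le_one_right (p n).2.1 meetProb_le_one
  have hxq : Tendsto (fun n : ℕ => n * edgeProb (K n) (P n) (p n) * edgeProb (K n) (P n) (p n)) l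
      (𝓝 0) := by
    refine squeeze_zero (fun n => by have := hq0 n; positivity) (fun n => ?_) hp
    have := hq0 n
    gcongr
    exact hqp n
  have hqlim : Tendsto (fun n => edgeProb (K n) (P n) (p n)) l (𝓝 0) := by
    refine squeeze_zero' (.of_forall hq0) ?_ hxq
    filter_upwards [hx.eventually_ge_atTop 1] with n hn
    exact le_mul_of_one_le_left (hq0 n) hn
  refine tendsto_sum_lowDegree hl h hm hx hc hxq (D := fun _ _ => Set.univ)
    (β := fun n => (m : ℝ) ^ 2 * (p n * edgeProb (K n) (P n) (p n))) (ε := fun _ => 0)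
    (η := fun n => (m : ℝ) ^ 2 * edgeProb (K n) (P n) (p n)) (fun n A u hu ω ω' => rfl)
    (fun n => ?_) (.of_forall fun n A hA ω _ u hu => ?_) ?_ (.of_forall fun n A hA => ?_) (by simpa using tendsto_const_nhds)
    (.of_forall fun n A hA => ?_) ?_
  · have := hq0 n
    have := (p n).2.1
    positivity
  · rw [← hA]
    exact typeProb_two_le ω (fun v hv w hw hvw => typeProb_mem_both_le ω hu hv hw hvw)
      (mul_nonneg (p n).2.1 (hq0 n))
  · have := hp.const_mul ((m : ℝ) ^ 2)
    rw [mul_zero] at this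
    exact this.congr fun n => by ring
  · simp
  · rw [Set.univ_inter, ← hA]
    exact one_sub_le_sampleLaw_real_independentOn A
  · simpa using hqlim.const_mul ((m : ℝ) ^ 2)

/-- Convergence of the binomial moments when two key rings are unlikely to meet. The sets `A` in
which some key rings overlap are treated separately: their vertices are still likely to have more
than `m * h` outer neighbours altogether. -/
lemma tendsto_sum_lowDegree_of_meet (hl : l ≤ atTop) (h : ℕ) {m : ℕ} (hm : 1 ≤ m) {c : ℝ}
    (hx : Tendsto (fun n : ℕ => n * edgeProb (K n) (P n) (p n)) l atTop)
    (hc : Tendsto (fun n : ℕ => n * (n * edgeProb (K n) (P n) (p n)) ^ h *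
      Real.exp (-(n * edgeProb (K n) (P n) (p n)))) l (𝓝 c))
    {C : ℝ} (hC : ∀ᶠ n : ℕ in l, (n : ℝ) ≤ C * Real.exp (n * edgeProb (K n) (P n) (p n)))
    (hK : Tendsto K l atTop)
    (hs : ∀ m : ℕ, Tendsto (fun n : ℕ => (n : ℝ) ^ m * meetProb (K n) (P n) ^ (m + 1)) l (𝓝 0))
    (hsx : Tendsto (fun n : ℕ => meetProb (K n) (P n) *
      Real.exp (3 / 4 * (n * edgeProb (K n) (P n) (p n)))) l (𝓝 0)) :
    Tendsto (fun n => ∑ A ∈ Finset.powersetCard m (Finset.univ : Finset (Fin n)),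
      (sampleLaw (Fin n) (K n) (P n) (p n)).real (lowDegree (K n) (P n) h A)) l
      (𝓝 ((c / h.factorial) ^ m / m.factorial)) := by
  set q : ℕ → ℝ := fun n => edgeProb (K n) (P n) (p n) with hq
  set s : ℕ → ℝ := fun n => meetProb (K n) (P n) with hsdef
  have hq_def : ∀ n, edgeProb (K n) (P n) (p n) = q n := fun n => rfl
  have hs_def : ∀ n, meetProb (K n) (P n) = s n := fun n => rfl
  simp only [hq_def, hs_def] at hx hc hC hs hsx
  have hq0 : ∀ n, 0 ≤ q n := fun n => edgeProb_nonneg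
  have hs0 : ∀ n, 0 ≤ s n := fun n => meetProb_nonneg
  have hqs : ∀ n, q n ≤ s n := fun n => mul_le_of_le_one_left (hs0 n) (p n).2.2
  have hslim : Tendsto s l (𝓝 0) := by simpa using hs 0
  have hqlim : Tendsto q l (𝓝 0) := squeeze_zero hq0 hqs hslim
  have hxs : ∀ d : ℕ, Tendsto (fun n => s n * (n * q n) ^ d * Real.exp (n * q n / 4)) l (𝓝 0) := by
    intro d
    have h1 := hsx.mul ((tendsto_pow_mul_exp_neg_half d).comp hx)
    rw [mul_zero] at h1
    refine h1.congr fun n => ?_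
    simp only [Function.comp]
    have h2 : Real.exp (n * q n / 4) =
        Real.exp (3 / 4 * (n * q n)) * Real.exp (-(n * q n / 2)) := by
      rw [← Real.exp_add]; congr 1; ring
    rw [h2]
    ring
  have hxq : Tendsto (fun n : ℕ => n * q n * q n) l (𝓝 0) := by
    refine squeeze_zero (fun n => mul_nonneg (mul_nonneg (Nat.cast_nonneg n) (hq0 n)) (hq0 n))
      (fun n => ?_) (hxs 1)
    have h1 : 0 ≤ n * q n := mul_nonneg (Nat.cast_nonneg n) (hq0 n)
    have h2 : 1 ≤ Real.exp (n * q n / 4) := Real.one_le_exp (by positivity)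
    calc n * q n * q n ≤ n * q n * s n := mul_le_mul_of_nonneg_left (hqs n) h1
      _ = s n * (n * q n) ^ 1 * 1 := by ring
      _ ≤ _ := mul_le_mul_of_nonneg_left h2 (mul_nonneg (hs0 n) (pow_nonneg h1 1))
  have hs2 := hslim.eventually_le_const (show (0 : ℝ) < 1 / 2 by norm_num)
  have hKinv : Tendsto (fun n => (K n : ℝ)⁻¹) l (𝓝 0) :=
    tendsto_inv_atTop_zero.comp (tendsto_natCast_atTop_atTop.comp hK)
  set L := m * h with hL
  -- The first term bounds the overlaps of more than `m` keys; the second one is for smaller overlaps.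
  set ε : ℕ → ℝ := fun n => (m : ℝ) ^ 2 * (2 * s n) ^ (m + 1) +
    (m : ℝ) ^ 2 * (2 * s n) ^ 1 * ((L + 1) * (n * (m * q n)) ^ L *
      (Real.exp (-(n * q n)) ^ m * Real.exp (n * q n / 4 + 1))) with hεdef
  refine tendsto_sum_lowDegree hl h hm hx hc hxq (D := fun n A => overlapLE (K n) (P n) 0 A)
    (β := fun n => (m : ℝ) ^ 2 * (q n * (2 * (0 : ℕ) / K n + 4 * q n))) (ε := ε)
    (η := fun n => (m : ℝ) ^ 2 * (2 * s n) ^ 1)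
    (fun n A => dependsOnlyOn_overlapLE 0 A)
    (fun n => ?_) ?_ ?_ ?_ ?_ ?_ ?_
  · have := hq0 n
    positivity
  · filter_upwards [hs2, hK.eventually_gt_atTop 0] with n h1 h2 A hA ω hω u hu
    rw [← hA]
    refine typeProb_two_le ω (fun v hv w hw hvw =>
      typeProb_mem_both_le_of_overlapLE h1 h2 hω subset_rfl hu hv hw hvw) ?_
    have := hq0 n
    positivity
  · have h1 := hxq.const_mul (4 * (m : ℝ) ^ 2)
    rw [mul_zero] at h1
    refine h1.congr fun n => ?_
    push_cast
    ring
  · have h1 : ∀ᶠ n in l, (2 : ℝ) * m ^ 4 * (K n : ℝ)⁻¹ ≤ 1 / 4 := by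
      refine Tendsto.eventually_le_const (show (0 : ℝ) < 1 / 4 by norm_num) ?_
      simpa using hKinv.const_mul ((2 : ℝ) * m ^ 4)
    have h2 : ∀ᶠ n : ℕ in l,
        4 * (m : ℝ) ^ 3 * (n * q n * q n) + m * (m + L : ℕ) * q n ≤ 1 := by
      refine Tendsto.eventually_le_const zero_lt_one ?_
      simpa using (hxq.const_mul (4 * (m : ℝ) ^ 3)).add (hqlim.const_mul ((m : ℝ) * (m + L : ℕ)))
    have h3 : ∀ᶠ n in l, (m : ℝ) ^ 2 * (2 * m * (K n : ℝ)⁻¹ + 4 * q n) ≤ 1 := by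
      refine Tendsto.eventually_le_const zero_lt_one ?_
      simpa using ((hKinv.const_mul ((2 : ℝ) * m)).add (hqlim.const_mul 4)).const_mul ((m : ℝ) ^ 2)
    filter_upwards [h1, h2, h3, hs2, hK.eventually_gt_atTop 0, hx.eventually_ge_atTop 1]
      with n h1 h2 h3 h4 h5 h6 A hA
    have hqn := hq0 n
    -- On `D` some rings overlap, in at most `m` keys each, and `b` bounds the pair probabilities.
    set b := q n * (2 * m * (K n : ℝ)⁻¹ + 4 * q n) with hb
    have hb0 : 0 ≤ b := by positivity
    have hmb : (m : ℝ) ^ 2 * b ≤ q n := by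
      calc (m : ℝ) ^ 2 * b = q n * ((m : ℝ) ^ 2 * (2 * m * (K n : ℝ)⁻¹ + 4 * q n)) := by ring
        _ ≤ q n * 1 := by gcongr
        _ = _ := mul_one _
    set D : Set (Sample (Fin n) (K n) (P n)) :=
      overlapLE (K n) (P n) m A ∩ (overlapLE (K n) (P n) 0 A)ᶜ with hDdef
    have hD : DependsOnlyOn (fun ω => ω ∈ D) A :=
      (dependsOnlyOn_overlapLE m A).inter (dependsOnlyOn_overlapLE 0 A).compl
    set F := Real.exp (-(m * (q n - (m : ℝ) ^ 2 * b))) with hF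
    have hexp0 : 0 ≤ m * (q n - (m : ℝ) ^ 2 * b) :=
      mul_nonneg (Nat.cast_nonneg m) (sub_nonneg.mpr hmb)
    have hF1 : F ≤ 1 := Real.exp_le_one_iff.mpr (neg_nonpos.mpr hexp0)
    have hFA : ∀ ω ∈ D, ∀ u ∉ A, typeProb (p n) ω A u {∅} ≤ F := by
      intro ω hω u hu
      refine (typeProb_empty_le ω hu).trans ?_
      have h7 : typeProb (p n) ω A u {B | 2 ≤ B.card} ≤ (A.card : ℝ) ^ 2 * b :=
        typeProb_two_le ω (fun v hv w hw hvw => by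
          rw [hb, ← div_eq_mul_inv]
          exact typeProb_mem_both_le_of_overlapLE h4 h5 hω.1 subset_rfl hu hv hw hvw) hb0
      rw [hA] at h7 ⊢
      have h8 : (m : ℝ) * typeProb (p n) ω A u {B | 2 ≤ B.card} ≤ m * ((m : ℝ) ^ 2 * b) := by gcongr
      have h9 := Real.add_one_le_exp (-(m * (q n - (m : ℝ) ^ 2 * b)))
      rw [hq_def]
      linarith
    have hmq : 1 ≤ (Fintype.card (Fin n) : ℝ) * (A.card * edgeProb (K n) (P n) (p n)) := by
      rw [hA, Fintype.card_fin, hq_def]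
      have : (1 : ℝ) ≤ m := by exact_mod_cast hm
      calc (1 : ℝ) ≤ n * q n := h6
        _ = 1 * (n * q n) := (one_mul _).symm
        _ ≤ m * (n * q n) := by gcongr
        _ = _ := by ring
    have h7 := sampleLaw_real_outerNbrs_le (p := p n) L hD (Real.exp_pos _).le hF1 hFA hmq
    have hcov : (overlapLE (K n) (P n) 0 A)ᶜ ∩ lowDegree (K n) (P n) h A ⊆
        (overlapLE (K n) (P n) m A)ᶜ ∪ (D ∩ {ω | (outerNbrs ω A).card ≤ L}) := by
      rintro ω ⟨hω0, hω⟩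
      by_cases hωm : ω ∈ overlapLE (K n) (P n) m A
      · refine Or.inr ⟨⟨hωm, hω0⟩, ?_⟩
        have := outerNbrs_card_le hω
        rwa [hA] at this
      · exact Or.inl hωm
    refine (measureReal_mono hcov (measure_ne_top _ _)).trans ((measureReal_union_le _ _).trans ?_)
    refine add_le_add ?_ (h7.trans ?_)
    · have := sampleLaw_real_compl_overlapLE_le (V := Fin n) (p := p n) h4 m A
      rwa [hA] at this
    · have h8 : (sampleLaw (Fin n) (K n) (P n) (p n)).real D ≤ (m : ℝ) ^ 2 * (2 * s n) ^ 1 := by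
        have := sampleLaw_real_compl_overlapLE_le (V := Fin n) (p := p n) h4 0 A
        rw [hA] at this
        exact (measureReal_mono Set.inter_subset_right (measure_ne_top _ _)).trans this
      have h9 : F ^ (n - m - L) ≤ Real.exp (-(n * q n)) ^ m * Real.exp (n * q n / 4 + 1) := by
        rw [hF, ← Real.exp_nat_mul, ← Real.exp_nat_mul, ← Real.exp_add, Real.exp_le_exp]
        have h10 : (n : ℝ) - (m + L : ℕ) ≤ (n - m - L : ℕ) := by
          have : n ≤ (n - m - L) + (m + L) := by omega
          have : (n : ℝ) ≤ ((n - m - L : ℕ) : ℝ) + ((m + L : ℕ) : ℝ) := by exact_mod_cast this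
          linarith
        have h11 := mul_le_mul_of_nonneg_right h10 hexp0
        have h12 : 0 ≤ ((m + L : ℕ) : ℝ) * (m * ((m : ℝ) ^ 2 * b)) := by positivity
        have h13 : n * (m * ((m : ℝ) ^ 2 * b)) = (n * q n) * (2 * m ^ 4 * (K n : ℝ)⁻¹) +
          4 * m ^ 3 * (n * q n * q n) := by rw [hb]; ring
        have h14 : (n * q n) * (2 * m ^ 4 * (K n : ℝ)⁻¹) ≤ (n * q n) * (1 / 4) := by gcongr
        linarith
      rw [hA, Fintype.card_fin, hq_def]
      have hnn : (0 : ℝ) ≤ n := Nat.cast_nonneg n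
      have hsn := hs0 n
      have hF0 : 0 ≤ F := (Real.exp_pos _).le
      refine mul_le_mul h8 ?_ (by positivity) (by positivity)
      exact mul_le_mul_of_nonneg_left h9 (by positivity)
  · have h1 := ((hs m).const_mul ((m : ℝ) ^ 2 * 2 ^ (m + 1))).add ((hxs L).const_mul
      (C ^ m * ((m : ℝ) ^ 2 * 2 * (L + 1) * m ^ L * Real.exp 1)))
    simp only [mul_zero, add_zero] at h1
    refine squeeze_zero' (.of_forall fun n => ?_) ?_ h1
    · have := hq0 n
      have := hs0 n
      positivity
    · filter_upwards [hC] with n hn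
      have hsn := hs0 n
      have hqn := hq0 n
      have h2 : (n : ℝ) ^ m * Real.exp (-(n * q n)) ^ m ≤ C ^ m := by
        rw [← mul_pow]
        refine pow_le_pow_left₀ (by positivity) ?_ m
        calc n * Real.exp (-(n * q n)) ≤ C * Real.exp (n * q n) * Real.exp (-(n * q n)) := by gcongr
          _ = C := by rw [mul_assoc, ← Real.exp_add]; simp
      calc (n : ℝ) ^ m * ε n = (m : ℝ) ^ 2 * 2 ^ (m + 1) * ((n : ℝ) ^ m * s n ^ (m + 1)) +
            ((n : ℝ) ^ m * Real.exp (-(n * q n)) ^ m) * (((m : ℝ) ^ 2 * 2 * (L + 1) * m ^ L *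
              Real.exp 1) * (s n * (n * q n) ^ L * Real.exp (n * q n / 4))) := by
            simp only [hεdef]
            rw [Real.exp_add, mul_pow 2 (s n) (m + 1)]
            have : ((n : ℝ) * (m * q n)) ^ L = m ^ L * (n * q n) ^ L := by
              rw [← mul_pow]; congr 1; ring
            rw [this]
            ring
        _ ≤ (m : ℝ) ^ 2 * 2 ^ (m + 1) * ((n : ℝ) ^ m * s n ^ (m + 1)) +
            C ^ m * (((m : ℝ) ^ 2 * 2 * (L + 1) * m ^ L *
              Real.exp 1) * (s n * (n * q n) ^ L * Real.exp (n * q n / 4))) := by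
            gcongr
        _ = _ := by ring
  · filter_upwards [hs2] with n h1 A hA
    rw [Set.inter_eq_self_of_subset_left (overlapLE_zero_subset A), ← hA]
    have h2 := sampleLaw_real_compl_overlapLE_le (p := p n) h1 0 A
    have h3 := probReal_compl_eq_one_sub (μ := sampleLaw (Fin n) (K n) (P n) (p n))
      (s := overlapLE (K n) (P n) 0 A) .of_discrete
    simp only [zero_add] at h2
    linarith
  · simpa using (hslim.const_mul 2).const_mul ((m : ℝ) ^ 2)

/-- For small channel probabilities every pair satisfies the hypothesis of
`tendsto_minDegreeGE_not_isKConnected`. -/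
lemma tendsto_minDegreeGE_not_isKConnected_of_channel (k : ℕ) (hl : l ≤ atTop)
    (hx : Tendsto (fun n : ℕ => n * edgeProb (K n) (P n) (p n)) l atTop) {C : ℝ}
    (hC : ∀ᶠ n : ℕ in l, (n : ℝ) ≤ C * Real.exp (n * edgeProb (K n) (P n) (p n)))
    (hK : Tendsto K l atTop) {C' : ℝ} (hP : ∀ᶠ n : ℕ in l, (n : ℝ) ≤ C' * P n)
    (hp : ∀ᶠ n in l, (p n : ℝ) ≤ 1 / 2) :
    Tendsto (fun n => (sampleLaw (Fin n) (K n) (P n) (p n)).real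
        (minDegreeGE (Fin n) (K n) (P n) k ∩ {ω | ¬ (sampleGraph ω).IsKConnected k})) l (𝓝 0) := by
  refine tendsto_minDegreeGE_not_isKConnected k hl hx hC hK hP (fun _ _ => Set.univ)
    (fun n T u hu ω ω' => rfl) ?_ (by simpa using tendsto_const_nhds)
  filter_upwards [hp] with n hn T ω _ u hu v hv w hw hvw
  refine (typeProb_mem_both_le ω hu hv hw hvw).trans ?_
  have := mul_le_mul_of_nonneg_right hn (edgeProb_nonneg (K := K n) (P := P n) (p := p n))
  linarith

/-- If rings rarely meet, then with high probability no two of them share more than two keys. -/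
lemma tendsto_minDegreeGE_not_isKConnected_of_meet (k : ℕ) (hl : l ≤ atTop)
    (hx : Tendsto (fun n : ℕ => n * edgeProb (K n) (P n) (p n)) l atTop) {C : ℝ}
    (hC : ∀ᶠ n : ℕ in l, (n : ℝ) ≤ C * Real.exp (n * edgeProb (K n) (P n) (p n)))
    (hK : Tendsto K l atTop) {C' : ℝ} (hP : ∀ᶠ n : ℕ in l, (n : ℝ) ≤ C' * P n)
    (hs0 : Tendsto (fun n : ℕ => meetProb (K n) (P n)) l (𝓝 0))
    (hs2 : Tendsto (fun n : ℕ => (n : ℝ) ^ 2 * meetProb (K n) (P n) ^ 3) l (𝓝 0)) :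
    Tendsto (fun n => (sampleLaw (Fin n) (K n) (P n) (p n)).real
        (minDegreeGE (Fin n) (K n) (P n) k ∩ {ω | ¬ (sampleGraph ω).IsKConnected k})) l (𝓝 0) := by
  have hs := hs0.eventually_le_const (show (0 : ℝ) < 1 / 2 by norm_num)
  refine tendsto_minDegreeGE_not_isKConnected k hl hx hC hK hP
    (fun n T => overlapLE (K n) (P n) 2 T) (fun n T => dependsOnlyOn_overlapLE 2 T) ?_ ?_
  · have hKinv : Tendsto (fun n => (K n : ℝ)⁻¹) l (𝓝 0) :=
      tendsto_inv_atTop_zero.comp (tendsto_natCast_atTop_atTop.comp hK)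
    have h1 : ∀ᶠ n in l, 4 * (K n : ℝ)⁻¹ + 4 * meetProb (K n) (P n) ≤ 1 / 2 := by
      refine Tendsto.eventually_le_const (show (0 : ℝ) < 1 / 2 by norm_num) ?_
      simpa using (hKinv.const_mul 4).add (hs0.const_mul 4)
    filter_upwards [hs, hK.eventually_gt_atTop 0, h1] with n h1 h2 h3 T ω hω u hu v hv w hw hvw
    refine (typeProb_mem_both_le_of_overlapLE h1 h2 hω subset_rfl hu hv hw hvw).trans ?_
    have hq := edgeProb_nonneg (K := K n) (P := P n) (p := p n)
    have hqs : edgeProb (K n) (P n) (p n) ≤ meetProb (K n) (P n) :=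
      mul_le_of_le_one_left meetProb_nonneg (p n).2.2
    rw [div_eq_mul_inv, div_eq_mul_inv]
    refine mul_le_mul_of_nonneg_left ?_ hq
    push_cast
    linarith
  · have h1 := hs2.const_mul 8
    rw [mul_zero] at h1
    refine squeeze_zero' (.of_forall fun n => measureReal_nonneg) ?_ h1
    filter_upwards [hs] with n hn
    refine le_trans (measureReal_mono ?_ (measure_ne_top _ _))
      ((sampleLaw_real_compl_overlapLE_le hn 2 (Finset.univ : Finset (Fin n))).trans (le_of_eq ?_))
    · rintro ω ⟨T, hT⟩ hω
      exact hT fun v _ w _ hvw => hω v (Finset.mem_univ v) w (Finset.mem_univ w) hvw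
    · rw [Finset.card_univ, Fintype.card_fin]
      ring

end Regimes

/-! ### The limit probability of `k`-connectivity -/

section Limit

variable {l : Filter ℕ} {K P : ℕ → ℕ} {p : ℕ → unitInterval}
  [∀ n, Nonempty (KeyRing (K n) (P n))]

/-- A graph which is `(h + 1)`-connected has minimum degree at least `h + 1`, and the converse
fails with probability tending to zero. -/
lemma tendsto_isKConnected_of_moments (h : ℕ) {c : ℝ}
    (hmom : ∀ m, 1 ≤ m →
      Tendsto (fun n => ∑ A ∈ Finset.powersetCard m (Finset.univ : Finset (Fin n)),
        (sampleLaw (Fin n) (K n) (P n) (p n)).real (lowDegree (K n) (P n) h A)) l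
        (𝓝 ((c / h.factorial) ^ m / m.factorial)))
    (hcon : Tendsto (fun n => (sampleLaw (Fin n) (K n) (P n) (p n)).real
        (minDegreeGE (Fin n) (K n) (P n) (h + 1) ∩ {ω | ¬ (sampleGraph ω).IsKConnected (h + 1)}))
        l (𝓝 0)) :
    Tendsto (fun n => (sampleLaw (Fin n) (K n) (P n) (p n)).real
      {ω | (sampleGraph ω).IsKConnected (h + 1)}) l (𝓝 (Real.exp (-(c / h.factorial)))) := by
  have hdeg : Tendsto (fun n => (sampleLaw (Fin n) (K n) (P n) (p n)).real
      (minDegreeGE (Fin n) (K n) (P n) (h + 1))) l (𝓝 (Real.exp (-(c / h.factorial)))) := by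
    refine tendsto_exp_neg_of_bonferroni
      (M := fun m n => ∑ A ∈ Finset.powersetCard m (Finset.univ : Finset (Fin n)),
        (sampleLaw (Fin n) (K n) (P n) (p n)).real (lowDegree (K n) (P n) h A))
      (.of_forall fun n J hJ => abs_real_minDegreeGE_sub_le h J hJ) fun m => ?_
    rcases Nat.eq_zero_or_pos m with rfl | hm
    · have : ∀ n, lowDegree (V := Fin n) (K n) (P n) h ∅ = Set.univ := fun n => by
        simp [lowDegree]
      simpa [this] using tendsto_const_nhds
    · exact hmom m hm
  have h1 := hdeg.sub hcon
  rw [sub_zero] at h1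
  refine h1.congr fun n => ?_
  have h2 : {ω : Sample (Fin n) (K n) (P n) | (sampleGraph ω).IsKConnected (h + 1)} =
      minDegreeGE (Fin n) (K n) (P n) (h + 1) \
        {ω | ¬ (sampleGraph ω).IsKConnected (h + 1)} := by
    ext ω
    simp only [Set.mem_sdiff, Set.mem_ofPred_eq, not_not, minDegreeGE]
    exact ⟨fun hω => ⟨fun v => le_card_neighbors_of_isKConnected hω v, hω⟩, fun hω => hω.2⟩
  rw [h2, ← measureReal_inter_add_sdiff (μ := sampleLaw (Fin n) (K n) (P n) (p n))
    (s := minDegreeGE (Fin n) (K n) (P n) (h + 1))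
    (t := {ω | ¬ (sampleGraph ω).IsKConnected (h + 1)}) .of_discrete]
  ring

/-- The limit law in terms of the expected degree `n * edgeProb`. The indices are split according
to the size of the channel probability. -/
lemma tendsto_isKConnected (h : ℕ) {a : ℕ → ℝ} {a₀ : ℝ} (ha : Tendsto a atTop (𝓝 a₀))
    (hxa : ∀ᶠ n : ℕ in atTop, n * edgeProb (K n) (P n) (p n) =
      Real.log n + h * Real.log (Real.log n) + a n)
    {C' : ℝ} (hC' : 0 < C') (hP : ∀ᶠ n : ℕ in atTop, (n : ℝ) ≤ C' * P n) :
    Tendsto (fun n => (sampleLaw (Fin n) (K n) (P n) (p n)).real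
      {ω | (sampleGraph ω).IsKConnected (h + 1)}) atTop
      (𝓝 (Real.exp (-(Real.exp (-a₀) / h.factorial)))) := by
  set x : ℕ → ℝ := fun n => n * edgeProb (K n) (P n) (p n) with hxdef
  set u : ℕ → ℝ := fun n => Real.log n with hudef
  have hu : Tendsto u atTop atTop := Real.tendsto_log_atTop.comp tendsto_natCast_atTop_atTop
  have hexpu : ∀ᶠ n : ℕ in atTop, Real.exp (u n) = n := by
    filter_upwards [eventually_gt_atTop 0] with n hn
    exact Real.exp_log (by exact_mod_cast hn)
  change ∀ᶠ n in atTop, x n = u n + h * Real.log (u n) + a n at hxa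
  have hx0 : ∀ n, 0 ≤ x n := fun n => mul_nonneg (Nat.cast_nonneg n) edgeProb_nonneg
  have hxu : Tendsto (fun n => x n / u n) atTop (𝓝 1) := by
    have h1 : Tendsto (fun n => Real.log (u n) / u n) atTop (𝓝 0) :=
      Real.isLittleO_log_id_atTop.tendsto_div_nhds_zero.comp hu
    have h2 := (tendsto_const_nhds (x := (1 : ℝ)).add (h1.const_mul (h : ℝ))).add (ha.div_atTop hu)
    simp only [mul_zero, add_zero] at h2
    refine h2.congr' ?_
    filter_upwards [hxa, hu.eventually_gt_atTop 0] with n h3 h4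
    rw [h3]
    have : u n ≠ 0 := h4.ne'
    field_simp
  have hx : Tendsto x atTop atTop := by
    have h1 := (hxu.pos_mul_atTop one_pos hu)
    refine h1.congr' ?_
    filter_upwards [hu.eventually_gt_atTop 0] with n h4
    exact div_mul_cancel₀ _ h4.ne'
  have hexpx : ∀ᶠ n : ℕ in atTop, Real.exp (x n) = n * u n ^ h * Real.exp (a n) := by
    filter_upwards [hxa, hexpu, hu.eventually_gt_atTop 0] with n h1 h2 h3
    have h4 : Real.exp (h * Real.log (u n)) = u n ^ h := by
      rw [Real.exp_nat_mul, Real.exp_log h3]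
    rw [h1, Real.exp_add, Real.exp_add, h4, h2]
  have hc : Tendsto (fun n : ℕ => n * x n ^ h * Real.exp (-x n)) atTop (𝓝 (Real.exp (-a₀))) := by
    have h1 := (hxu.pow h).mul ((Real.continuous_exp.tendsto _).comp ha.neg)
    rw [one_pow, one_mul] at h1
    refine h1.congr' ?_
    filter_upwards [hexpx, hu.eventually_gt_atTop 0, eventually_gt_atTop 0] with n h2 h3 h4
    have h5 : (n : ℝ) ≠ 0 := by positivity
    rw [Real.exp_neg (x n), h2]
    simp only [Function.comp, Real.exp_neg, div_pow]
    field_simp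
  have hC : ∀ᶠ n : ℕ in atTop, (n : ℝ) ≤ Real.exp (1 - a₀) * Real.exp (x n) := by
    filter_upwards [hexpx, hu.eventually_ge_atTop 1,
      ha.eventually_const_le (show a₀ - 1 < a₀ by linarith)] with n h1 h2 h3
    have h4 : 1 ≤ Real.exp (1 - a₀) * Real.exp (a n) := by
      rw [← Real.exp_add]
      exact Real.one_le_exp (by linarith)
    have h5 : 1 ≤ u n ^ h := one_le_pow₀ h2
    rw [h1]
    calc (n : ℝ) = n * (1 * 1) := by ring
      _ ≤ n * (u n ^ h * (Real.exp (1 - a₀) * Real.exp (a n))) := by gcongr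
      _ = _ := by ring
  -- The rings grow because `x n ≤ n * (K n ^ 2 / P n) ≤ C' * K n ^ 2`.
  have hK : Tendsto K atTop atTop := by
    refine tendsto_atTop.mpr fun b => ?_
    filter_upwards [hP, hx.eventually_gt_atTop (C' * (b : ℝ) ^ 2)] with n h1 h2
    have h3 : x n ≤ C' * (K n : ℝ) ^ 2 := by
      have h4 : edgeProb (K n) (P n) (p n) ≤ (K n : ℝ) ^ 2 / P n :=
        (mul_le_of_le_one_left meetProb_nonneg (p n).2.2).trans meetProb_le
      calc x n ≤ n * ((K n : ℝ) ^ 2 / P n) := by simp only [hxdef]; gcongr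
        _ ≤ C' * P n * ((K n : ℝ) ^ 2 / P n) := by gcongr
        _ = C' * (K n : ℝ) ^ 2 * (P n / P n) := by ring
        _ ≤ C' * (K n : ℝ) ^ 2 * 1 := by gcongr; exact div_self_le_one _
        _ = _ := mul_one _
    have h4 := lt_of_mul_lt_mul_left (h2.trans_le h3) hC'.le
    have h5 := lt_of_pow_lt_pow_left₀ 2 (Nat.cast_nonneg _) h4
    exact (Nat.cast_lt.mp h5).le
  have hx2 : ∀ᶠ n in atTop, x n ≤ 7 / 6 * u n := by
    filter_upwards [hxu.eventually_le_const (show (1 : ℝ) < 7 / 6 by norm_num),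
      hu.eventually_gt_atTop 0] with n h1 h2
    exact (div_le_iff₀ h2).mp h1
  -- On `B` the channels are sparse enough that `x n * p n → 0`; off `B` the rings rarely meet.
  set B : Set ℕ := {n | (p n : ℝ) ≤ 1 / u n ^ 2} with hB
  have hsplit : (atTop : Filter ℕ) = atTop ⊓ 𝓟 B ⊔ atTop ⊓ 𝓟 Bᶜ := by
    rw [← inf_sup_left, sup_principal, Set.union_compl_self, principal_univ, inf_top_eq]
  rw [hsplit]
  refine Tendsto.sup ?_ ?_
  · have hl : atTop ⊓ 𝓟 B ≤ atTop := inf_le_left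
    have hp : Tendsto (fun n => x n * p n) (atTop ⊓ 𝓟 B) (𝓝 0) := by
      have h1 : Tendsto (fun n => 7 / 6 * (u n)⁻¹) (atTop ⊓ 𝓟 B) (𝓝 0) := by
        simpa using (tendsto_inv_atTop_zero.comp (hu.mono_left hl)).const_mul (7 / 6 : ℝ)
      refine squeeze_zero' (.of_forall fun n => mul_nonneg (hx0 n) (p n).2.1) ?_ h1
      filter_upwards [hl hx2, hl (hu.eventually_gt_atTop 0), mem_inf_of_right (mem_principal_self B)]
        with n h2 h3 h4
      calc x n * p n ≤ 7 / 6 * u n * (1 / u n ^ 2) := by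
            have := (p n).2.1
            gcongr
            exact h4
        _ = 7 / 6 * (u n)⁻¹ := by field_simp
    refine tendsto_isKConnected_of_moments h
      (fun m hm => tendsto_sum_lowDegree_of_channel hl h hm (hx.mono_left hl) (hc.mono_left hl) hp)
      (tendsto_minDegreeGE_not_isKConnected_of_channel _ hl (hx.mono_left hl) (hl hC)
        (hK.mono_left hl) (hl hP) ?_)
    filter_upwards [hl (hx.eventually_ge_atTop 1),
      hp.eventually_le_const (show (0 : ℝ) < 1 / 2 by norm_num)] with n h1 h2
    exact (le_mul_of_one_le_left (p n).2.1 h1).trans h2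
  · have hl : atTop ⊓ 𝓟 Bᶜ ≤ atTop := inf_le_left
    have hs : ∀ᶠ n in atTop ⊓ 𝓟 Bᶜ,
        meetProb (K n) (P n) ≤ 7 / 6 * u n ^ 3 * Real.exp (-u n) := by
      filter_upwards [hl hx2, hl (hu.eventually_gt_atTop 0), hl hexpu,
        hl (eventually_gt_atTop 0), mem_inf_of_right (mem_principal_self Bᶜ)] with n h1 h2 h3 h4 h5
      have h6 : 1 / u n ^ 2 < p n := not_le.mp h5
      have hn : (0 : ℝ) < n := by exact_mod_cast h4
      have hs0 := meetProb_nonneg (K := K n) (P := P n)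
      rw [Real.exp_neg, h3, ← div_eq_mul_inv, le_div_iff₀ hn]
      have h7 : n * (1 / u n ^ 2 * meetProb (K n) (P n)) ≤ 7 / 6 * u n := by
        refine le_trans ?_ h1
        simp only [hxdef, edgeProb]
        gcongr
      calc meetProb (K n) (P n) * n = u n ^ 2 * (n * (1 / u n ^ 2 * meetProb (K n) (P n))) := by
            field_simp
        _ ≤ u n ^ 2 * (7 / 6 * u n) := by gcongr
        _ = _ := by ring
    have hmom : ∀ m : ℕ, Tendsto (fun n : ℕ => (n : ℝ) ^ m * meetProb (K n) (P n) ^ (m + 1))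
        (atTop ⊓ 𝓟 Bᶜ) (𝓝 0) := by
      intro m
      have h1 := (((Real.tendsto_pow_mul_exp_neg_atTop_nhds_zero (3 * (m + 1))).comp
        (hu.mono_left hl)).const_mul ((7 / 6 : ℝ) ^ (m + 1)))
      rw [mul_zero] at h1
      refine squeeze_zero' (.of_forall fun n => by
        have := meetProb_nonneg (K := K n) (P := P n)
        positivity) ?_ h1
      filter_upwards [hs, hl hexpu] with n h2 h3
      have hs0 := meetProb_nonneg (K := K n) (P := P n)
      calc (n : ℝ) ^ m * meetProb (K n) (P n) ^ (m + 1)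
          ≤ (n : ℝ) ^ m * (7 / 6 * u n ^ 3 * Real.exp (-u n)) ^ (m + 1) := by gcongr
        _ = (7 / 6 : ℝ) ^ (m + 1) * (u n ^ (3 * (m + 1)) *
              ((Real.exp (u n) * Real.exp (-u n)) ^ m * Real.exp (-u n))) := by
            rw [h3, mul_pow, mul_pow, mul_pow, ← pow_mul]
            ring
        _ = _ := by rw [← Real.exp_add]; simp
    have hsx : Tendsto (fun n => meetProb (K n) (P n) * Real.exp (3 / 4 * x n))
        (atTop ⊓ 𝓟 Bᶜ) (𝓝 0) := by
      have h1 := ((Real.tendsto_pow_mul_exp_neg_atTop_nhds_zero 3).comp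
        ((hu.mono_left hl).atTop_div_const (show (0 : ℝ) < 8 by norm_num))).const_mul
          (7 / 6 * 8 ^ 3 : ℝ)
      rw [mul_zero] at h1
      refine squeeze_zero' (.of_forall fun n => by
        have := meetProb_nonneg (K := K n) (P := P n)
        positivity) ?_ h1
      filter_upwards [hs, hl hx2, hl (hu.eventually_gt_atTop 0)] with n h2 h3 h4
      calc meetProb (K n) (P n) * Real.exp (3 / 4 * x n)
          ≤ 7 / 6 * u n ^ 3 * Real.exp (-u n) * Real.exp (7 / 8 * u n) := by
            have h5 := Real.exp_le_exp.mpr (show 3 / 4 * x n ≤ 7 / 8 * u n by linarith)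
            exact mul_le_mul h2 h5 (Real.exp_pos _).le (by positivity)
        _ = 7 / 6 * u n ^ 3 * Real.exp (-(u n / 8)) := by
            rw [mul_assoc, ← Real.exp_add]
            congr 2
            ring
        _ = _ := by simp only [Function.comp]; ring
    exact tendsto_isKConnected_of_moments h
      (fun m hm => tendsto_sum_lowDegree_of_meet hl h hm (hx.mono_left hl) (hc.mono_left hl) (hl hC)
        (hK.mono_left hl) hmom hsx)
      (tendsto_minDegreeGE_not_isKConnected_of_meet _ hl (hx.mono_left hl) (hl hC)
        (hK.mono_left hl) (hl hP) (by simpa using hmom 0) (hmom 2))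

end Limit

theorem theorem1 (k : ℕ) (hk : 1 ≤ k)
    (K P : ℕ → ℕ) (p : ℕ → unitInterval) (hKP : ∀ n, K n ≤ P n)
    (hP : (fun n : ℕ => (n : ℝ)) =O[atTop] fun n : ℕ => (P n : ℝ))
    (hKPo : (fun n : ℕ => (K n : ℝ) / (P n : ℝ)) =o[atTop] fun _ : ℕ => (1 : ℝ))
    (q α : ℕ → ℝ) (αstar : ℝ)
    (hq : ∀ n, ∀ u v : Fin n, u ≠ v →
      q n = (secureGraph n (K n) (P n) (p n)).real {G | G.Adj u v})
    (hα : ∀ᶠ n : ℕ in atTop,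
      q n = (Real.log n + ((k : ℝ) - 1) * Real.log (Real.log n) + α n) / n)
    (hlim : Tendsto α atTop (𝓝 αstar)) :
    Tendsto (fun n : ℕ =>
        (secureGraph n (K n) (P n) (p n)).real {G | G.IsKConnected k})
      atTop (𝓝 (Real.exp (-(Real.exp (-αstar) / (Nat.factorial (k - 1) : ℝ))))) := by
  obtain ⟨h, rfl⟩ := Nat.exists_eq_add_of_le' hk
  have (n : ℕ) : Nonempty (KeyRing (K n) (P n)) := nonempty_keyRing (hKP n)
  obtain ⟨C', hC', hPC⟩ := hP.exists_pos
  have hP' : ∀ᶠ n : ℕ in atTop, (n : ℝ) ≤ C' * P n := by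
    filter_upwards [hPC.bound] with n hn
    simpa using hn
  have hxa : ∀ᶠ n : ℕ in atTop, n * edgeProb (K n) (P n) (p n) =
      Real.log n + h * Real.log (Real.log n) + α n := by
    filter_upwards [hα, eventually_ge_atTop 2] with n h1 h2
    have hne : (⟨0, by omega⟩ : Fin n) ≠ ⟨1, by omega⟩ := by simp
    have h3 := hq n _ _ hne
    rw [secureGraph_real] at h3
    simp only [Set.mem_ofPred_eq] at h3
    rw [sampleLaw_real_adj hne] at h3
    have hn : (n : ℝ) ≠ 0 := by
      have : n ≠ 0 := by omega
      exact_mod_cast this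
    rw [← h3, h1, mul_div_cancel₀ _ hn]
    push_cast
    ring
  rw [Nat.add_sub_cancel]
  refine (tendsto_isKConnected h hlim hxa hC' hP').congr fun n => ?_
  rw [secureGraph_real]
  rfl
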